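/- Let $\mathbb K\in\{\mathbb R,\mathbb C\}$. Lie groups are groups that are smooth manifolds modelled on Hausdorff locally convex $\mathbb K$-vector spaces, with smooth multiplication and inversion (a map is $C^1$ if it is continuous and its directional derivatives exist and depend continuously on the point and the direction, $C^{n+1}$ if it is $C^1$ and its differential is $C^n$, smooth if it is $C^n$ for all $n$). A subgroup $H$ of a Lie group $P$ is a split Lie subgroup if it carries a Lie group structure with smooth inclusion, and $P/H$ a manifold structure, for which $P\to P/H$ is a smooth $H$-principal bundle. A Lie group extension $A\hookrightarrow P\to B$ is a short exact sequence of Lie group morphisms which is a smooth $A$-principal bundle. For a Lie group $\Gamma$ and a Lie group $A$, $C^p_s(\Gamma,A)$ is the set of maps $\Gamma^p\to A$ that are smooth in an identity neighbourhood and equal to $1$ whenever one argument is $1$. $C^2_{ss}(\Gamma,A)$ is the set of those $\omega\in C^2_s(\Gamma,A)$ for which, for every $g\in\Gamma$, the map $x\mapsto\omega(g,x)\,\omega(gxg^{-1},g)^{-1}$ is smooth in an identity neighbourhood. For a smooth $\Gamma$-module $A$, $d$ denotes the group differential, $Z^p$ the cocycles in $C^p$, and $H^3_{ss}(\Gamma,A)=Z^3_s(\Gamma,A)/d\,C^2_{ss}(\Gamma,A)$.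 Let $G$ be a Lie group, $N\trianglelefteq G$ a normal split Lie subgroup, $q_0:G\to G/N$ the quotient map, $Z$ a smooth (abelian) $G$-module, written additively, and $g.n=gng^{-1}$ for $g\in G$, $n\in N$. Let $f\in Z^2_{ss}(N,Z)$ (for the trivial action of $N$ on $Z$) and let $\widehat N=Z\times_fN$ be the set $Z\times N$ with the product $(z,n)(z',n')=(z+z'+f(n,n'),nn')$. Then $\widehat N$ carries a Lie group structure for which, for some open identity neighbourhood $U\subseteq N$, the map $Z\times U\to\widehat N$, $(z,n)\mapsto(z,n)$, is a diffeomorphism onto an open subset; equip $\widehat N$ with it. Let $\theta:G\to C^1_s(N,Z)$ be a $1$-cocycle, i.e. $\theta(gg')(n)=\theta(g)(n)+g.\theta(g')(g^{-1}ng)$, such that $(g,n)\mapsto\theta(g)(n)$ is smooth in an identity neighbourhood of $G\times N$, such that for each $n\in N$ the map $g\mapsto\theta(g)(g.n)+f(g.n,n^{-1})$ is smooth in an identity neighbourhood of $G$, and such that $$\theta(g)(n)+\theta(g)(n')-\theta(g)(nn')=g.f(g^{-1}ng,g^{-1}n'g)-f(n,n')\qquad(g\in G,\ n,n'\in N).$$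 Then $\widehat S(g)(z,n)=(g.z+\theta(g)(g.n),\,g.n)$ defines a homomorphism $\widehat S:G\to\mathrm{Aut}(\widehat N)$ into the automorphism group of the abstract group $\widehat N$. Suppose that $\alpha:\widehat N\to G$, $(z,n)\mapsto n$, together with $\widehat S$ is a smooth crossed module. That is: $\alpha$ and the action map $G\times\widehat N\to\widehat N$ are smooth; $\alpha(\widehat S(g)(x))=g\alpha(x)g^{-1}$ and $\widehat S(\alpha(x))(y)=xyx^{-1}$ for $g\in G$, $x,y\in\widehat N$; $\ker\alpha$ and $\mathrm{im}\,\alpha$ are split Lie subgroups of $\widehat N$ and $G$; and $\alpha$ induces an isomorphism of Lie groups $\widehat N/\ker\alpha\to\mathrm{im}\,\alpha$. (Then $N$ acts trivially on $Z$, so that $Z$ is a $G/N$-module.) Let $\sigma\in C^1_s(G/N,G)$ with $q_0\circ\sigma=\mathrm{id}$ and let $\omega\in C^2_{ss}(G/N,\widehat N)$ be such that the $N$-component of $\omega(x,y)$ is $\delta_\sigma(x,y)=\sigma(x)\sigma(y)\sigma(xy)^{-1}$. Put $S=\widehat S\circ\sigma$ and $$(d_S\omega)(x,y,w)=S(x)(\omega(y,w))\,\omega(x,yw)\,\omega(xy,w)^{-1}\,\omega(x,y)^{-1}.$$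 Then $d_S\omega$ takes values in $Z$ and is an element of $Z^3_s(G/N,Z)$; its class $Q_{ss}(f,\theta)=[d_S\omega]\in H^3_{ss}(G/N,Z)$ is the same for all choices of such $\sigma$ and $\omega$; and the following are equivalent: 1. $Q_{ss}(f,\theta)=0$ in $H^3_{ss}(G/N,Z)$. 2. There exist a Lie group extension $Z\hookrightarrow\widehat G\xrightarrow{q}G$ and a $G$-equivariant equivalence $\varphi:\widehat N\to q^{-1}(N)$ of extensions of $N$ by $Z$, where $q^{-1}(N)$ is regarded as a split Lie subgroup of $\widehat G$; $G$-equivariance means $\varphi(\widehat S(q(a))(x))=a\,\varphi(x)\,a^{-1}$ for $a\in\widehat G$, $x\in\widehat N$. 3. There exists $f_G\in Z^2_{ss}(G,Z)$ with $f_G(n,n')=f(n,n')$ for $n,n'\in N$ and $f_G(g,g^{-1}ng)-f_G(n,g)=\theta(g)(n)$ for $g\in G$, $n\in N$. -/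

import Mathlib

open Set Topology Filter

universe u

/-! ### Differential calculus in locally convex spaces -/

/-- `f` is of class `C^n` (in the sense of Michal and Bastiani) on the set `U`, which is meant to
be open. `f` is `C^0` if it is continuous. It is `C^(n+1)` if it is continuous, all directional
derivatives `df(x)(h) = lim_{t → 0} (f(x + t h) - f(x)) / t` exist for `x ∈ U`, and the
map `(x, h) ↦ df(x)(h)` is of class `C^n` on `U × E`. -/
def LCContDiffOn (𝕜 : Type*) [RCLike 𝕜] {F : Type*} [AddCommGroup F] [Module 𝕜 F]
    [TopologicalSpace F] :
    ℕ → ∀ {E : Type u} [AddCommGroup E] [Module 𝕜 E] [TopologicalSpace E],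
      (E → F) → Set E → Prop
  | 0, _, _, _, _, f, U => ContinuousOn f U
  | n + 1, E, _, _, _, f, U =>
      ContinuousOn f U ∧ ∃ df : E × E → F,
        (∀ x ∈ U, ∀ h : E,
          Tendsto (fun t : 𝕜 => t⁻¹ • (f (x + t • h) - f x)) (𝓝[≠] 0) (𝓝 (df (x, h)))) ∧
        LCContDiffOn 𝕜 n df (U ×ˢ univ)

/-- Smooth maps on open subsets of locally convex spaces. -/
def LCSmoothOn (𝕜 : Type*) [RCLike 𝕜] {E : Type u} {F : Type*}
    [AddCommGroup E] [Module 𝕜 E] [TopologicalSpace E]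
    [AddCommGroup F] [Module 𝕜 F] [TopologicalSpace F] (f : E → F) (U : Set E) : Prop :=
  ∀ n : ℕ, LCContDiffOn 𝕜 n f U

section Calculus

variable {𝕜 : Type*} [RCLike 𝕜] {F F' : Type*}
  [AddCommGroup F] [Module 𝕜 F] [TopologicalSpace F]
  [AddCommGroup F'] [Module 𝕜 F'] [TopologicalSpace F']

theorem LCContDiffOn.continuousOn {n : ℕ} {E : Type u} [AddCommGroup E] [Module 𝕜 E]
    [TopologicalSpace E] {f : E → F} {U : Set E} (h : LCContDiffOn 𝕜 n f U) :
    ContinuousOn f U := by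
  cases n with
  | zero => exact h
  | succ n => exact h.1

theorem LCContDiffOn.comp_linear (n : ℕ) : ∀ {E E' : Type u}
    [AddCommGroup E] [Module 𝕜 E] [TopologicalSpace E]
    [AddCommGroup E'] [Module 𝕜 E'] [TopologicalSpace E']
    (L : E' →L[𝕜] E) {f : E → F} {U : Set E} {V : Set E'},
    LCContDiffOn 𝕜 n f U → MapsTo L V U → LCContDiffOn 𝕜 n (fun x => f (L x)) V := by
  induction n with
  | zero =>
    intro E E' _ _ _ _ _ _ L f U V h hV
    exact ContinuousOn.comp (g := f) h L.continuous.continuousOn hV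
  | succ n ih =>
    intro E E' _ _ _ _ _ _ L f U V h hV
    obtain ⟨hc, df, hdf, hn⟩ := h
    refine ⟨hc.comp L.continuous.continuousOn hV, fun p => df (L.prodMap L p), ?_, ?_⟩
    · intro x hx k
      simpa using hdf (L x) (hV hx) (L k)
    · exact ih (L.prodMap L) hn (fun p hp => ⟨hV hp.1, mem_univ _⟩)

theorem LCContDiffOn.pair (n : ℕ) : ∀ {E : Type u}
    [AddCommGroup E] [Module 𝕜 E] [TopologicalSpace E]
    {f : E → F} {g : E → F'} {U : Set E},
    LCContDiffOn 𝕜 n f U → LCContDiffOn 𝕜 n g U →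
      LCContDiffOn 𝕜 n (fun x => (f x, g x)) U := by
  induction n with
  | zero =>
    intro E _ _ _ f g U hf hg
    exact ContinuousOn.prodMk hf hg
  | succ n ih =>
    intro E _ _ _ f g U hf hg
    obtain ⟨hc, df, hdf, hn⟩ := hf
    obtain ⟨hc', dg, hdg, hn'⟩ := hg
    refine ⟨hc.prodMk hc', fun p => (df p, dg p), ?_, ih hn hn'⟩
    intro x hx k
    exact (hdf x hx k).prodMk_nhds (hdg x hx k)

theorem LCContDiffOn.const (n : ℕ) : ∀ {E : Type u}
    [AddCommGroup E] [Module 𝕜 E] [TopologicalSpace E] (c : F) (U : Set E),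
    LCContDiffOn 𝕜 n (fun _ => c) U := by
  induction n with
  | zero => intro E _ _ _ c U; exact continuousOn_const
  | succ n ih =>
    intro E _ _ _ c U
    refine ⟨continuousOn_const, fun _ => 0, ?_, ih 0 _⟩
    intro x _ k
    simpa using (tendsto_const_nhds : Tendsto (fun _ : 𝕜 => (0 : F)) (𝓝[≠] 0) (𝓝 0))

end Calculus

/-! ### Smooth manifolds modelled on locally convex spaces, Lie groups -/

/-- A smooth (Hausdorff) manifold structure over `𝕜` on the type `M`, modelled on a Hausdorff
locally convex space `E`. -/
structure SmoothMfd (𝕜 : Type*) [RCLike 𝕜] (M : Type u) where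
  /-- the model space -/
  E : Type u
  [instAddCommGroup : AddCommGroup E]
  [instModule : Module 𝕜 E]
  [instModuleReal : Module ℝ E]
  [instScalarTower : IsScalarTower ℝ 𝕜 E]
  [instTopE : TopologicalSpace E]
  [instTopAddGroup : IsTopologicalAddGroup E]
  [instContSMul : ContinuousSMul 𝕜 E]
  [instT2E : T2Space E]
  [instLC : LocallyConvexSpace ℝ E]
  /-- the topology of the manifold -/
  top : TopologicalSpace M
  t2 : T2Space M
  /-- the charts -/
  atlas : Set (OpenPartialHomeomorph M E)
  cover : ∀ x : M, ∃ e ∈ atlas, x ∈ e.source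
  compat : ∀ e ∈ atlas, ∀ e' ∈ atlas,
    LCSmoothOn 𝕜 (fun v => e' (e.symm v)) (e.target ∩ e.symm ⁻¹' e'.source)

attribute [instance] SmoothMfd.instAddCommGroup SmoothMfd.instModule SmoothMfd.instModuleReal
  SmoothMfd.instScalarTower SmoothMfd.instTopE SmoothMfd.instTopAddGroup
  SmoothMfd.instContSMul SmoothMfd.instT2E SmoothMfd.instLC

namespace SmoothMfd

variable {𝕜 : Type*} [RCLike 𝕜] {M M' : Type u}

/-- `U` is open in the manifold `A`. -/
def IsOpenIn (A : SmoothMfd 𝕜 M) (U : Set M) : Prop := IsOpen[A.top] U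

/-- Smoothness of `f : M → M'` on the set `U`, which is meant to be open: `f` is continuous on
`U` and smooth in all charts. -/
def SmoothOn (A : SmoothMfd 𝕜 M) (B : SmoothMfd 𝕜 M') (f : M → M') (U : Set M) : Prop :=
  @ContinuousOn M M' A.top B.top f U ∧
    ∀ e ∈ A.atlas, ∀ e' ∈ B.atlas,
      LCSmoothOn 𝕜 (fun v => e' (f (e.invFun v))) (e.target ∩ e.invFun ⁻¹' (U ∩ f ⁻¹' e'.source))

/-- Smooth maps. -/
def Smooth (A : SmoothMfd 𝕜 M) (B : SmoothMfd 𝕜 M') (f : M → M') : Prop :=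
  A.SmoothOn B f univ

/-- `f` is smooth on some open neighbourhood of `x`. -/
def SmoothNear (A : SmoothMfd 𝕜 M) (B : SmoothMfd 𝕜 M') (f : M → M') (x : M) : Prop :=
  ∃ U : Set M, A.IsOpenIn U ∧ x ∈ U ∧ A.SmoothOn B f U

theorem smoothNear_const (A : SmoothMfd 𝕜 M) (B : SmoothMfd 𝕜 M') (c : M') (x : M) :
    A.SmoothNear B (fun _ => c) x := by
  let := A.top
  let := B.top
  exact ⟨univ, isOpen_univ, mem_univ _, continuousOn_const,
    fun _ _ _ _ n => LCContDiffOn.const n _ _⟩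

/-- The product manifold. -/
def prod (A : SmoothMfd 𝕜 M) (B : SmoothMfd 𝕜 M') : SmoothMfd 𝕜 (M × M') :=
  letI := A.top
  letI := B.top
  { E := A.E × B.E
    top := inferInstance
    t2 := haveI := A.t2; haveI := B.t2; inferInstance
    atlas := {e | ∃ a ∈ A.atlas, ∃ b ∈ B.atlas, e = a.prod b}
    cover := by
      intro x
      obtain ⟨a, ha, hxa⟩ := A.cover x.1
      obtain ⟨b, hb, hxb⟩ := B.cover x.2
      exact ⟨a.prod b, ⟨a, ha, b, hb, rfl⟩, ⟨hxa, hxb⟩⟩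
    compat := by
      rintro _ ⟨a, ha, b, hb, rfl⟩ _ ⟨a', ha', b', hb', rfl⟩ n
      have h1 := LCContDiffOn.comp_linear n (ContinuousLinearMap.fst 𝕜 A.E B.E)
        (V := ((a.prod b).target ∩ (a.prod b).symm ⁻¹' (a'.prod b').source))
        (A.compat a ha a' ha' n) (fun p hp => ⟨hp.1.1, hp.2.1⟩)
      have h2 := LCContDiffOn.comp_linear n (ContinuousLinearMap.snd 𝕜 A.E B.E)
        (V := ((a.prod b).target ∩ (a.prod b).symm ⁻¹' (a'.prod b').source))
        (B.compat b hb b' hb' n) (fun p hp => ⟨hp.1.2, hp.2.2⟩)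
      exact LCContDiffOn.pair n h1 h2 }

end SmoothMfd

/-- A Lie group structure on the group `G`: a smooth manifold structure modelled on a locally
convex space for which multiplication and inversion are smooth. -/
structure LieGroupStr (𝕜 : Type*) [RCLike 𝕜] (G : Type u) [Group G] extends
    SmoothMfd 𝕜 G where
  smooth_mul : (toSmoothMfd.prod toSmoothMfd).Smooth toSmoothMfd (fun p : G × G => p.1 * p.2)
  smooth_inv : toSmoothMfd.Smooth toSmoothMfd (fun g : G => g⁻¹)

/-! ### Split Lie subgroups and extensions of Lie groups -/

section Bundles

variable {𝕜 : Type*} [RCLike 𝕜] {H P B : Type u} [Group H] [Group P]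

/-- The injective homomorphism `ι : H → P` of Lie groups and the smooth map `π : P → B` turn `P`
into a smooth principal bundle over the manifold `B` for the right action `p.h = p ι(h)`
of `H` on `P`: the fibres of `π` are the orbits of `H`, and over suitable open sets `U` covering
`B` there are smooth sections `s` such that `U × H → π⁻¹(U), (b, h) ↦ s(b) ι(h)` is a
diffeomorphism (`k` is the `H`-component of its inverse). -/
structure IsCosetBundle (LH : LieGroupStr 𝕜 H) (LP : LieGroupStr 𝕜 P) (MB : SmoothMfd 𝕜 B)
    (ι : H →* P) (π : P → B) : Prop where
  injective : Function.Injective ι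
  smooth_incl : LH.Smooth LP.toSmoothMfd ι
  smooth_proj : LP.Smooth MB π
  fibre : ∀ p p' : P, π p = π p' ↔ ∃ h : H, p' = p * ι h
  local_triv : ∀ b : B, ∃ U : Set B, MB.IsOpenIn U ∧ b ∈ U ∧
    ∃ (s : B → P) (k : P → H),
      MB.SmoothOn LP.toSmoothMfd s U ∧ (∀ y ∈ U, π (s y) = y) ∧
      LP.SmoothOn LH.toSmoothMfd k (π ⁻¹' U) ∧ (∀ p ∈ π ⁻¹' U, p = s (π p) * ι (k p))

/-- The subgroup `K` of the Lie group `P`, with the Lie group structure `LK` on `K`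
and the manifold structure `MQ` on the space `P ⧸ K` of cosets `p K`, is a split Lie subgroup. -/
def IsSplitLieSubgroup (LP : LieGroupStr 𝕜 P) (K : Subgroup P) (LK : LieGroupStr 𝕜 K)
    (MQ : SmoothMfd 𝕜 (P ⧸ K)) : Prop :=
  IsCosetBundle LK LP MQ K.subtype (fun p => (p : P ⧸ K))

/-- `1 → H → P → B → 1` is an extension of Lie groups: a short exact sequence of Lie group
morphisms for which `P` is a smooth `H`-principal bundle over `B`. -/
def IsLieGroupExtension [Group B] (LH : LieGroupStr 𝕜 H) (LP : LieGroupStr 𝕜 P)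
    (LB : LieGroupStr 𝕜 B) (ι : H →* P) (q : P →* B) : Prop :=
  ι.range = q.ker ∧ Function.Surjective q ∧ IsCosetBundle LH LP LB.toSmoothMfd ι q

/-- A smooth crossed module `α : H → P` with the action `S` of `P` on `H`. -/
structure IsSmoothCrossedModule (LH : LieGroupStr 𝕜 H) (LP : LieGroupStr 𝕜 P)
    (α : H →* P) (S : P →* MulAut H) : Prop where
  smooth_hom : LH.Smooth LP.toSmoothMfd α
  smooth_action : (LP.prod LH.toSmoothMfd).Smooth LH.toSmoothMfd (fun x : P × H => S x.1 x.2)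
  equivariant : ∀ (g : P) (h : H), α (S g h) = g * α h * g⁻¹
  peiffer : ∀ h h' : H, S (α h) h' = h * h' * h⁻¹
  /-- kernel and range of `α` are split Lie subgroups and `α` induces an isomorphism
  `H / ker α → im α` of Lie groups -/
  split : ∃ (LK : LieGroupStr 𝕜 α.ker) (MQ : SmoothMfd 𝕜 (H ⧸ α.ker))
      (LI : LieGroupStr 𝕜 α.range) (MC : SmoothMfd 𝕜 (P ⧸ α.range)),
    IsSplitLieSubgroup LH α.ker LK MQ ∧ IsSplitLieSubgroup LP α.range LI MC ∧
    MQ.Smooth LI.toSmoothMfd (QuotientGroup.quotientKerEquivRange α) ∧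
    LI.Smooth MQ (QuotientGroup.quotientKerEquivRange α).symm

end Bundles

/-! ### Locally smooth cochains -/

section Cochains

variable {𝕜 : Type*} [RCLike 𝕜] {Γ A : Type u} [Group Γ]

/-- Normalized locally smooth `1`-cochains, `C^1_s(Γ, A)`. -/
def IsC1s [Group A] (MΓ : SmoothMfd 𝕜 Γ) (MA : SmoothMfd 𝕜 A) (h : Γ → A) : Prop :=
  h 1 = 1 ∧ MΓ.SmoothNear MA h 1

/-- Normalized locally smooth `2`-cochains, `C^2_s(Γ, A)`. -/
def IsC2s [Group A] (MΓ : SmoothMfd 𝕜 Γ) (MA : SmoothMfd 𝕜 A) (ω : Γ → Γ → A) : Prop :=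
  (∀ g, ω 1 g = 1) ∧ (∀ g, ω g 1 = 1) ∧
    (MΓ.prod MΓ).SmoothNear MA (fun p => ω p.1 p.2) (1, 1)

/-- The set `C^2_ss(Γ, A)` of those `ω ∈ C^2_s(Γ, A)` for which all the functions
`ω_g(x) = ω(g, x) ω(g x g⁻¹, g)⁻¹` are smooth in an identity neighbourhood. -/
def IsC2ss [Group A] (MΓ : SmoothMfd 𝕜 Γ) (MA : SmoothMfd 𝕜 A) (ω : Γ → Γ → A) : Prop :=
  IsC2s MΓ MA ω ∧
    ∀ g, MΓ.SmoothNear MA (fun x => ω g x * (ω (g * x * g⁻¹) g)⁻¹) 1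

/-- Normalized locally smooth `3`-cochains, `C^3_s(Γ, A)`. -/
def IsC3s [Group A] (MΓ : SmoothMfd 𝕜 Γ) (MA : SmoothMfd 𝕜 A) (c : Γ → Γ → Γ → A) : Prop :=
  (∀ g g', c 1 g g' = 1) ∧ (∀ g g', c g 1 g' = 1) ∧ (∀ g g', c g g' 1 = 1) ∧
    (MΓ.prod (MΓ.prod MΓ)).SmoothNear MA (fun p => c p.1 p.2.1 p.2.2) (1, 1, 1)

/-- `δ_σ(g, g') = σ(g) σ(g') σ(g g')⁻¹`. -/
def deltaMap [Group A] (σ : Γ → A) (g g' : Γ) : A := σ g * σ g' * (σ (g * g'))⁻¹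

/-- `(d_S ω)(g, g', g'') = S(g)(ω(g', g'')) ω(g, g' g'') ω(g g', g'')⁻¹ ω(g, g')⁻¹`.
If `A` is abelian and `S` is a homomorphism, this is the group differential on `2`-cochains,
written multiplicatively. -/
def dTwo [Group A] (S : Γ → MulAut A) (ω : Γ → Γ → A) (g g' g'' : Γ) : A :=
  S g (ω g' g'') * ω g (g' * g'') * (ω (g * g') g'')⁻¹ * (ω g g')⁻¹

/-- The group differential on `3`-cochains with values in an abelian group, written
multiplicatively. -/
def dThree [CommGroup A] (ρ : Γ → MulAut A) (c : Γ → Γ → Γ → A) (g₀ g₁ g₂ g₃ : Γ) : A :=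
  ρ g₀ (c g₁ g₂ g₃) * (c (g₀ * g₁) g₂ g₃)⁻¹ * c g₀ (g₁ * g₂) g₃ * (c g₀ g₁ (g₂ * g₃))⁻¹ *
    c g₀ g₁ g₂

/-- `Z^2_ss(Γ, A)` for the abelian group `A` with the action `ρ` of `Γ`. -/
structure Z2ss [CommGroup A] (MΓ : SmoothMfd 𝕜 Γ) (MA : SmoothMfd 𝕜 A) (ρ : Γ →* MulAut A) where
  /-- the underlying function -/
  fn : Γ → Γ → A
  c2ss : IsC2ss MΓ MA fn
  cocycle : ∀ g g' g'', dTwo ρ fn g g' g'' = 1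

/-- `Z^3_s(Γ, A)` for the abelian group `A` with the action `ρ` of `Γ`. -/
structure Z3s [CommGroup A] (MΓ : SmoothMfd 𝕜 Γ) (MA : SmoothMfd 𝕜 A) (ρ : Γ →* MulAut A) where
  /-- the underlying function -/
  fn : Γ → Γ → Γ → A
  c3s : IsC3s MΓ MA fn
  cocycle : ∀ g₀ g₁ g₂ g₃, dThree ρ fn g₀ g₁ g₂ g₃ = 1

/-- The zero cocycle (the constant `1` in multiplicative notation). -/
def Z3s.trivial [CommGroup A] (MΓ : SmoothMfd 𝕜 Γ) (MA : SmoothMfd 𝕜 A) (ρ : Γ →* MulAut A) :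
    Z3s MΓ MA ρ where
  fn := fun _ _ _ => 1
  c3s := ⟨fun _ _ => rfl, fun _ _ => rfl, fun _ _ => rfl, SmoothMfd.smoothNear_const _ _ _ _⟩
  cocycle := by intros; simp [dThree]

/-- `H^3_ss(Γ, A) = Z^3_s(Γ, A) / d(C^2_ss(Γ, A))`: two cocycles define the same class iff
they differ by `d β` for some `β ∈ C^2_ss(Γ, A)`. -/
def H3ss [CommGroup A] (MΓ : SmoothMfd 𝕜 Γ) (MA : SmoothMfd 𝕜 A) (ρ : Γ →* MulAut A) :
    Type u :=
  Quot (fun c c' : Z3s MΓ MA ρ => ∃ β : Γ → Γ → A, IsC2ss MΓ MA β ∧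
    ∀ g g' g'', c'.fn g g' g'' = c.fn g g' g'' * dTwo ρ β g g' g'')

/-- The cohomology class of a cocycle. -/
def H3ss.mk [CommGroup A] {MΓ : SmoothMfd 𝕜 Γ} {MA : SmoothMfd 𝕜 A} {ρ : Γ →* MulAut A}
    (c : Z3s MΓ MA ρ) : H3ss MΓ MA ρ := Quot.mk _ c

/-- The neutral element of `H^3_ss(Γ, A)`. -/
def H3ss.trivial [CommGroup A] (MΓ : SmoothMfd 𝕜 Γ) (MA : SmoothMfd 𝕜 A) (ρ : Γ →* MulAut A) :
    H3ss MΓ MA ρ := H3ss.mk (Z3s.trivial MΓ MA ρ)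

end Cochains

/-! ### Central extensions defined by cocycles -/

/-- The set underlying the central extension `A ×_f Γ` defined by `f ∈ Z^2_ss(Γ, A)`,
where `Γ` acts trivially on `A`. -/
@[ext]
structure CentralExt {𝕜 : Type*} [RCLike 𝕜] {Γ A : Type u} [Group Γ] [CommGroup A]
    {MΓ : SmoothMfd 𝕜 Γ} {MA : SmoothMfd 𝕜 A} (f : Z2ss MΓ MA 1) where
  fst : A
  snd : Γ

namespace CentralExt

variable {𝕜 : Type*} [RCLike 𝕜] {Γ A : Type u} [Group Γ] [CommGroup A]
  {MΓ : SmoothMfd 𝕜 Γ} {MA : SmoothMfd 𝕜 A}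

theorem cocycle_eq (f : Z2ss MΓ MA 1) (a b c : Γ) :
    f.fn b c * f.fn a (b * c) = f.fn a b * f.fn (a * b) c := by
  have h := f.cocycle a b c
  simp only [dTwo, MonoidHom.one_apply, MulAut.one_apply] at h
  rw [mul_inv_eq_one, mul_inv_eq_iff_eq_mul] at h
  exact h

theorem cocycle_inv (f : Z2ss MΓ MA 1) (a : Γ) : f.fn a⁻¹ a = f.fn a a⁻¹ := by
  have h := cocycle_eq f a a⁻¹ a
  simpa [f.c2ss.1.1, f.c2ss.1.2.1] using h

/-- The group structure `(a, n)(a', n') = (a a' f(n, n'), n n')`. -/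
instance (f : Z2ss MΓ MA 1) : Group (CentralExt f) where
  mul x y := ⟨x.fst * y.fst * f.fn x.snd y.snd, x.snd * y.snd⟩
  one := ⟨1, 1⟩
  inv x := ⟨x.fst⁻¹ * (f.fn x.snd⁻¹ x.snd)⁻¹, x.snd⁻¹⟩
  mul_assoc x y z := by
    refine CentralExt.ext ?_ (mul_assoc _ _ _)
    change x.fst * y.fst * f.fn x.snd y.snd * z.fst * f.fn (x.snd * y.snd) z.snd =
      x.fst * (y.fst * z.fst * f.fn y.snd z.snd) * f.fn x.snd (y.snd * z.snd)
    have h := cocycle_eq f x.snd y.snd z.snd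
    calc _ = x.fst * y.fst * z.fst * (f.fn x.snd y.snd * f.fn (x.snd * y.snd) z.snd) := by
          simp only [mul_assoc, mul_comm, mul_left_comm]
      _ = _ := by rw [← h]; simp only [mul_assoc]
  one_mul x := by
    refine CentralExt.ext ?_ (one_mul _)
    change 1 * x.fst * f.fn 1 x.snd = x.fst
    rw [f.c2ss.1.1]; simp
  mul_one x := by
    refine CentralExt.ext ?_ (mul_one _)
    change x.fst * 1 * f.fn x.snd 1 = x.fst
    rw [f.c2ss.1.2.1]; simp
  inv_mul_cancel x := by
    refine CentralExt.ext ?_ (inv_mul_cancel _)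
    change x.fst⁻¹ * (f.fn x.snd⁻¹ x.snd)⁻¹ * x.fst * f.fn x.snd⁻¹ x.snd = 1
    rw [mul_right_comm, inv_mul_cancel_right, inv_mul_cancel]

theorem mul_fst {f : Z2ss MΓ MA 1} (x y : CentralExt f) :
    (x * y).fst = x.fst * y.fst * f.fn x.snd y.snd := rfl

theorem mul_snd {f : Z2ss MΓ MA 1} (x y : CentralExt f) : (x * y).snd = x.snd * y.snd := rfl

theorem one_fst {f : Z2ss MΓ MA 1} : (1 : CentralExt f).fst = 1 := rfl

theorem one_snd {f : Z2ss MΓ MA 1} : (1 : CentralExt f).snd = 1 := rfl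

/-- The quotient homomorphism `A ×_f Γ → Γ`. -/
def proj (f : Z2ss MΓ MA 1) : CentralExt f →* Γ where
  toFun x := x.snd
  map_one' := rfl
  map_mul' _ _ := rfl

/-- The inclusion `A → A ×_f Γ`. -/
def incl (f : Z2ss MΓ MA 1) : A →* CentralExt f where
  toFun a := ⟨a, 1⟩
  map_one' := rfl
  map_mul' a b := by
    refine CentralExt.ext ?_ (mul_one _).symm
    change a * b = a * b * f.fn 1 1
    rw [f.c2ss.1.1]; simp

/-- `L` is the Lie group structure on `A ×_f Γ` for which, for some open identity
neighbourhood `U` in `Γ`, the map `A × U → A ×_f Γ, (a, n) ↦ (a, n)` is a diffeomorphism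
onto an open subset. -/
def IsStandard {f : Z2ss MΓ MA 1} (L : LieGroupStr 𝕜 (CentralExt f)) : Prop :=
  ∃ U : Set Γ, MΓ.IsOpenIn U ∧ (1 : Γ) ∈ U ∧
    (MA.prod MΓ).SmoothOn L.toSmoothMfd (fun p => ⟨p.1, p.2⟩) (univ ×ˢ U) ∧
    L.IsOpenIn {x | x.snd ∈ U} ∧
    L.SmoothOn (MA.prod MΓ) (fun x => (x.fst, x.snd)) {x | x.snd ∈ U}

end CentralExt

/-! ### The action defined by `θ` and the obstruction class -/

section Crossed

variable {𝕜 : Type*} [RCLike 𝕜] {G Z : Type u} [Group G] [CommGroup Z]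
  {N : Subgroup G} [N.Normal]

/-- The set `Z^1_ss(G, C^1_s(N, Z))_f`: cocycles `θ` for the action
`(g.α)(n) = g.α(g⁻¹ n g)` of `G` on `C^1_s(N, Z)`, such that `(g, n) ↦ θ(g)(n)` is smooth in an
identity neighbourhood and, for each `n`, so is `g ↦ θ(g)(g.n) f(g.n, n⁻¹)`,
where `g.n = g n g⁻¹`. -/
structure IsZ1ss (LG : LieGroupStr 𝕜 G) (LZ : LieGroupStr 𝕜 Z) (LN : LieGroupStr 𝕜 N)
    (ρ : G →* MulAut Z) (f : Z2ss LN.toSmoothMfd LZ.toSmoothMfd 1) (θ : G → N → Z) : Prop where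
  c1s : ∀ g, IsC1s LN.toSmoothMfd LZ.toSmoothMfd (θ g)
  smooth : (LG.prod LN.toSmoothMfd).SmoothNear LZ.toSmoothMfd (fun p => θ p.1 p.2) (1, 1)
  orbit : ∀ n : N, LG.SmoothNear LZ.toSmoothMfd
    (fun g => θ g (MulAut.conjNormal g n) * f.fn (MulAut.conjNormal g n) n⁻¹) 1
  cocycle : ∀ (g g' : G) (n : N),
    θ (g * g') n = θ g n * ρ g (θ g' (MulAut.conjNormal g⁻¹ n))

/-- The relation `d_N(θ(g)) = g.f - f` for all `g ∈ G`, written multiplicatively. -/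
def IsCompatible {LN : LieGroupStr 𝕜 N} {LZ : LieGroupStr 𝕜 Z} (ρ : G →* MulAut Z)
    (f : Z2ss LN.toSmoothMfd LZ.toSmoothMfd 1) (θ : G → N → Z) : Prop :=
  ∀ (g : G) (n n' : N), θ g n' * (θ g (n * n'))⁻¹ * θ g n =
    ρ g (f.fn (MulAut.conjNormal g⁻¹ n) (MulAut.conjNormal g⁻¹ n')) * (f.fn n n')⁻¹

variable {LG : LieGroupStr 𝕜 G} {LZ : LieGroupStr 𝕜 Z} {LN : LieGroupStr 𝕜 N}
  {ρ : G →* MulAut Z} {f : Z2ss LN.toSmoothMfd LZ.toSmoothMfd 1} {θ : G → N → Z}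

theorem IsZ1ss.one (hθ : IsZ1ss LG LZ LN ρ f θ) (n : N) : θ 1 n = 1 := by
  have h := hθ.cocycle 1 1 n
  simpa using h

/-- The homomorphism `Ŝ : G → Aut(Z ×_f N)`,
`Ŝ(g)(z, n) = (g.z · θ(g)(g.n), g.n)` with `g.n = g n g⁻¹`. -/
def extAction (hθ : IsZ1ss LG LZ LN ρ f θ) (hc : IsCompatible ρ f θ) :
    G →* MulAut (CentralExt f) :=
  letI act : MulDistribMulAction G (CentralExt f) :=
    { smul := fun g x =>
        ⟨ρ g x.fst * θ g (MulAut.conjNormal g x.snd), MulAut.conjNormal g x.snd⟩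
      one_smul := by
        intro x
        refine CentralExt.ext ?_ ?_
        · change ρ 1 x.fst * θ 1 (MulAut.conjNormal 1 x.snd) = x.fst
          simp [hθ.one]
        · change MulAut.conjNormal (1 : G) x.snd = x.snd
          simp
      mul_smul := by
        intro g g' x
        refine CentralExt.ext ?_ ?_
        · change ρ (g * g') x.fst * θ (g * g') (MulAut.conjNormal (g * g') x.snd) =
            ρ g (ρ g' x.fst * θ g' (MulAut.conjNormal g' x.snd)) *
              θ g (MulAut.conjNormal g (MulAut.conjNormal g' x.snd))
          rw [hθ.cocycle, mul_comm (θ g _), ← mul_assoc]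
          simp
        · change MulAut.conjNormal (g * g') x.snd =
            MulAut.conjNormal g (MulAut.conjNormal g' x.snd)
          simp
      smul_one := by
        intro g
        refine CentralExt.ext ?_ ?_
        · change ρ g 1 * θ g (MulAut.conjNormal g 1) = 1
          simp [(hθ.c1s g).1]
        · change MulAut.conjNormal g (1 : N) = 1
          simp
      smul_mul := by
        intro g x y
        refine CentralExt.ext ?_ ?_
        · change ρ g (x.fst * y.fst * f.fn x.snd y.snd) *
              θ g (MulAut.conjNormal g (x.snd * y.snd)) =
            ρ g x.fst * θ g (MulAut.conjNormal g x.snd) *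
              (ρ g y.fst * θ g (MulAut.conjNormal g y.snd)) *
              f.fn (MulAut.conjNormal g x.snd) (MulAut.conjNormal g y.snd)
          have h := hc g (MulAut.conjNormal g x.snd) (MulAut.conjNormal g y.snd)
          simp only [← MulAut.mul_apply, ← map_mul, inv_mul_cancel, map_one,
            MulAut.one_apply] at h
          rw [eq_mul_inv_iff_mul_eq] at h
          rw [map_mul, map_mul, ← h]
          simp [mul_assoc, mul_comm, mul_left_comm]
        · change MulAut.conjNormal g (x.snd * y.snd) =
            MulAut.conjNormal g x.snd * MulAut.conjNormal g y.snd
          simp }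
  MulDistribMulAction.toMulAut G (CentralExt f)

theorem extAction_apply (hθ : IsZ1ss LG LZ LN ρ f θ) (hc : IsCompatible ρ f θ) (g : G)
    (x : CentralExt f) : extAction hθ hc g x =
      ⟨ρ g x.fst * θ g (MulAut.conjNormal g x.snd), MulAut.conjNormal g x.snd⟩ := rfl

/-- The homomorphism `α : Z ×_f N → G, (z, n) ↦ n`. -/
def alphaHom (f : Z2ss LN.toSmoothMfd LZ.toSmoothMfd 1) : CentralExt f →* G :=
  N.subtype.comp (CentralExt.proj f)

theorem IsSmoothCrossedModule.le_ker {hθ : IsZ1ss LG LZ LN ρ f θ} {hc : IsCompatible ρ f θ}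
    {L : LieGroupStr 𝕜 (CentralExt f)}
    (h : IsSmoothCrossedModule L LG (alphaHom f) (extAction hθ hc)) : N ≤ ρ.ker := by
  intro n hn
  rw [MonoidHom.mem_ker]
  ext z
  have h1 := h.peiffer ⟨1, ⟨n, hn⟩⟩ ⟨z, 1⟩
  have h2 : (⟨1, ⟨n, hn⟩⟩ : CentralExt f) * ⟨z, 1⟩ = ⟨z, 1⟩ * ⟨1, ⟨n, hn⟩⟩ := by
    refine CentralExt.ext ?_ ?_
    · simp [CentralExt.mul_fst, f.c2ss.1.1, f.c2ss.1.2.1]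
    · simp [CentralExt.mul_snd]
  rw [h2, mul_inv_cancel_right] at h1
  have h3 := congrArg CentralExt.fst h1
  rw [extAction_apply] at h3
  simpa [(hθ.c1s _).1, alphaHom, CentralExt.proj] using h3

/-- The action of `G ⧸ N` on `Z` induced by the action `ρ` of `G`, on which `N` acts trivially. -/
def quotAction (ρ : G →* MulAut Z) (h : N ≤ ρ.ker) : G ⧸ N →* MulAut Z :=
  QuotientGroup.lift N ρ h

/-- `σ : G/N → G` is a normalized locally smooth section, and `ω ∈ C^2_ss(G/N, Z ×_f N)`
lifts `δ_σ` to `Z ×_f N`. -/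
structure IsFactorData (LG : LieGroupStr 𝕜 G) (MQ : SmoothMfd 𝕜 (G ⧸ N))
    (L : LieGroupStr 𝕜 (CentralExt f)) (σ : G ⧸ N → G) (ω : G ⧸ N → G ⧸ N → CentralExt f) :
    Prop where
  section_eq : ∀ x, (σ x : G ⧸ N) = x
  section_c1s : IsC1s MQ LG.toSmoothMfd σ
  c2ss : IsC2ss MQ L.toSmoothMfd ω
  lift_eq : ∀ x y, ((CentralExt.proj f (ω x y) : N) : G) = deltaMap σ x y

/-- The function `w : (G/N)^3 → Z ×_f N` takes values in `Z`, is an element of `Z^3_s(G/N, Z)`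
and `Q` is its class in `H^3_ss(G/N, Z)`. -/
def HasClass {MQ : SmoothMfd 𝕜 (G ⧸ N)} {ρ' : G ⧸ N →* MulAut Z}
    (w : G ⧸ N → G ⧸ N → G ⧸ N → CentralExt f) (Q : H3ss MQ LZ.toSmoothMfd ρ') : Prop :=
  ∃ c : Z3s MQ LZ.toSmoothMfd ρ', (∀ x y z, w x y z = CentralExt.incl f (c.fn x y z)) ∧
    H3ss.mk c = Q

/-- There is a Lie group extension `Z → Ĝ → G` (homomorphisms `ι` and `q`) together with a
`G`-equivariant equivalence `φ : Z ×_f N → q⁻¹(N)` of extensions of `N` by `Z`. Here `q⁻¹(N)`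
carries its structure `LP` of a split Lie subgroup of `Ĝ`, and `g = q(ĝ) ∈ G` acts on it by
conjugation with `ĝ`. -/
def HasEquivariantExtension (LG : LieGroupStr 𝕜 G) (L : LieGroupStr 𝕜 (CentralExt f))
    (S : G →* MulAut (CentralExt f)) : Prop :=
  ∃ (Ghat : Type u) (_ : Group Ghat) (LGhat : LieGroupStr 𝕜 Ghat) (ι : Z →* Ghat)
      (q : Ghat →* G),
    IsLieGroupExtension LZ LGhat LG ι q ∧
    ∃ (LP : LieGroupStr 𝕜 (N.comap q)) (MP : SmoothMfd 𝕜 (Ghat ⧸ N.comap q)),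
      IsSplitLieSubgroup LGhat (N.comap q) LP MP ∧
      ∃ (ιP : Z →* N.comap q) (φ : CentralExt f →* N.comap q),
        (∀ z, (ιP z : Ghat) = ι z) ∧
        IsLieGroupExtension LZ LP LN ιP (q.subgroupComap N) ∧
        L.Smooth LP.toSmoothMfd φ ∧
        (∀ z, φ (CentralExt.incl f z) = ιP z) ∧
        (∀ x, q.subgroupComap N (φ x) = CentralExt.proj f x) ∧
        (∀ (a : Ghat) (x : CentralExt f), (φ (S (q a) x) : Ghat) = a * φ x * a⁻¹)

/-- The cocycle `F ∈ Z^2_ss(G, Z)` restricts to `f` on `N × N`, and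
`F̃(g)(n) = F(g, g⁻¹ n g) - F(n, g)` restricts to `θ` on `G × N`. -/
def Extends (F : Z2ss LG.toSmoothMfd LZ.toSmoothMfd ρ)
    (f : Z2ss LN.toSmoothMfd LZ.toSmoothMfd 1) (θ : G → N → Z) : Prop :=
  (∀ n n' : N, F.fn n n' = f.fn n n') ∧
    ∀ (g : G) (n : N), F.fn g (g⁻¹ * n * g) * (F.fn n g)⁻¹ = θ g n

end Crossed

/-! This is Eilenberg–Mac Lane obstruction theory for a crossed module, carried out with cochains
that are smooth only near the identity. Since ω lies over δ_σ, and both bracketings of σ(x)σ(y)σ(z)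
agree, α kills d_Sω. The kernel Z of α is central by the Peiffer identity, so expanding one product
in two ways yields the 3-cocycle identity (`dTwo_cocycle`). Two sections differ by an N-valued
function, which lifts to N̂. Twisting ω by such a lift replaces the section and leaves d_Sω
unchanged (`dTwo_twistCochain`). Two cochains over the same δ_σ differ by a Z-valued cochain β,
which changes d_Sω by dβ (`dTwo_mul_central`). Hence the class is well defined.

(1) ⇒ (3): if the class vanishes, ω can be corrected so that d_Sω = 1. Pull σ and ω back to G and
twist by η(g) = (1, gσ(g)⁻¹). The section then becomes the identity map of G, so the twisted cochain
is Z-valued; it is the cocycle f_G (`IsFactorData.exists_extends`). (3) ⇒ (2): take Ĝ = Z ×_{f_G} G.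
The two conditions on f_G say that (z, n) ↦ (z, n) is a homomorphism N̂ → Ĝ and that it is
equivariant (`Extends.hasEquivariantExtension`). (2) ⇒ (1): lift σ to a section with values in Ĝ.
Its δ lies in q⁻¹(N) ≅ N̂, and associativity in Ĝ makes the resulting ω satisfy d_Sω = 1
(`HasEquivariantExtension.exists_factorData`).

The Lie groups come from local data: a manifold structure on a group yields a Lie group if
multiplication, inversion and every conjugation are smooth near the identity
(`IsLocalLie.exists_lieGroupStr`). In a twisted product, conjugation involves F(g,x)F(gxg⁻¹,g)⁻¹,
exactly the term controlled by C²_ss (`IsTwisted.conj_fst`). Smoothness of maps into Z, N and N̂ is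
tested in the ambient group through local retractions (`HasLocalRetraction.smoothNear`). All of this
rests on the chain rule `LCContDiffOn.comp`. -/

/-! ### The chain rule -/

section ChainRule

variable {𝕜 : Type*} [RCLike 𝕜]

/-- The directional derivative, as a limit of difference quotients. -/
noncomputable def lcDeriv (𝕜 : Type*) [RCLike 𝕜] {E F : Type*} [AddCommGroup E] [Module 𝕜 E]
    [AddCommGroup F] [Module 𝕜 F] [TopologicalSpace F] (f : E → F) (p : E × E) : F :=
  limUnder (𝓝[≠] (0 : 𝕜)) (fun t : 𝕜 => t⁻¹ • (f (p.1 + t • p.2) - f p.1))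

theorem LCContDiffOn.mono {F : Type*} [AddCommGroup F] [Module 𝕜 F] [TopologicalSpace F] (n : ℕ) :
    ∀ {E : Type u} [AddCommGroup E] [Module 𝕜 E] [TopologicalSpace E]
    {f : E → F} {U V : Set E}, LCContDiffOn 𝕜 n f U → V ⊆ U → LCContDiffOn 𝕜 n f V := by
  intro E _ _ _ f U V h hV
  exact LCContDiffOn.comp_linear n (ContinuousLinearMap.id 𝕜 E) h hV

theorem LCContDiffOn.of_succ {F : Type*} [AddCommGroup F] [Module 𝕜 F] [TopologicalSpace F]
    (n : ℕ) : ∀ {E : Type u} [AddCommGroup E] [Module 𝕜 E] [TopologicalSpace E]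
    {f : E → F} {U : Set E}, LCContDiffOn 𝕜 (n + 1) f U → LCContDiffOn 𝕜 n f U := by
  induction n with
  | zero => intro E _ _ _ f U h; exact h.1
  | succ n ih =>
    intro E _ _ _ f U h
    obtain ⟨hc, df, hdf, hn⟩ := h
    exact ⟨hc, df, hdf, ih hn⟩

theorem tendsto_add_smul {E : Type*} [AddCommGroup E] [Module 𝕜 E] [TopologicalSpace E]
    [IsTopologicalAddGroup E] [ContinuousSMul 𝕜 E] (x h : E) :
    Tendsto (fun t : 𝕜 => x + t • h) (𝓝[≠] 0) (𝓝 x) := by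
  have : Continuous (fun t : 𝕜 => x + t • h) := by fun_prop
  have h2 := this.tendsto 0
  simp only [zero_smul, add_zero] at h2
  exact h2.mono_left nhdsWithin_le_nhds

theorem LCContDiffOn.congr {F : Type*} [AddCommGroup F] [Module 𝕜 F] [TopologicalSpace F]
    {n : ℕ} {E : Type u} [AddCommGroup E] [Module 𝕜 E] [TopologicalSpace E]
    [IsTopologicalAddGroup E] [ContinuousSMul 𝕜 E] {f g : E → F} {U : Set E} (hU : IsOpen U)
    (h : LCContDiffOn 𝕜 n f U) (hfg : ∀ x ∈ U, g x = f x) : LCContDiffOn 𝕜 n g U := by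
  cases n with
  | zero => exact ContinuousOn.congr h hfg
  | succ n =>
    obtain ⟨hc, df, hdf, hn⟩ := h
    refine ⟨hc.congr hfg, df, fun x hx k => ?_, hn⟩
    refine (hdf x hx k).congr' ?_
    filter_upwards [tendsto_add_smul x k (hU.mem_nhds hx)] with t ht
    rw [hfg x hx, hfg _ ht]

/-- Limits in the Hausdorff space `F` are unique, so the derivative in the definition can be
replaced by a canonical one that does not depend on `U`. This is what allows local derivatives to be
glued. -/
theorem lcContDiffOn_succ_iff {F : Type*} [AddCommGroup F] [Module 𝕜 F] [TopologicalSpace F]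
    [T2Space F]
    {n : ℕ} {E : Type u} [AddCommGroup E] [Module 𝕜 E] [TopologicalSpace E]
    [IsTopologicalAddGroup E] [ContinuousSMul 𝕜 E] {f : E → F} {U : Set E} (hU : IsOpen U) :
    LCContDiffOn 𝕜 (n + 1) f U ↔ ContinuousOn f U ∧
      (∀ x ∈ U, ∀ h : E,
          Tendsto (fun t : 𝕜 => t⁻¹ • (f (x + t • h) - f x)) (𝓝[≠] 0)
            (𝓝 (lcDeriv 𝕜 f (x, h)))) ∧
        LCContDiffOn 𝕜 n (lcDeriv 𝕜 f) (U ×ˢ univ) := by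
  constructor
  · rintro ⟨hc, df, hdf, hn⟩
    have key : ∀ p ∈ U ×ˢ (univ : Set E), lcDeriv 𝕜 f p = df p := fun p hp =>
      (hdf p.1 hp.1 p.2).limUnder_eq
    refine ⟨hc, fun x hx h => ?_, hn.congr (hU.prod isOpen_univ) key⟩
    rw [key (x, h) ⟨hx, mem_univ _⟩]
    exact hdf x hx h
  · rintro ⟨hc, hd, hn⟩
    exact ⟨hc, _, hd, hn⟩

/-- The derivatives on the various `V` are all `lcDeriv 𝕜 f`, so the induction hypothesis applies to
this single function. -/
theorem LCContDiffOn.of_local {F : Type*} [AddCommGroup F] [Module 𝕜 F] [TopologicalSpace F]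
    [T2Space F] (n : ℕ) : ∀ {E : Type u} [AddCommGroup E] [Module 𝕜 E] [TopologicalSpace E]
    [IsTopologicalAddGroup E] [ContinuousSMul 𝕜 E] {f : E → F} {U : Set E},
    (∀ x ∈ U, ∃ V, IsOpen V ∧ x ∈ V ∧ LCContDiffOn 𝕜 n f V) → LCContDiffOn 𝕜 n f U := by
  have hcont : ∀ {m : ℕ} {E : Type u} [AddCommGroup E] [Module 𝕜 E] [TopologicalSpace E]
      [IsTopologicalAddGroup E] [ContinuousSMul 𝕜 E] {f : E → F} {U : Set E},
      (∀ x ∈ U, ∃ V, IsOpen V ∧ x ∈ V ∧ LCContDiffOn 𝕜 m f V) → ContinuousOn f U := by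
    intro m E _ _ _ _ _ f U h x hx
    obtain ⟨V, hV, hxV, hf⟩ := h x hx
    exact (hf.continuousOn.continuousAt (hV.mem_nhds hxV)).continuousWithinAt
  induction n with
  | zero => intro E _ _ _ _ _ f U h; exact hcont h
  | succ n ih =>
    intro E _ _ _ _ _ f U h
    refine ⟨hcont h, lcDeriv 𝕜 f, fun x hx k => ?_, ih ?_⟩
    · obtain ⟨V, hV, hxV, hf⟩ := h x hx
      exact ((lcContDiffOn_succ_iff hV).1 hf).2.1 x hxV k
    · rintro p ⟨hp, -⟩
      obtain ⟨V, hV, hxV, hf⟩ := h p.1 hp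
      exact ⟨V ×ˢ univ, hV.prod isOpen_univ, ⟨hxV, mem_univ _⟩,
        ((lcContDiffOn_succ_iff hV).1 hf).2.2⟩

/-! ### Difference quotients along a varying direction -/

section Slope

variable {E F : Type*} [AddCommGroup E] [Module 𝕜 E] [Module ℝ E] [IsScalarTower ℝ 𝕜 E]
  [AddCommGroup F] [Module 𝕜 F] [Module ℝ F] [IsScalarTower ℝ 𝕜 F] [TopologicalSpace F]

/-- The mean value theorem for a real functional applied to a difference quotient. -/
theorem exists_slope_eq {g : E → F} {V : Set E} {dg : E × E → F}
    (hd : ∀ y ∈ V, ∀ k, Tendsto (fun t : 𝕜 => t⁻¹ • (g (y + t • k) - g y)) (𝓝[≠] 0)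
      (𝓝 (dg (y, k)))) (l : F →L[ℝ] ℝ) (y k : E) {t : 𝕜} (ht : t ≠ 0)
    (hV : ∀ s ∈ Icc (0 : ℝ) 1, y + s • t • k ∈ V) :
    ∃ s ∈ Icc (0 : ℝ) 1, l (t⁻¹ • (g (y + t • k) - g y)) = l (dg (y + s • t • k, k)) := by
  have hder : ∀ s ∈ Icc (0 : ℝ) 1, HasDerivAt (fun s : ℝ => l (t⁻¹ • g (y + s • t • k)))
      (l (dg (y + s • t • k, k))) s := by
    intro s hs
    rw [hasDerivAt_iff_tendsto_slope_zero]
    -- A real increment `r` along the segment is the increment `r * t` in `𝕜` in the direction `k`.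
    have h1 : Tendsto (fun r : ℝ => (r : 𝕜) * t) (𝓝[≠] 0) (𝓝[≠] 0) := by
      refine tendsto_nhdsWithin_of_tendsto_nhds_of_eventually_within _ ?_ ?_
      · have : Continuous (fun r : ℝ => (r : 𝕜) * t) := by fun_prop
        have h2 := this.tendsto 0
        simp only [map_zero, zero_mul] at h2
        exact h2.mono_left nhdsWithin_le_nhds
      · filter_upwards [self_mem_nhdsWithin] with r hr
        simp only [mem_compl_iff, mem_singleton_iff] at hr ⊢
        simp [hr, ht]
    have h2 := ((l.continuous.tendsto _).comp ((hd _ (hV s hs) k).comp h1))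
    refine h2.congr' ?_
    filter_upwards [self_mem_nhdsWithin] with r hr
    simp only [Function.comp_apply]
    rw [← map_sub, ← map_smul, ← smul_sub]
    congr 1
    have e1 : ((r : 𝕜) * t) • k = r • t • k := by
      rw [← smul_assoc, ← RCLike.real_smul_eq_coe_mul]
    have e2 : ((r : 𝕜) * t)⁻¹ = r⁻¹ • t⁻¹ := by
      rw [mul_inv, ← RCLike.ofReal_inv, RCLike.real_smul_eq_coe_mul]
    rw [e1, e2, smul_assoc, add_smul, add_assoc]
  obtain ⟨s, hs, h⟩ := exists_hasDerivAt_eq_slope (fun s : ℝ => l (t⁻¹ • g (y + s • t • k)))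
    (fun s => l (dg (y + s • t • k, k))) zero_lt_one
    (fun s hs => (hder s hs).continuousAt.continuousWithinAt)
    (fun s hs => hder s (Ioo_subset_Icc_self hs))
  refine ⟨s, Ioo_subset_Icc_self hs, ?_⟩
  rw [h]
  simp [smul_sub]

/-- The core of the chain rule: the direction may vary with `t`. By Hahn–Banach and the mean value
theorem, a difference quotient cannot leave an open convex set that contains all derivatives along
the segment. -/
theorem tendsto_slope_of_tendsto [TopologicalSpace E] [IsTopologicalAddGroup E]
    [ContinuousSMul 𝕜 E] [IsTopologicalAddGroup F] [ContinuousSMul 𝕜 F] [LocallyConvexSpace ℝ F]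
    {g : E → F} {V : Set E} (hV : IsOpen V) {dg : E × E → F}
    (hd : ∀ y ∈ V, ∀ k, Tendsto (fun t : 𝕜 => t⁻¹ • (g (y + t • k) - g y)) (𝓝[≠] 0)
      (𝓝 (dg (y, k)))) (hc : ContinuousOn dg (V ×ˢ univ)) {y : E} (hy : y ∈ V)
    {k : 𝕜 → E} {k₀ : E} (hk : Tendsto k (𝓝[≠] 0) (𝓝 k₀)) :
    Tendsto (fun t : 𝕜 => t⁻¹ • (g (y + t • k t) - g y)) (𝓝[≠] 0) (𝓝 (dg (y, k₀))) := by
  have : ContinuousSMul ℝ E := IsScalarTower.continuousSMul 𝕜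
  have : ContinuousSMul ℝ F := IsScalarTower.continuousSMul 𝕜
  rw [(LocallyConvexSpace.convex_basis (𝕜 := ℝ) (dg (y, k₀))).tendsto_right_iff]
  rintro C₀ ⟨hC₀, hC₀c⟩
  set C := interior C₀ with hC
  have hCo : IsOpen C := isOpen_interior
  have hCc : Convex ℝ C := hC₀c.interior
  have hmem : dg (y, k₀) ∈ C := mem_interior_iff_mem_nhds.2 hC₀
  have hsm : Tendsto (fun t : 𝕜 => (t • k t, k t)) (𝓝[≠] 0) (𝓝 ((0 : E), k₀)) := by
    refine Tendsto.prodMk_nhds ?_ hk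
    have h0 : Tendsto (fun t : 𝕜 => t) (𝓝[≠] 0) (𝓝 0) := nhdsWithin_le_nhds
    simpa using h0.smul hk
  -- Compactness of `[0, 1]` gives one neighbourhood of `(0, k₀)` that works for every point of the
  -- segment.
  have htube : ∀ᶠ p : E × E in 𝓝 ((0 : E), k₀), ∀ s ∈ Icc (0 : ℝ) 1,
      y + s • p.1 ∈ V ∧ dg (y + s • p.1, p.2) ∈ C := by
    refine isCompact_Icc.eventually_forall_of_forall_eventually ?_
    intro s _
    have hcont : Continuous (fun z : (E × E) × ℝ => (y + z.2 • z.1.1, z.1.2)) := by fun_prop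
    have hlim := hcont.tendsto (((0 : E), k₀), s)
    simp only [smul_zero, add_zero] at hlim
    have hO : IsOpen (V ×ˢ (univ : Set E)) := hV.prod isOpen_univ
    have h1 : ∀ᶠ q in 𝓝 (y, k₀), q ∈ V ×ˢ (univ : Set E) := hO.mem_nhds ⟨hy, mem_univ _⟩
    have h2 : ∀ᶠ q in 𝓝 (y, k₀), dg q ∈ C :=
      (hc.continuousAt (hO.mem_nhds ⟨hy, mem_univ _⟩)) (hCo.mem_nhds hmem)
    filter_upwards [hlim.eventually h1, hlim.eventually h2] with z hz1 hz2
    exact ⟨hz1.1, hz2⟩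
  filter_upwards [hsm.eventually htube, self_mem_nhdsWithin] with t ht ht0
  refine interior_subset (s := C₀) ?_
  -- A functional separating the quotient from `C` contradicts the mean value theorem, which equates
  -- its value there with its value at a point of `C`.
  by_contra hnot
  obtain ⟨l, hl⟩ := geometric_hahn_banach_point_open hCc hCo hnot
  obtain ⟨s, hs, h⟩ := exists_slope_eq hd l y (k t) ht0 (fun s hs => (ht s hs).1)
  exact absurd h (hl _ (ht s hs).2).ne

end Slope

/-- Write f(x + tk) = f(x) + t·k(t), where k(t) is the difference quotient of f; it tends to df(x,
k). The derivative of the composition is dg ∘ (f, df), to which the induction hypothesis applies. -/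
theorem LCContDiffOn.comp {H : Type*} [AddCommGroup H] [Module 𝕜 H] [Module ℝ H]
    [IsScalarTower ℝ 𝕜 H] [TopologicalSpace H] [IsTopologicalAddGroup H] [ContinuousSMul 𝕜 H]
    [LocallyConvexSpace ℝ H] (n : ℕ) : ∀ {E F : Type u}
    [AddCommGroup E] [Module 𝕜 E] [TopologicalSpace E]
    [IsTopologicalAddGroup E] [ContinuousSMul 𝕜 E]
    [AddCommGroup F] [Module 𝕜 F] [Module ℝ F] [IsScalarTower ℝ 𝕜 F]
    [TopologicalSpace F] [IsTopologicalAddGroup F] [ContinuousSMul 𝕜 F]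
    {g : F → H} {f : E → F} {U : Set E} {V : Set F}, IsOpen V →
    LCContDiffOn 𝕜 n g V → LCContDiffOn 𝕜 n f U → MapsTo f U V →
    LCContDiffOn 𝕜 n (fun x => g (f x)) U := by
  induction n with
  | zero => intro E F _ _ _ _ _ _ _ _ _ _ _ _ g f U V _ hg hf h; exact ContinuousOn.comp hg hf h
  | succ n ih =>
    intro E F _ _ _ _ _ _ _ _ _ _ _ _ g f U V hV hg hf h
    have hf' := LCContDiffOn.of_succ n hf
    obtain ⟨hgc, dg, hdg, hgn⟩ := hg
    obtain ⟨hfc, df, hdf, hfn⟩ := hf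
    refine ⟨hgc.comp hfc h, fun p => dg (f p.1, df p), ?_, ?_⟩
    · intro x hx k
      have := tendsto_slope_of_tendsto hV hdg hgn.continuousOn (h hx) (hdf x hx k)
      refine this.congr' ?_
      filter_upwards [self_mem_nhdsWithin] with t ht
      rw [smul_inv_smul₀ ht, add_sub_cancel]
    · refine ih (f := fun p => (f p.1, df p)) (U := U ×ˢ univ) (hV.prod isOpen_univ) hgn ?_
        (fun p hp => ⟨h hp.1, mem_univ _⟩)
      exact LCContDiffOn.pair n
        (LCContDiffOn.comp_linear n (ContinuousLinearMap.fst 𝕜 E E) hf'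
          (V := U ×ˢ univ) (fun p hp => hp.1)) hfn

theorem LCContDiffOn.linear {F : Type*} [AddCommGroup F] [Module 𝕜 F] [TopologicalSpace F]
    (n : ℕ) : ∀ {E : Type u} [AddCommGroup E] [Module 𝕜 E] [TopologicalSpace E]
    (l : E →L[𝕜] F) (U : Set E), LCContDiffOn 𝕜 n l U := by
  induction n with
  | zero => intro E _ _ _ l U; exact l.continuous.continuousOn
  | succ n ih =>
    intro E _ _ _ l U
    refine ⟨l.continuous.continuousOn, l.comp (ContinuousLinearMap.snd 𝕜 E E),
      fun x _ k => ?_, ih _ _⟩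
    refine (tendsto_const_nhds (x := l k)).congr' ?_
    filter_upwards [self_mem_nhdsWithin] with t ht
    rw [map_add, map_smul, add_sub_cancel_left, inv_smul_smul₀ ht]

end ChainRule

/-! ### Smoothness near a point -/

namespace SmoothMfd

variable {𝕜 : Type*} [RCLike 𝕜] {M M₁ M₂ M₃ : Type u}
  {A : SmoothMfd 𝕜 M} {B : SmoothMfd 𝕜 M₁} {C : SmoothMfd 𝕜 M₂} {D : SmoothMfd 𝕜 M₃}

/-- The filter of neighbourhoods of `x` in the manifold `A`. -/
def nhd (A : SmoothMfd 𝕜 M) (x : M) : Filter M := @nhds M A.top x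

theorem IsOpenIn.mem_nhd {U : Set M} (hU : A.IsOpenIn U) {x : M} (hx : x ∈ U) : U ∈ A.nhd x :=
  let := A.top; IsOpen.mem_nhds hU hx

theorem mem_nhd_iff {s : Set M} {x : M} : s ∈ A.nhd x ↔ ∃ U ⊆ s, A.IsOpenIn U ∧ x ∈ U :=
  let := A.top; mem_nhds_iff

theorem IsOpenIn.inter {U V : Set M} (hU : A.IsOpenIn U) (hV : A.IsOpenIn V) :
    A.IsOpenIn (U ∩ V) :=
  let := A.top; IsOpen.inter hU hV

theorem isOpenIn_univ : A.IsOpenIn (univ : Set M) := @isOpen_univ M A.top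

theorem mem_of_mem_nhd {s : Set M} {x : M} (h : s ∈ A.nhd x) : x ∈ s :=
  let := A.top; mem_of_mem_nhds h

theorem self_of_eventually {p : M → Prop} {x : M} (h : ∀ᶠ y in A.nhd x, p y) : p x :=
  mem_of_mem_nhd h

theorem isOpenIn_iff_mem_nhd {U : Set M} : A.IsOpenIn U ↔ ∀ x ∈ U, U ∈ A.nhd x :=
  let := A.top; isOpen_iff_mem_nhds

theorem nhd_prod (A : SmoothMfd 𝕜 M) (B : SmoothMfd 𝕜 M₁) (p : M × M₁) :
    (A.prod B).nhd p = A.nhd p.1 ×ˢ B.nhd p.2 :=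
  @nhds_prod_eq M M₁ A.top B.top p.1 p.2

theorem LCSmoothOn.congr {E F : Type*} [AddCommGroup F] [Module 𝕜 F] [TopologicalSpace F]
    [AddCommGroup E] [Module 𝕜 E] [TopologicalSpace E]
    [IsTopologicalAddGroup E] [ContinuousSMul 𝕜 E] {f g : E → F} {U : Set E} (hU : IsOpen U)
    (h : LCSmoothOn 𝕜 f U) (hfg : ∀ x ∈ U, g x = f x) : LCSmoothOn 𝕜 g U :=
  fun n => (h n).congr hU hfg

/-- Compatibility of the charts and the chain rule carry smoothness from one pair of charts to all
others. Continuity is recovered from the local expression. -/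
theorem smoothOn_of_chart {f : M → M₁} {W : Set M} (hW : A.IsOpenIn W)
    {e : @OpenPartialHomeomorph M A.E A.top _} (he : e ∈ A.atlas)
    {e' : @OpenPartialHomeomorph M₁ B.E B.top _} (he' : e' ∈ B.atlas)
    (hWe : W ⊆ e.source) (hWf : MapsTo f W e'.source)
    (hs : LCSmoothOn 𝕜 (fun v => e' (f (e.invFun v))) (e.target ∩ e.invFun ⁻¹' W)) :
    A.SmoothOn B f W := by
  let := A.top
  let := B.top
  have hcont : ContinuousOn f W := by
    have h0 : ContinuousOn (fun v => e' (f (e.symm v))) (e.target ∩ e.symm ⁻¹' W) :=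
      (hs 0).continuousOn
    have h1 : ContinuousOn (fun x => e'.symm (e' (f (e.symm (e x))))) W := by
      refine e'.continuousOn_symm.comp (h0.comp (e.continuousOn.mono hWe) ?_) ?_
      · intro x hx
        exact ⟨e.map_source (hWe hx), by simpa [e.left_inv (hWe hx)] using hx⟩
      · intro x hx
        simp only [e.left_inv (hWe hx)]
        exact e'.map_source (hWf hx)
    refine h1.congr fun x hx => ?_
    change f x = e'.symm (e' (f (e.symm (e x))))
    rw [e.left_inv (hWe hx), e'.left_inv (hWf hx)]
  refine ⟨hcont, fun a ha b hb => ?_⟩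
  have hO : IsOpen (a.target ∩ a.symm ⁻¹' (W ∩ f ⁻¹' b.source)) :=
    a.symm.isOpen_inter_preimage (hcont.isOpen_inter_preimage hW b.open_source)
  have hO1 : IsOpen (e.target ∩ e.symm ⁻¹' W) := e.symm.isOpen_inter_preimage hW
  have hO2 : IsOpen (e'.target ∩ e'.symm ⁻¹' b.source) :=
    e'.symm.isOpen_inter_preimage b.open_source
  intro n
  have h1 : LCContDiffOn 𝕜 n (fun v => e (a.symm v))
      (a.target ∩ a.symm ⁻¹' (W ∩ f ⁻¹' b.source)) :=
    (A.compat a ha e he n).mono n (fun v hv => ⟨hv.1, hWe hv.2.1⟩)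
  have h2 := LCContDiffOn.comp n hO1 (hs n) h1 (fun v hv => by
    refine ⟨e.map_source (hWe hv.2.1), ?_⟩
    change e.symm (e _) ∈ W
    rw [e.left_inv (hWe hv.2.1)]; exact hv.2.1)
  have h3 := LCContDiffOn.comp n hO2 (B.compat e' he' b hb n) h2 (fun v hv => by
    have hl : e.invFun (e (a.symm v)) = a.symm v := e.left_inv (hWe hv.2.1)
    simp only [hl]
    refine ⟨e'.map_source (hWf hv.2.1), ?_⟩
    change e'.symm (e' _) ∈ b.source
    rw [e'.left_inv (hWf hv.2.1)]; exact hv.2.2)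
  refine h3.congr hO fun v hv => ?_
  have hl : e.invFun (e (a.symm v)) = a.symm v := e.left_inv (hWe hv.2.1)
  simp only [hl]
  exact congrArg b (e'.left_inv (hWf hv.2.1)).symm

theorem SmoothNear.exists_chart {f : M → M₁} {x : M} (h : A.SmoothNear B f x)
    {e : @OpenPartialHomeomorph M A.E A.top _} (he : e ∈ A.atlas) (hx : x ∈ e.source)
    {e' : @OpenPartialHomeomorph M₁ B.E B.top _} (he' : e' ∈ B.atlas) (hfx : f x ∈ e'.source) :
    ∃ W, A.IsOpenIn W ∧ x ∈ W ∧ W ⊆ e.source ∧ MapsTo f W e'.source ∧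
      @ContinuousOn M M₁ A.top B.top f W ∧
      LCSmoothOn 𝕜 (fun v => e' (f (e.invFun v))) (e.target ∩ e.invFun ⁻¹' W) := by
  let := A.top
  let := B.top
  obtain ⟨U, hU, hxU, hc, hs⟩ := h
  refine ⟨e.source ∩ (U ∩ f ⁻¹' e'.source), ?_, ⟨hx, hxU, hfx⟩, fun _ h => h.1,
    fun _ h => h.2.2, hc.mono (fun _ h => h.2.1), ?_⟩
  · exact e.open_source.inter (ContinuousOn.isOpen_inter_preimage hc hU e'.open_source)
  · intro n
    exact (hs e he e' he' n).mono n (fun v hv => ⟨hv.1, hv.2.2⟩)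

theorem SmoothOn.smoothNear {f : M → M₁} {U : Set M} (h : A.SmoothOn B f U) (hU : A.IsOpenIn U)
    {x : M} (hx : x ∈ U) : A.SmoothNear B f x :=
  ⟨U, hU, hx, h⟩

theorem Smooth.smoothNear {f : M → M₁} (h : A.Smooth B f) (x : M) : A.SmoothNear B f x :=
  SmoothOn.smoothNear h isOpenIn_univ (mem_univ _)

theorem SmoothNear.tendsto {f : M → M₁} {x : M} (h : A.SmoothNear B f x) :
    Tendsto f (A.nhd x) (B.nhd (f x)) := by
  let := A.top
  let := B.top
  obtain ⟨U, hU, hxU, hc, hs⟩ := h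
  exact hc.continuousAt (IsOpen.mem_nhds hU hxU)

/-- Smoothness is local, so everything below works with germs (`SmoothNear`), which compose without
bookkeeping of domains. -/
theorem smoothOn_iff {f : M → M₁} {U : Set M} (hU : A.IsOpenIn U) :
    A.SmoothOn B f U ↔ ∀ x ∈ U, A.SmoothNear B f x := by
  refine ⟨fun h x hx => h.smoothNear hU hx, fun h => ⟨?_, fun e he e' he' n => ?_⟩⟩
  · let := A.top
    let := B.top
    intro x hx
    have : ContinuousAt f x := (h x hx).tendsto
    exact this.continuousWithinAt
  · let := A.top
    let := B.top
    refine LCContDiffOn.of_local n fun v hv => ?_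
    obtain ⟨V, hV, hxV, hc, hs⟩ := h (e.invFun v) hv.2.1
    exact ⟨_, e.symm.isOpen_inter_preimage (hc.isOpen_inter_preimage hV e'.open_source),
      ⟨hv.1, hxV, hv.2.2⟩, hs e he e' he' n⟩

theorem smooth_iff {f : M → M₁} : A.Smooth B f ↔ ∀ x, A.SmoothNear B f x :=
  (smoothOn_iff isOpenIn_univ).trans ⟨fun h x => h x (mem_univ _), fun h x _ => h x⟩

theorem SmoothNear.comp {g : M₁ → M₂} {f : M → M₁} {x : M} (hg : B.SmoothNear C g (f x))
    (hf : A.SmoothNear B f x) : A.SmoothNear C (fun y => g (f y)) x := by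
  let := A.top
  let := B.top
  let := C.top
  obtain ⟨e, he, hxe⟩ := A.cover x
  obtain ⟨e', he', hxe'⟩ := B.cover (f x)
  obtain ⟨e'', he'', hxe''⟩ := C.cover (g (f x))
  obtain ⟨W, hW, hxW, hWe, hWf, hc, hs⟩ := hf.exists_chart he hxe he' hxe'
  obtain ⟨W', hW', hxW', hWe', hWf', hc', hs'⟩ := hg.exists_chart he' hxe' he'' hxe''
  have hO : IsOpen (W ∩ f ⁻¹' W') := ContinuousOn.isOpen_inter_preimage hc hW hW'
  refine ⟨W ∩ f ⁻¹' W', hO, ⟨hxW, hxW'⟩, ?_⟩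
  refine smoothOn_of_chart hO he he'' (fun _ h => hWe h.1) (fun _ h => hWf' h.2) ?_
  intro n
  have h2 := LCContDiffOn.comp n (e'.symm.isOpen_inter_preimage hW') (hs' n)
    ((hs n).mono n (V := e.target ∩ e.symm ⁻¹' (W ∩ f ⁻¹' W')) (fun v hv => ⟨hv.1, hv.2.1⟩))
    (fun v hv => by
      refine ⟨e'.map_source (hWf hv.2.1), ?_⟩
      have hl : e'.symm (e' (f (e.invFun v))) = f (e.invFun v) := e'.left_inv (hWf hv.2.1)
      exact mem_preimage.2 (hl.symm ▸ hv.2.2))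
  refine h2.congr (e.symm.isOpen_inter_preimage hO) fun v hv => ?_
  have hl : e'.invFun (e' (f (e.invFun v))) = f (e.invFun v) := e'.left_inv (hWf hv.2.1)
  simp only [hl]

theorem SmoothNear.comp_of_eq {g : M₁ → M₂} {f : M → M₁} {x : M} {y : M₁}
    (hg : B.SmoothNear C g y) (hf : A.SmoothNear B f x) (hy : f x = y) :
    A.SmoothNear C (fun y => g (f y)) x := by
  subst hy; exact hg.comp hf

theorem SmoothNear.congr {f g : M → M₁} {x : M} (hf : A.SmoothNear B f x)
    (h : ∀ᶠ y in A.nhd x, g y = f y) : A.SmoothNear B g x := by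
  obtain ⟨e, he, hxe⟩ := A.cover x
  obtain ⟨e', he', hxe'⟩ := B.cover (f x)
  obtain ⟨W, hW, hxW, hWe, hWf, hc, hs⟩ := hf.exists_chart he hxe he' hxe'
  obtain ⟨V, hVs, hV, hxV⟩ := mem_nhd_iff.1 h
  refine ⟨W ∩ V, hW.inter hV, ⟨hxW, hxV⟩, ?_⟩
  have hg : ∀ y ∈ V, g y = f y := fun y hy => hVs hy
  refine smoothOn_of_chart (hW.inter hV) he he' (fun _ h => hWe h.1) (fun y h => ?_) ?_
  · rw [hg y h.2]; exact hWf h.1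
  · let := A.top
    refine LCSmoothOn.congr (e.symm.isOpen_inter_preimage (hW.inter hV))
      (fun n => (hs n).mono n (fun v hv => ⟨hv.1, hv.2.1⟩)) fun v hv => ?_
    have : g (e.invFun v) = f (e.invFun v) := hg _ hv.2.2
    simp only [this]

theorem SmoothNear.eventually {f : M → M₁} {x : M} (hf : A.SmoothNear B f x) :
    ∀ᶠ y in A.nhd x, A.SmoothNear B f y := by
  obtain ⟨U, hU, hx, h⟩ := hf
  exact mem_of_superset (hU.mem_nhd hx) fun y hy => h.smoothNear hU hy

theorem smoothNear_id (A : SmoothMfd 𝕜 M) (x : M) : A.SmoothNear A (fun y => y) x := by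
  let := A.top
  obtain ⟨e, he, hxe⟩ := A.cover x
  refine ⟨e.source, e.open_source, hxe,
    smoothOn_of_chart e.open_source he he subset_rfl (fun _ h => h) ?_⟩
  refine LCSmoothOn.congr (e.symm.isOpen_inter_preimage e.open_source)
    (fun n => LCContDiffOn.linear n (ContinuousLinearMap.id 𝕜 A.E) _) fun v hv => ?_
  exact e.right_inv hv.1

theorem SmoothNear.prodMk {f : M → M₁} {g : M → M₂} {x : M} (hf : A.SmoothNear B f x)
    (hg : A.SmoothNear C g x) : A.SmoothNear (B.prod C) (fun y => (f y, g y)) x := by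
  let := A.top
  let := B.top
  let := C.top
  obtain ⟨e, he, hxe⟩ := A.cover x
  obtain ⟨e', he', hxe'⟩ := B.cover (f x)
  obtain ⟨e'', he'', hxe''⟩ := C.cover (g x)
  obtain ⟨W, hW, hxW, hWe, hWf, hc, hs⟩ := hf.exists_chart he hxe he' hxe'
  obtain ⟨W', hW', hxW', hWe', hWf', hc', hs'⟩ := hg.exists_chart he hxe he'' hxe''
  refine ⟨W ∩ W', hW.inter hW', ⟨hxW, hxW'⟩, ?_⟩
  refine smoothOn_of_chart (e' := e'.prod e'') (B := B.prod C) (hW.inter hW') he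
    ⟨e', he', e'', he'', rfl⟩ (fun _ h => hWe h.1) (fun y h => ⟨hWf h.1, hWf' h.2⟩) ?_
  intro n
  exact LCContDiffOn.pair n ((hs n).mono n (fun v hv => ⟨hv.1, hv.2.1⟩))
    ((hs' n).mono n (fun v hv => ⟨hv.1, hv.2.2⟩))

theorem smoothNear_fst (A : SmoothMfd 𝕜 M) (B : SmoothMfd 𝕜 M₁) (p : M × M₁) :
    (A.prod B).SmoothNear A Prod.fst p := by
  let := A.top
  let := B.top
  obtain ⟨e, he, hxe⟩ := A.cover p.1
  obtain ⟨e', he', hxe'⟩ := B.cover p.2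
  have hO : IsOpen (e.prod e').source := (e.prod e').open_source
  refine ⟨_, hO, ⟨hxe, hxe'⟩, smoothOn_of_chart (A := A.prod B) (e := e.prod e') hO
    ⟨e, he, e', he', rfl⟩ he subset_rfl (fun _ h => h.1) ?_⟩
  refine LCSmoothOn.congr ((e.prod e').symm.isOpen_inter_preimage hO)
    (fun n => LCContDiffOn.linear n (ContinuousLinearMap.fst 𝕜 A.E B.E) _) fun v hv => ?_
  exact e.right_inv hv.1.1

theorem smoothNear_snd (A : SmoothMfd 𝕜 M) (B : SmoothMfd 𝕜 M₁) (p : M × M₁) :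
    (A.prod B).SmoothNear B Prod.snd p := by
  let := A.top
  let := B.top
  obtain ⟨e, he, hxe⟩ := A.cover p.1
  obtain ⟨e', he', hxe'⟩ := B.cover p.2
  have hO : IsOpen (e.prod e').source := (e.prod e').open_source
  refine ⟨_, hO, ⟨hxe, hxe'⟩, smoothOn_of_chart (A := A.prod B) (e := e.prod e') hO
    ⟨e, he, e', he', rfl⟩ he' subset_rfl (fun _ h => h.2) ?_⟩
  refine LCSmoothOn.congr ((e.prod e').symm.isOpen_inter_preimage hO)
    (fun n => LCContDiffOn.linear n (ContinuousLinearMap.snd 𝕜 A.E B.E) _) fun v hv => ?_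
  exact e'.right_inv hv.1.2

theorem SmoothNear.fst {f : M → M₁ × M₂} {x : M} (h : A.SmoothNear (B.prod C) f x) :
    A.SmoothNear B (fun y => (f y).1) x :=
  (smoothNear_fst B C (f x)).comp h

theorem SmoothNear.snd {f : M → M₁ × M₂} {x : M} (h : A.SmoothNear (B.prod C) f x) :
    A.SmoothNear C (fun y => (f y).2) x :=
  (smoothNear_snd B C (f x)).comp h

/-- Composition with a map of two variables. -/
theorem SmoothNear.comp₂ {m : M₁ → M₂ → M₃} {f : M → M₁} {g : M → M₂} {x : M} {a : M₁} {b : M₂}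
    (hm : (B.prod C).SmoothNear D (fun p => m p.1 p.2) (a, b))
    (hf : A.SmoothNear B f x) (hg : A.SmoothNear C g x) (ha : f x = a) (hb : g x = b) :
    A.SmoothNear D (fun y => m (f y) (g y)) x := by
  subst ha hb
  exact SmoothNear.comp (g := fun p : M₁ × M₂ => m p.1 p.2) (f := fun y => (f y, g y)) hm
    (hf.prodMk hg)

/-! ### Transport of manifold structures -/

/-- The manifold structure on `M` for which the bijection `φ : M ≃ M₁` is a diffeomorphism. -/
def transport (B : SmoothMfd 𝕜 M₁) (φ : M ≃ M₁) : SmoothMfd 𝕜 M :=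
  letI := B.top
  letI : TopologicalSpace M := TopologicalSpace.induced φ B.top
  let h : M ≃ₜ M₁ := φ.toHomeomorphOfIsInducing ⟨rfl⟩
  { E := B.E
    top := inferInstance
    t2 := haveI := B.t2; h.symm.t2Space
    atlas := {e | ∃ b ∈ B.atlas, e = h.toOpenPartialHomeomorph.trans b}
    cover := by
      intro x
      obtain ⟨b, hb, hx⟩ := B.cover (φ x)
      exact ⟨_, ⟨b, hb, rfl⟩, by simpa [h] using hx⟩
    compat := by
      rintro _ ⟨b, hb, rfl⟩ _ ⟨b', hb', rfl⟩ n
      refine ((B.compat b hb b' hb' n).mono n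
        (V := (h.toOpenPartialHomeomorph.trans b).target ∩
          (h.toOpenPartialHomeomorph.trans b).symm ⁻¹'
            (h.toOpenPartialHomeomorph.trans b').source) ?_).congr ?_ ?_
      · intro v hv
        have h1 := hv.1
        have h2 := hv.2
        simp [h] at h1 h2
        exact ⟨h1, h2⟩
      · exact (((h.toOpenPartialHomeomorph.trans b).symm.isOpen_inter_preimage
          (h.toOpenPartialHomeomorph.trans b').open_source))
      · intro v hv
        simp [h] }

theorem transport_smoothNear (B : SmoothMfd 𝕜 M₁) (φ : M ≃ M₁) (x : M) :
    (B.transport φ).SmoothNear B φ x := by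
  let := B.top
  let := (B.transport φ).top
  let h : M ≃ₜ M₁ := φ.toHomeomorphOfIsInducing ⟨rfl⟩
  obtain ⟨b, hb, hx⟩ := B.cover (φ x)
  have hO : IsOpen (h.toOpenPartialHomeomorph.trans b).source :=
    (h.toOpenPartialHomeomorph.trans b).open_source
  refine ⟨_, hO, by simpa [h] using hx, smoothOn_of_chart (A := B.transport φ)
    (e := h.toOpenPartialHomeomorph.trans b) hO ⟨b, hb, rfl⟩ hb subset_rfl
    (fun y hy => by simpa [h] using hy) ?_⟩
  refine LCSmoothOn.congr ((h.toOpenPartialHomeomorph.trans b).symm.isOpen_inter_preimage hO)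
    (fun n => LCContDiffOn.linear n (ContinuousLinearMap.id 𝕜 B.E) _) fun v hv => ?_
  exact (h.toOpenPartialHomeomorph.trans b).right_inv hv.1

theorem transport_symm_smoothNear (B : SmoothMfd 𝕜 M₁) (φ : M ≃ M₁) (y : M₁) :
    B.SmoothNear (B.transport φ) φ.symm y := by
  let := B.top
  let := (B.transport φ).top
  let h : M ≃ₜ M₁ := φ.toHomeomorphOfIsInducing ⟨rfl⟩
  obtain ⟨b, hb, hx⟩ := B.cover y
  refine ⟨_, b.open_source, hx, smoothOn_of_chart (B := B.transport φ)
    (e' := h.toOpenPartialHomeomorph.trans b) b.open_source hb ⟨b, hb, rfl⟩ subset_rfl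
    (fun y hy => ⟨mem_univ _, (congrArg (· ∈ b.source) (φ.apply_symm_apply y)).mpr hy⟩) ?_⟩
  refine LCSmoothOn.congr (b.symm.isOpen_inter_preimage b.open_source)
    (fun n => LCContDiffOn.linear n (ContinuousLinearMap.id 𝕜 B.E) _) fun v hv => ?_
  have : φ (φ.symm (b.invFun v)) = b.invFun v := φ.apply_symm_apply _
  change b (φ (φ.symm (b.invFun v))) = v
  rw [this]
  exact b.right_inv hv.1

end SmoothMfd

/-! ### Lie groups from local data -/

section LieGroup

variable {𝕜 : Type*} [RCLike 𝕜] {K M : Type u} [Group K] {A : SmoothMfd 𝕜 M}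

open SmoothMfd

theorem LieGroupStr.smoothNear_mul (L : LieGroupStr 𝕜 K) {f g : M → K} {x : M}
    (hf : A.SmoothNear L.toSmoothMfd f x) (hg : A.SmoothNear L.toSmoothMfd g x) :
    A.SmoothNear L.toSmoothMfd (fun y => f y * g y) x :=
  (L.smooth_mul.smoothNear (f x, g x)).comp₂ (m := fun a b => a * b) hf hg rfl rfl

theorem LieGroupStr.smoothNear_inv (L : LieGroupStr 𝕜 K) {f : M → K} {x : M}
    (hf : A.SmoothNear L.toSmoothMfd f x) :
    A.SmoothNear L.toSmoothMfd (fun y => (f y)⁻¹) x :=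
  (L.smooth_inv.smoothNear (f x)).comp hf

/-- A group with a manifold structure for which the group operations are smooth near the
identity and the conjugations fix the germ of the manifold at the identity. -/
structure IsLocalLie (A : SmoothMfd 𝕜 K) : Prop where
  mul : (A.prod A).SmoothNear A (fun p : K × K => p.1 * p.2) (1, 1)
  inv : A.SmoothNear A (fun g : K => g⁻¹) 1
  conj : ∀ g : K, A.SmoothNear A (fun x => g * x * g⁻¹) 1

namespace IsLocalLie

variable {A : SmoothMfd 𝕜 K} (h : IsLocalLie A)

include h in
-- The neighbourhoods of 1 in the manifold form a group filter basis: local smoothness of the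
-- operations and of the conjugations gives the continuity that the axioms require.
theorem exists_topology : ∃ τ : TopologicalSpace K, @IsTopologicalGroup K τ _ ∧
    @nhds K τ 1 = A.nhd 1 := by
  have hm : Tendsto (fun p : K × K => p.1 * p.2) (A.nhd 1 ×ˢ A.nhd 1) (A.nhd 1) := by
    have := h.mul.tendsto
    simpa [nhd_prod] using this
  let B : GroupFilterBasis K :=
    { sets := (A.nhd 1).sets
      nonempty := ⟨univ, univ_mem⟩
      inter_sets := fun {x y} hx hy => ⟨x ∩ y, inter_mem hx hy, subset_rfl⟩
      one' := fun hU => mem_of_mem_nhd hU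
      mul' := by
        intro U hU
        obtain ⟨V, hV, hVU⟩ := mem_prod_same_iff.1 (hm hU)
        refine ⟨V, hV, ?_⟩
        rintro _ ⟨a, ha, b, hb, rfl⟩
        exact hVU (mk_mem_prod ha hb)
      inv' := fun {U} hU => ⟨_, h.inv.tendsto (by simpa using hU), subset_rfl⟩
      conj' := fun g {U} hU => ⟨_, (h.conj g).tendsto (by simpa using hU), subset_rfl⟩ }
  refine ⟨B.topology, B.isTopologicalGroup, ?_⟩
  rw [B.nhds_one_eq]
  ext s
  rw [FilterBasis.mem_filter_iff]
  exact ⟨fun ⟨t, ht, hts⟩ => mem_of_superset ht hts, fun hs => ⟨s, hs, subset_rfl⟩⟩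

include h in
-- Multiplication is smooth near every point close to (1, 1), in particular near (w, 1) and (w⁻¹, w)
-- when w is close to 1. Freezing the first factor gives the two translations.
theorem exists_nhd : ∃ W, A.IsOpenIn W ∧ (1 : K) ∈ W ∧
    ∀ w ∈ W, A.SmoothNear A (fun x => w * x) 1 ∧ A.SmoothNear A (fun x => w⁻¹ * x) w := by
  have h1 : ∀ᶠ w in A.nhd 1, A.SmoothNear A (fun x => w * x) 1 := by
    have ht : Tendsto (fun w : K => (w, (1 : K))) (A.nhd 1) ((A.prod A).nhd (1, 1)) :=
      ((smoothNear_id A 1).prodMk (smoothNear_const A A (1 : K) 1)).tendsto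
    filter_upwards [ht.eventually h.mul.eventually] with w hw
    exact hw.comp₂ (m := fun a b : K => a * b) (smoothNear_const A A w 1) (smoothNear_id A 1)
      rfl rfl
  have h2 : ∀ᶠ w in A.nhd 1, A.SmoothNear A (fun x => w⁻¹ * x) w := by
    have ht : Tendsto (fun w : K => (w⁻¹, w)) (A.nhd 1) ((A.prod A).nhd (1, 1)) := by
      have := (h.inv.prodMk (smoothNear_id A 1)).tendsto
      rwa [inv_one] at this
    filter_upwards [ht.eventually h.mul.eventually] with w hw
    exact hw.comp₂ (m := fun a b : K => a * b) (smoothNear_const A A w⁻¹ w) (smoothNear_id A w)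
      rfl rfl
  obtain ⟨W, hW, hWo, h1W⟩ := mem_nhd_iff.1 (h1.and h2)
  exact ⟨W, hWo, h1W, fun w hw => hW hw⟩

end IsLocalLie

/-- Data for the construction of a Lie group: a group topology `τ` that agrees with the manifold
`A` on the identity neighbourhood `W`, where `A` is invariant under the left translations
between points of `W`. -/
structure LocalLieData (A : SmoothMfd 𝕜 K) (τ : TopologicalSpace K) (W : Set K) : Prop where
  isTopologicalGroup : @IsTopologicalGroup K τ _
  isOpenIn : A.IsOpenIn W
  one_mem : (1 : K) ∈ W
  smooth : ∀ w ∈ W, A.SmoothNear A (fun x => w * x) 1 ∧ A.SmoothNear A (fun x => w⁻¹ * x) w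
  nhds_one : @nhds K τ 1 = A.nhd 1

namespace LocalLieData

variable {A : SmoothMfd 𝕜 K} {τ : TopologicalSpace K} {W : Set K} (h : LocalLieData A τ W)

include h

/-- Left translation by `w` carries the group neighbourhoods of 1 to those of `w`, and by smoothness
of the two translations it does the same for the manifold neighbourhoods. -/
theorem nhds_eq {w : K} (hw : w ∈ W) : @nhds K τ w = A.nhd w := by
  have := h.isTopologicalGroup
  rw [← map_mul_left_nhds_one w, h.nhds_one]
  refine le_antisymm ?_ ?_
  · have := (h.smooth w hw).1.tendsto
    rwa [mul_one] at this
  · have := (h.smooth w hw).2.tendsto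
    rw [inv_mul_cancel] at this
    refine le_trans (le_of_eq ?_) (map_mono (m := fun x => w * x) this)
    rw [map_map]
    simp [Function.comp_def]

/-- Factor through the identity: cx = (cw)(w⁻¹x), with both `w` and `c * w` in `W`. -/
theorem smoothNear_mul {c w : K} (hw : w ∈ W) (hcw : c * w ∈ W) :
    A.SmoothNear A (fun x => c * x) w := by
  have := (h.smooth _ hcw).1.comp_of_eq (h.smooth w hw).2 (inv_mul_cancel w)
  simpa [mul_assoc] using this

theorem t2Space : @T2Space K τ := by
  have := h.isTopologicalGroup
  refine IsTopologicalGroup.t2Space_of_one_sep fun x hx => ?_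
  rw [h.nhds_one]
  let := A.top
  have := A.t2
  exact ⟨{x}ᶜ, isOpen_compl_singleton.mem_nhds (by simpa using hx.symm), by simp⟩

/-- The part over `W` of a chart of `A`, as a chart for the group topology. -/
def restrChart (e : @OpenPartialHomeomorph K A.E A.top _) :
    @OpenPartialHomeomorph K A.E τ _ where
  toFun := e.toFun
  invFun := e.invFun
  source := e.source ∩ W
  target := e.target ∩ e.invFun ⁻¹' W
  map_source' x hx := ⟨e.map_source' hx.1, by
    have : e.invFun (e.toFun x) = x := e.left_inv' hx.1
    rw [mem_preimage, this]; exact hx.2⟩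
  map_target' v hv := ⟨e.map_target' hv.1, hv.2⟩
  left_inv' x hx := e.left_inv' hx.1
  right_inv' v hv := e.right_inv' hv.1
  open_source := by
    rw [isOpen_iff_mem_nhds]
    intro x hx
    rw [h.nhds_eq hx.2]
    let := A.top
    exact (e.open_source.inter h.isOpenIn).mem_nhds hx
  open_target := by
    let := A.top
    exact e.symm.isOpen_inter_preimage h.isOpenIn
  continuousOn_toFun := by
    intro x hx
    refine ContinuousAt.continuousWithinAt ?_
    rw [ContinuousAt, h.nhds_eq hx.2]
    let := A.top
    exact e.continuousAt hx.1
  continuousOn_invFun := by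
    intro v hv
    refine ContinuousAt.continuousWithinAt ?_
    rw [ContinuousAt, h.nhds_eq hv.2]
    let := A.top
    exact e.symm.continuousAt hv.1

/-- The translate to `g` of a chart of `A`. -/
def translChart (g : K) (e : @OpenPartialHomeomorph K A.E A.top _) :
    @OpenPartialHomeomorph K A.E τ _ :=
  haveI := h.isTopologicalGroup
  (Homeomorph.mulLeft g⁻¹).toOpenPartialHomeomorph.trans (h.restrChart e)

theorem translChart_invFun (g : K) (e : @OpenPartialHomeomorph K A.E A.top _) (v : A.E) :
    (h.translChart g e).invFun v = g * e.invFun v :=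
  congrArg (· * e.invFun v) (inv_inv g)

theorem translChart_source (g : K) (e : @OpenPartialHomeomorph K A.E A.top _) :
    (h.translChart g e).source = {x | g⁻¹ * x ∈ e.source ∧ g⁻¹ * x ∈ W} := by
  ext x
  change True ∧ _ ↔ _
  exact Iff.of_eq (true_and _)

theorem translChart_target (g : K) (e : @OpenPartialHomeomorph K A.E A.top _) :
    (h.translChart g e).target = e.target ∩ e.invFun ⁻¹' W := by
  ext x
  change _ ∧ True ↔ _
  exact Iff.of_eq (and_true _)

/-- The manifold structure on the group. -/
def mfd : SmoothMfd 𝕜 K where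
  E := A.E
  top := τ
  t2 := h.t2Space
  atlas := {c | ∃ g, ∃ e ∈ A.atlas, c = h.translChart g e}
  cover := by
    intro x
    obtain ⟨e, he, hxe⟩ := A.cover 1
    refine ⟨_, ⟨x, e, he, rfl⟩, ?_⟩
    rw [translChart_source]
    simpa using ⟨hxe, h.one_mem⟩
  compat := by
    rintro _ ⟨g, e, he, rfl⟩ _ ⟨g', e', he', rfl⟩ n
    refine LCContDiffOn.of_local n fun v hv => ?_
    have h1 := hv.1
    have h2 : (h.translChart g e).invFun v ∈ (h.translChart g' e').source := hv.2
    rw [translChart_target] at h1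
    rw [translChart_source, translChart_invFun, mem_ofPred_eq, ← mul_assoc] at h2
    obtain ⟨U, hU, hxU, hc, hs⟩ := h.smoothNear_mul h1.2 h2.2
    -- The change between the charts translated to `g` and `g'` is left translation by g'⁻¹g between
    -- two points of `W`, read in the original charts.
    have key : ∀ v, g'⁻¹ * (h.translChart g e).invFun v = g'⁻¹ * g * e.invFun v := fun v => by
      rw [translChart_invFun, mul_assoc]
    let := A.top
    have hO := e.symm.isOpen_inter_preimage (hc.isOpen_inter_preimage hU e'.open_source)
    refine ⟨_, hO, ⟨h1.1, hxU, h2.1⟩, (hs e he e' he' n).congr hO fun v _ => ?_⟩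
    exact congrArg e' (key v)

/-- In the chart translated to `g`, this map is the identity of the model space. -/
theorem smoothNear_translate (g : K) : A.SmoothNear h.mfd (fun x => g * x) 1 := by
  obtain ⟨e, he, hxe⟩ := A.cover 1
  let := A.top
  have hO : IsOpen (e.source ∩ W) := e.open_source.inter h.isOpenIn
  refine ⟨_, hO, ⟨hxe, h.one_mem⟩, smoothOn_of_chart (B := h.mfd) hO he
    ⟨g, e, he, rfl⟩ inter_subset_left ?_ ?_⟩
  · intro x hx
    rw [translChart_source]
    simpa using hx
  · refine LCSmoothOn.congr (e.symm.isOpen_inter_preimage hO)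
      (fun n => LCContDiffOn.linear n (ContinuousLinearMap.id 𝕜 A.E) _) fun v hv => ?_
    change e (g⁻¹ * (g * e.invFun v)) = v
    rw [inv_mul_cancel_left]
    exact e.right_inv hv.1

theorem smoothNear_translate_inv (g : K) : h.mfd.SmoothNear A (fun x => g⁻¹ * x) g := by
  obtain ⟨e, he, hxe⟩ := A.cover 1
  have hO : h.mfd.IsOpenIn (h.translChart g e).source := (h.translChart g e).open_source
  refine ⟨_, hO, ?_, smoothOn_of_chart (A := h.mfd) hO ⟨g, e, he, rfl⟩ he subset_rfl ?_ ?_⟩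
  · rw [translChart_source]
    simpa using ⟨hxe, h.one_mem⟩
  · intro x hx
    rw [translChart_source] at hx
    exact hx.1
  · refine LCSmoothOn.congr ((h.translChart g e).symm.isOpen_inter_preimage hO)
      (fun n => LCContDiffOn.linear n (ContinuousLinearMap.id 𝕜 A.E) _) fun v hv => ?_
    exact (h.translChart g e).right_inv hv.1

end LocalLieData

/-- A group with a compatible manifold structure near the identity, on which conjugations are
smooth, is a Lie group. -/
theorem IsLocalLie.exists_lieGroupStr {A : SmoothMfd 𝕜 K} (hA : IsLocalLie A) :
    ∃ L : LieGroupStr 𝕜 K, A.SmoothNear L.toSmoothMfd (fun x => x) 1 ∧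
      L.SmoothNear A (fun x => x) 1 := by
  obtain ⟨τ, hτ, hnhds⟩ := hA.exists_topology
  obtain ⟨W, hW, h1W, hs⟩ := hA.exists_nhd
  have h : LocalLieData A τ W := ⟨hτ, hW, h1W, hs, hnhds⟩
  have hmul : (h.mfd.prod h.mfd).Smooth h.mfd (fun p : K × K => p.1 * p.2) := by
    rw [smooth_iff]
    rintro ⟨a, b⟩
    -- Multiplication near (a, b) reduces to the identity by (ax)(by) = ab·(b⁻¹xb)·y, hence the need
    -- for conjugations.
    have h1 := (h.smoothNear_translate_inv a).comp (smoothNear_fst h.mfd h.mfd (a, b))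
    have h2 := (h.smoothNear_translate_inv b).comp (smoothNear_snd h.mfd h.mfd (a, b))
    have h3 := (hA.conj b⁻¹).comp_of_eq h1 (inv_mul_cancel a)
    have h4 := hA.mul.comp₂ (m := fun a b : K => a * b) h3 h2 (by simp) (by simp)
    have h5 := (h.smoothNear_translate (a * b)).comp_of_eq h4 (by simp)
    refine h5.congr (Eventually.of_forall fun p => ?_)
    simp [mul_assoc]
  have hinv : h.mfd.Smooth h.mfd (fun g : K => g⁻¹) := by
    rw [smooth_iff]
    intro a
    -- Inversion near `a` reduces to the identity by (ax)⁻¹ = a⁻¹·(a x⁻¹ a⁻¹).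
    have h1 := hA.inv.comp_of_eq (h.smoothNear_translate_inv a) (inv_mul_cancel a)
    have h2 := (hA.conj a).comp_of_eq h1 (by simp)
    have h3 := (h.smoothNear_translate a⁻¹).comp_of_eq h2 (by simp)
    refine h3.congr (Eventually.of_forall fun p => ?_)
    simp [mul_assoc]
  refine ⟨{ h.mfd with smooth_mul := hmul, smooth_inv := hinv }, ?_, ?_⟩
  · simpa using h.smoothNear_translate 1
  · simpa using h.smoothNear_translate_inv 1

end LieGroup

/-! ### Extensions of Lie groups by modules, defined by cocycles -/

section Twisted

open SmoothMfd

variable {𝕜 : Type*} [RCLike 𝕜] {M M₁ M₂ : Type u} {A : SmoothMfd 𝕜 M}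

theorem SmoothMfd.SmoothNear.transport {B : SmoothMfd 𝕜 M₁} {φ : M₂ ≃ M₁} {f : M → M₂} {x : M}
    (h : A.SmoothNear B (fun y => φ (f y)) x) : A.SmoothNear (B.transport φ) f x := by
  simpa using (transport_symm_smoothNear B φ (φ (f x))).comp (f := fun y => φ (f y)) h

/-- Translate the germ at 1 by φ(y) = φ(x)φ(x⁻¹y). -/
theorem LieGroupStr.smooth_of_smoothNear_one {K P : Type u} [Group K] [Group P]
    (LK : LieGroupStr 𝕜 K) (LP : LieGroupStr 𝕜 P) (φ : K →* P)
    (h : LK.SmoothNear LP.toSmoothMfd φ 1) : LK.Smooth LP.toSmoothMfd φ := by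
  rw [smooth_iff]
  intro x
  have h1 := LK.smoothNear_mul (smoothNear_const LK.toSmoothMfd LK.toSmoothMfd x⁻¹ x)
    (smoothNear_id LK.toSmoothMfd x)
  have h2 := LP.smoothNear_mul (smoothNear_const LK.toSmoothMfd LP.toSmoothMfd (φ x) x)
    (h.comp_of_eq h1 (inv_mul_cancel x))
  simpa using h2

theorem LieGroupStr.smoothNear_conj {K : Type u} [Group K] (L : LieGroupStr 𝕜 K) (g x : K) :
    L.SmoothNear L.toSmoothMfd (fun y => g * y * g⁻¹) x :=
  L.smoothNear_mul (L.smoothNear_mul (smoothNear_const _ _ _ _) (smoothNear_id _ _))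
    (smoothNear_const _ _ _ _)

variable {Γ Z K : Type u} [Group Γ] [Group K]

/-- `e.symm` is a diffeomorphism from `Z × U` onto an open subset of the Lie group `K`, for
some open identity neighbourhood `U` in `Γ`. -/
def IsStandardAlong (MΓ : SmoothMfd 𝕜 Γ) (MZ : SmoothMfd 𝕜 Z) (e : K ≃ Z × Γ)
    (L : LieGroupStr 𝕜 K) : Prop :=
  ∃ U : Set Γ, MΓ.IsOpenIn U ∧ (1 : Γ) ∈ U ∧
    (MZ.prod MΓ).SmoothOn L.toSmoothMfd e.symm (univ ×ˢ U) ∧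
    L.IsOpenIn {x | (e x).2 ∈ U} ∧
    L.SmoothOn (MZ.prod MΓ) e {x | (e x).2 ∈ U}

namespace IsStandardAlong

variable {MΓ : SmoothMfd 𝕜 Γ} {MZ : SmoothMfd 𝕜 Z} {e : K ≃ Z × Γ} {L : LieGroupStr 𝕜 K}
  (h : IsStandardAlong MΓ MZ e L)

include h

theorem symm_smoothNear (z : Z) : (MZ.prod MΓ).SmoothNear L.toSmoothMfd e.symm (z, 1) := by
  obtain ⟨U, hU, h1, hs, -⟩ := h
  refine hs.smoothNear ?_ ⟨mem_univ _, h1⟩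
  let := MZ.top
  let := MΓ.top
  exact IsOpen.prod isOpen_univ hU

theorem smoothNear {x : K} (hx : (e x).2 = 1) : L.SmoothNear (MZ.prod MΓ) e x := by
  obtain ⟨U, hU, h1, -, ho, hs⟩ := h
  refine hs.smoothNear ho ?_
  change (e x).2 ∈ U
  rwa [hx]

theorem mk_smoothNear {f : M → Z} {g : M → Γ} {x : M} (hf : A.SmoothNear MZ f x)
    (hg : A.SmoothNear MΓ g x) (hx : g x = 1) :
    A.SmoothNear L.toSmoothMfd (fun y => e.symm (f y, g y)) x :=
  (h.symm_smoothNear (f x)).comp_of_eq (hf.prodMk hg) (by rw [hx])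

end IsStandardAlong

variable [CommGroup Z]

/-- The bijection `e` identifies the group `K` with `Z × Γ`, with the multiplication
`(z, g) (z', g') = (z g.z' F(g, g'), g g')`. -/
def IsTwisted (ρ : Γ →* MulAut Z) (F : Γ → Γ → Z) (e : K ≃ Z × Γ) : Prop :=
  ∀ x y, e (x * y) = ((e x).1 * ρ (e x).2 (e y).1 * F (e x).2 (e y).2, (e x).2 * (e y).2)

namespace IsTwisted

variable {ρ : Γ →* MulAut Z} {F : Γ → Γ → Z} {e : K ≃ Z × Γ}

section Algebra

variable (h : IsTwisted ρ F e) (hF₁ : ∀ g, F 1 g = 1)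

include h

theorem mul_fst (x y : K) :
    (e (x * y)).1 = (e x).1 * ρ (e x).2 (e y).1 * F (e x).2 (e y).2 := by rw [h x y]

theorem mul_snd (x y : K) : (e (x * y)).2 = (e x).2 * (e y).2 := by rw [h x y]

theorem one_snd : (e 1).2 = 1 := by simpa using h.mul_snd 1 1

theorem inv_snd (x : K) : (e x⁻¹).2 = (e x).2⁻¹ := by
  rw [eq_inv_iff_mul_eq_one, ← h.mul_snd, inv_mul_cancel, h.one_snd]

theorem conj_snd (g x : K) : (e (g * x * g⁻¹)).2 = (e g).2 * (e x).2 * (e g).2⁻¹ := by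
  rw [h.mul_snd, h.mul_snd, h.inv_snd]

/-- Obtained by comparing first components in (gxg⁻¹)g = gx. The factor with the two values of `F`
is the one whose smoothness defines C²_ss. -/
theorem conj_fst (g x : K) : (e (g * x * g⁻¹)).1 = (e g).1 * ρ (e g).2 (e x).1 *
    (F (e g).2 (e x).2 * (F ((e g).2 * (e x).2 * (e g).2⁻¹) (e g).2)⁻¹) *
    (ρ ((e g).2 * (e x).2 * (e g).2⁻¹) (e g).1)⁻¹ := by
  have h1 := h.mul_fst (g * x * g⁻¹) g
  rw [inv_mul_cancel_right, h.mul_fst, h.conj_snd] at h1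
  rw [← mul_assoc, h1]
  generalize ρ _ (e g).1 = a
  generalize F ((e g).2 * (e x).2 * (e g).2⁻¹) (e g).2 = b
  rw [mul_inv_cancel_right, mul_inv_cancel_right]

include hF₁

theorem one_eq : e 1 = (1, 1) := by
  refine Prod.ext ?_ h.one_snd
  simpa [h.one_snd, hF₁] using h.mul_fst 1 1

theorem inv_fst (x : K) :
    (e x⁻¹).1 = (ρ (e x).2⁻¹ (e x).1 * F (e x).2⁻¹ (e x).2)⁻¹ := by
  have := h.mul_fst x⁻¹ x
  rw [inv_mul_cancel, h.one_eq hF₁, h.inv_snd, mul_assoc] at this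
  exact eq_inv_of_mul_eq_one_left this.symm

theorem symm_one_mul (z : Z) (x : K) : e (e.symm (z, 1) * x) = (z * (e x).1, (e x).2) := by
  rw [h]; simp [hF₁]

theorem symm_mul_symm (z z' : Z) (g : Γ) : e.symm (z, 1) * e.symm (z', g) = e.symm (z * z', g) := by
  apply e.injective
  rw [h.symm_one_mul hF₁]
  simp

/-- The inclusion `Z → K`. -/
def incl : Z →* K where
  toFun z := e.symm (z, 1)
  map_one' := by rw [← h.one_eq hF₁, e.symm_apply_apply]
  map_mul' a b := (h.symm_mul_symm hF₁ a b 1).symm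

omit hF₁ in
/-- The projection `K → Γ`. -/
def proj : K →* Γ where
  toFun x := (e x).2
  map_one' := h.one_snd
  map_mul' := h.mul_snd

end Algebra

variable {LΓ : LieGroupStr 𝕜 Γ} {LZ : LieGroupStr 𝕜 Z}

theorem isLocalLie (h : IsTwisted ρ F e)
    (hρ : (LΓ.prod LZ.toSmoothMfd).Smooth LZ.toSmoothMfd (fun p : Γ × Z => ρ p.1 p.2))
    (hF : IsC2ss LΓ.toSmoothMfd LZ.toSmoothMfd F) :
    IsLocalLie ((LZ.prod LΓ.toSmoothMfd).transport e) := by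
  set B := (LZ.prod LΓ.toSmoothMfd).transport e with hB
  have h1 := h.one_eq hF.1.1
  have hfst : ∀ x, B.SmoothNear LZ.toSmoothMfd (fun x => (e x).1) x := fun x =>
    (transport_smoothNear (LZ.prod LΓ.toSmoothMfd) e x).fst
  have hsnd : ∀ x, B.SmoothNear LΓ.toSmoothMfd (fun x => (e x).2) x := fun x =>
    (transport_smoothNear (LZ.prod LΓ.toSmoothMfd) e x).snd
  have hact : ∀ {M : Type u} {A : SmoothMfd 𝕜 M} {f : M → Γ} {g : M → Z} {x : M},
      A.SmoothNear LΓ.toSmoothMfd f x → A.SmoothNear LZ.toSmoothMfd g x →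
      A.SmoothNear LZ.toSmoothMfd (fun y => ρ (f y) (g y)) x := fun hf hg =>
    (hρ.smoothNear _).comp₂ (m := fun a b => ρ a b) hf hg rfl rfl
  refine ⟨?_, ?_, fun g => ?_⟩
  · have f1 := (hfst 1).comp_of_eq (smoothNear_fst B B ((1 : K), (1 : K))) rfl
    have f2 := (hsnd 1).comp_of_eq (smoothNear_fst B B ((1 : K), (1 : K))) rfl
    have g1 := (hfst 1).comp_of_eq (smoothNear_snd B B ((1 : K), (1 : K))) rfl
    have g2 := (hsnd 1).comp_of_eq (smoothNear_snd B B ((1 : K), (1 : K))) rfl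
    refine SmoothNear.transport ?_
    simp only [h _ _]
    refine SmoothNear.prodMk ?_ (LΓ.smoothNear_mul f2 g2)
    exact LZ.smoothNear_mul (LZ.smoothNear_mul f1 (hact f2 g1))
      (hF.1.2.2.comp₂ (m := F) f2 g2 (by simp [h1]) (by simp [h1]))
  · refine SmoothNear.transport ?_
    have : ∀ x, e x⁻¹ = ((ρ (e x).2⁻¹ (e x).1 * F (e x).2⁻¹ (e x).2)⁻¹, (e x).2⁻¹) := fun x =>
      Prod.ext (h.inv_fst hF.1.1 x) (h.inv_snd x)
    simp only [this]
    have hi := LΓ.smoothNear_inv (hsnd 1)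
    exact (LZ.smoothNear_inv (LZ.smoothNear_mul (hact hi (hfst 1))
      (hF.1.2.2.comp₂ (m := F) hi (hsnd 1) (by simp [h1]) (by simp [h1])))).prodMk hi
  · refine SmoothNear.transport ?_
    have : ∀ x, e (g * x * g⁻¹) = (_, _) := fun x => Prod.ext (h.conj_fst g x) (h.conj_snd g x)
    simp only [this]
    have hc := (LΓ.smoothNear_conj (e g).2 _).comp (hsnd 1)
    refine SmoothNear.prodMk (LZ.smoothNear_mul (LZ.smoothNear_mul (LZ.smoothNear_mul
      (smoothNear_const _ _ _ _) (hact (smoothNear_const _ _ _ _) (hfst 1))) ?_)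
      (LZ.smoothNear_inv (hact hc (smoothNear_const _ _ _ _)))) hc
    -- This is where membership in C²_ss, and not just in C²_s, is needed.
    exact (hF.2 (e g).2).comp_of_eq (hsnd 1) (by simp [h1])

theorem exists_isStandardAlong (h : IsTwisted ρ F e)
    (hρ : (LΓ.prod LZ.toSmoothMfd).Smooth LZ.toSmoothMfd (fun p : Γ × Z => ρ p.1 p.2))
    (hF : IsC2ss LΓ.toSmoothMfd LZ.toSmoothMfd F) :
    ∃ L : LieGroupStr 𝕜 K, IsStandardAlong LΓ.toSmoothMfd LZ.toSmoothMfd e L := by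
  obtain ⟨L, hL, hL'⟩ := (h.isLocalLie hρ hF).exists_lieGroupStr
  refine ⟨L, ?_⟩
  set P := LZ.prod LΓ.toSmoothMfd with hP
  have hF₁ := hF.1.1
  have h1 := h.one_eq hF₁
  have h1' : e.symm (1, 1) = 1 := by rw [← h1, e.symm_apply_apply]
  have hs : P.SmoothNear L.toSmoothMfd e.symm (1, 1) :=
    hL.comp_of_eq (transport_symm_smoothNear P e (1, 1)) h1'
  have he : L.SmoothNear P e 1 := (transport_smoothNear P e 1).comp (f := fun x => x) hL'
  have hev : ∀ᶠ p in P.nhd (1, 1), P.SmoothNear L.toSmoothMfd e.symm p ∧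
      L.SmoothNear P e (e.symm p) := by
    refine hs.eventually.and (hs.tendsto.eventually ?_)
    rw [h1']
    exact he.eventually
  have ht : Tendsto (fun g : Γ => ((1 : Z), g)) (LΓ.nhd 1) (P.nhd (1, 1)) :=
    ((smoothNear_const LΓ.toSmoothMfd LZ.toSmoothMfd (1 : Z) 1).prodMk
      (smoothNear_id LΓ.toSmoothMfd 1)).tendsto
  -- `U` controls only the slice {1} × U. Left translations by elements of Z, which act on the first
  -- coordinate alone, extend both directions to all of Z × U.
  obtain ⟨U, hU, hUo, h1U⟩ := mem_nhd_iff.1 (ht.eventually hev)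
  have key : ∀ z, ∀ g ∈ U, P.SmoothNear L.toSmoothMfd e.symm (z, g) := by
    intro z g hg
    have a1 : P.SmoothNear P (fun p => (z⁻¹ * p.1, p.2)) (z, g) :=
      (LZ.smoothNear_mul (smoothNear_const _ _ _ _) (smoothNear_fst _ _ _)).prodMk
        (smoothNear_snd _ _ _)
    have a2 := (hU hg).1.comp_of_eq a1 (by simp)
    refine (L.smoothNear_mul (smoothNear_const _ _ (e.symm (z, 1)) _) a2).congr
      (Eventually.of_forall fun p => ?_)
    rw [h.symm_mul_symm hF₁, mul_inv_cancel_left]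
  have key' : ∀ x, (e x).2 ∈ U → L.SmoothNear P e x := by
    intro x hx
    have a1 := L.smoothNear_mul (smoothNear_const L.toSmoothMfd L.toSmoothMfd
      (e.symm ((e x).1, 1))⁻¹ x) (smoothNear_id L.toSmoothMfd x)
    have a2 : L.SmoothNear P e ((e.symm ((e x).1, 1))⁻¹ * x) := by
      have : (e.symm ((e x).1, 1))⁻¹ * x = e.symm (1, (e x).2) := by
        rw [inv_mul_eq_iff_eq_mul, h.symm_mul_symm hF₁, mul_one, e.symm_apply_apply]
      rw [this]
      exact (hU hx).2
    have a3 := a2.comp a1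
    refine ((LZ.smoothNear_mul (smoothNear_const _ _ (e x).1 _) a3.fst).prodMk a3.snd).congr
      (Eventually.of_forall fun y => ?_)
    rw [← h.symm_one_mul hF₁, mul_inv_cancel_left]
  have hO : L.IsOpenIn {x | (e x).2 ∈ U} := by
    rw [isOpenIn_iff_mem_nhd]
    intro x hx
    exact (key' x hx).snd.tendsto (hUo.mem_nhd hx)
  refine ⟨U, hUo, h1U, ?_, hO, (smoothOn_iff hO).2 fun x hx => key' x hx⟩
  rw [smoothOn_iff]
  · rintro ⟨z, g⟩ ⟨-, hg⟩
    exact key z g hg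
  · let := LZ.top
    let := LΓ.top
    exact IsOpen.prod isOpen_univ hUo

theorem smooth_proj (h : IsTwisted ρ F e) {L : LieGroupStr 𝕜 K}
    (hL : IsStandardAlong LΓ.toSmoothMfd LZ.toSmoothMfd e L) :
    L.Smooth LΓ.toSmoothMfd h.proj :=
  LieGroupStr.smooth_of_smoothNear_one L LΓ _ (hL.smoothNear h.one_snd).snd

theorem smooth_incl (h : IsTwisted ρ F e) (hF₁ : ∀ g, F 1 g = 1) {L : LieGroupStr 𝕜 K}
    (hL : IsStandardAlong LΓ.toSmoothMfd LZ.toSmoothMfd e L) :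
    LZ.Smooth L.toSmoothMfd (h.incl hF₁) := by
  rw [smooth_iff]
  intro z
  exact hL.mk_smoothNear (smoothNear_id _ _) (smoothNear_const _ _ 1 _) rfl

end IsTwisted

end Twisted

/-! ### Coset bundles -/

section CosetBundle

open SmoothMfd

variable {𝕜 : Type*} [RCLike 𝕜] {M H P B : Type u} [Group H] [Group P]
  {LH : LieGroupStr 𝕜 H} {LP : LieGroupStr 𝕜 P} {MB : SmoothMfd 𝕜 B} {A : SmoothMfd 𝕜 M}
  {ι : H →* P} {π : P → B}

/-- Near the identity, the homomorphism `ι` has a smooth left inverse on its image. -/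
def HasLocalRetraction (LH : LieGroupStr 𝕜 H) (LP : LieGroupStr 𝕜 P) (ι : H →* P) : Prop :=
  ∃ r : P → H, LP.SmoothNear LH.toSmoothMfd r 1 ∧ ∀ᶠ p in LP.nhd 1, ∀ h, ι h = p → r p = h

/-- A map into `H` is smooth if its composition with `ι` is smooth. -/
theorem HasLocalRetraction.smoothNear (hι : HasLocalRetraction LH LP ι) {k : M → H} {x : M}
    (hk : A.SmoothNear LP.toSmoothMfd (fun y => ι (k y)) x) :
    A.SmoothNear LH.toSmoothMfd k x := by
  obtain ⟨r, hr, hev⟩ := hι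
  have h1 : A.SmoothNear LP.toSmoothMfd (fun y => (ι (k x))⁻¹ * ι (k y)) x :=
    LP.smoothNear_mul (smoothNear_const _ _ _ _) hk
  have h2 := LH.smoothNear_mul (smoothNear_const A LH.toSmoothMfd (k x) x)
    (hr.comp_of_eq h1 (inv_mul_cancel _))
  refine h2.congr ?_
  have ht := h1.tendsto
  rw [inv_mul_cancel] at ht
  filter_upwards [ht.eventually hev] with y hy
  rw [hy ((k x)⁻¹ * k y) (by simp), mul_inv_cancel_left]

namespace IsCosetBundle

theorem hasLocalRetraction (h : IsCosetBundle LH LP MB ι π) : HasLocalRetraction LH LP ι := by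
  obtain ⟨U, hU, h1U, s, k, -, -, hk, hsk⟩ := h.local_triv (π 1)
  have hπ1 : π ⁻¹' U ∈ LP.nhd 1 := (h.smooth_proj.smoothNear 1).tendsto (hU.mem_nhd h1U)
  have hO : LP.IsOpenIn (π ⁻¹' U) := by
    rw [isOpenIn_iff_mem_nhd]
    exact fun x hx => (h.smooth_proj.smoothNear x).tendsto (hU.mem_nhd hx)
  -- The local section need not take the value 1 at π(1). The factor `(k 1)⁻¹` compensates:
  -- comparing the decompositions of 1 and ι(x) over the same base point gives k(ιx) = k(1)x.
  refine ⟨fun p => (k 1)⁻¹ * k p, LH.smoothNear_mul (smoothNear_const _ _ _ _)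
    (hk.smoothNear hO h1U), ?_⟩
  filter_upwards [hπ1] with p hp x hx
  subst hx
  have hπ : π (ι x) = π 1 := ((h.fibre _ _).2 ⟨x, by simp⟩).symm
  have e1 := hsk 1 h1U
  have e2 := hsk (ι x) hp
  rw [hπ] at e2
  apply h.injective
  rw [map_mul, map_inv, inv_mul_eq_iff_eq_mul]
  apply mul_left_cancel (a := s (π 1))
  rw [← e2, ← mul_assoc, ← e1, one_mul]

theorem exists_section (h : IsCosetBundle LH LP MB ι π) (b : B) :
    ∃ s : B → P, MB.SmoothNear LP.toSmoothMfd s b ∧ ∀ᶠ y in MB.nhd b, π (s y) = y := by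
  obtain ⟨U, hU, hb, s, k, hs, hπs, -, -⟩ := h.local_triv b
  exact ⟨s, hs.smoothNear hU hb, mem_of_superset (hU.mem_nhd hb) hπs⟩

/-- The fibre coordinate of p satisfies ι(k(p)) = s(π(p))⁻¹p, which is smooth in `P`; the local
retraction makes `k` itself smooth. -/
theorem of_section (inj : Function.Injective ι) (smooth_incl : LH.Smooth LP.toSmoothMfd ι)
    (hr : HasLocalRetraction LH LP ι) (smooth_proj : LP.Smooth MB π)
    (fibre : ∀ p p' : P, π p = π p' ↔ ∃ h : H, p' = p * ι h)
    (hs : ∀ b, ∃ s : B → P, MB.SmoothNear LP.toSmoothMfd s b ∧ ∀ᶠ y in MB.nhd b, π (s y) = y) :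
    IsCosetBundle LH LP MB ι π := by
  refine ⟨inj, smooth_incl, smooth_proj, fibre, fun b => ?_⟩
  obtain ⟨s, hs, hπ⟩ := hs b
  obtain ⟨U, hU, hUo, hb⟩ := mem_nhd_iff.1 (hs.eventually.and hπ)
  have hk : ∀ p, ∃ h : H, π p ∈ U → p = s (π p) * ι h := by
    intro p
    by_cases hp : π p ∈ U
    · obtain ⟨h, hh⟩ := (fibre _ p).1 (hU hp).2
      exact ⟨h, fun _ => hh⟩
    · exact ⟨1, fun h => absurd h hp⟩
  choose k hk using hk
  have hO : LP.IsOpenIn (π ⁻¹' U) := by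
    rw [isOpenIn_iff_mem_nhd]
    exact fun x hx => (smooth_proj.smoothNear x).tendsto (hUo.mem_nhd hx)
  refine ⟨U, hUo, hb, s, k, (smoothOn_iff hUo).2 fun y hy => (hU hy).1, fun y hy => (hU hy).2,
    (smoothOn_iff hO).2 fun p hp => hr.smoothNear ?_, hk⟩
  have h1 : LP.SmoothNear LP.toSmoothMfd (fun p => (s (π p))⁻¹ * p) p :=
    LP.smoothNear_mul (LP.smoothNear_inv ((hU hp).1.comp (smooth_proj.smoothNear p)))
      (smoothNear_id _ _)
  refine h1.congr ?_
  filter_upwards [hO.mem_nhd hp] with p' hp'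
  rw [eq_inv_mul_iff_mul_eq]
  exact (hk p' hp').symm

end IsCosetBundle

/-- The base of the bundle defined by a normal split Lie subgroup is a Lie group. -/
def IsSplitLieSubgroup.quotient {N : Subgroup P} [N.Normal] {LN : LieGroupStr 𝕜 N}
    {MQ : SmoothMfd 𝕜 (P ⧸ N)} (h : IsSplitLieSubgroup LP N LN MQ) : LieGroupStr 𝕜 (P ⧸ N) where
  toSmoothMfd := MQ
  smooth_mul := by
    rw [smooth_iff]
    rintro ⟨x, y⟩
    obtain ⟨s, hs, hsx⟩ := IsCosetBundle.exists_section h x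
    obtain ⟨t, ht, hty⟩ := IsCosetBundle.exists_section h y
    -- Multiplication on the base is locally π(s(x)t(y)) for smooth local sections `s` and `t`.
    have h1 := LP.smoothNear_mul (hs.comp (smoothNear_fst MQ MQ (x, y)))
      (ht.comp (smoothNear_snd MQ MQ (x, y)))
    refine ((h.smooth_proj.smoothNear _).comp h1).congr ?_
    filter_upwards [(smoothNear_fst MQ MQ (x, y)).tendsto.eventually hsx,
      (smoothNear_snd MQ MQ (x, y)).tendsto.eventually hty] with p h1 h2
    rw [QuotientGroup.mk_mul, h1, h2]
  smooth_inv := by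
    rw [smooth_iff]
    intro x
    obtain ⟨s, hs, hsx⟩ := IsCosetBundle.exists_section h x
    refine ((h.smooth_proj.smoothNear _).comp (LP.smoothNear_inv hs)).congr ?_
    filter_upwards [hsx] with p h1
    rw [QuotientGroup.mk_inv, h1]

section Extension

variable [Group B] {LB : LieGroupStr 𝕜 B} {q : P →* B}

/-- A local section near the identity suffices for the local triviality of an extension. -/
theorem IsLieGroupExtension.of_section (inj : Function.Injective ι)
    (exact : ι.range = q.ker) (surj : Function.Surjective q)
    (smooth_incl : LH.Smooth LP.toSmoothMfd ι)
    (hr : HasLocalRetraction LH LP ι) (smooth_proj : LP.Smooth LB.toSmoothMfd q)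
    {s : B → P} (hs : LB.SmoothNear LP.toSmoothMfd s 1) (hqs : ∀ᶠ y in LB.nhd 1, q (s y) = y) :
    IsLieGroupExtension LH LP LB ι q := by
  refine ⟨exact, surj, IsCosetBundle.of_section inj smooth_incl hr smooth_proj ?_ fun b => ?_⟩
  · intro p p'
    have : q p = q p' ↔ p⁻¹ * p' ∈ q.ker := by
      rw [MonoidHom.mem_ker, map_mul, map_inv, inv_mul_eq_one]
    rw [this, ← exact, MonoidHom.mem_range]
    exact exists_congr fun h => by rw [eq_inv_mul_iff_mul_eq, eq_comm]
  · obtain ⟨p, rfl⟩ := surj b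
    have h1 : LB.SmoothNear LB.toSmoothMfd (fun y => (q p)⁻¹ * y) (q p) :=
      LB.smoothNear_mul (smoothNear_const _ _ _ _) (smoothNear_id _ _)
    refine ⟨fun y => p * s ((q p)⁻¹ * y), LP.smoothNear_mul (smoothNear_const _ _ _ _)
      (hs.comp_of_eq h1 (inv_mul_cancel _)), ?_⟩
    have ht := h1.tendsto
    rw [inv_mul_cancel] at ht
    filter_upwards [ht.eventually hqs] with y hy
    rw [map_mul, hy, mul_inv_cancel_left]

end Extension

section Twisted

variable {Γ Z K : Type u} [Group Γ] [CommGroup Z] [Group K]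
  {ρ : Γ →* MulAut Z} {F : Γ → Γ → Z} {e : K ≃ Z × Γ}
  {LΓ : LieGroupStr 𝕜 Γ} {LZ : LieGroupStr 𝕜 Z} {L : LieGroupStr 𝕜 K}

theorem IsTwisted.isLieGroupExtension (h : IsTwisted ρ F e) (hF₁ : ∀ g, F 1 g = 1)
    (hL : IsStandardAlong LΓ.toSmoothMfd LZ.toSmoothMfd e L) :
    IsLieGroupExtension LZ L LΓ (h.incl hF₁) h.proj := by
  have hincl : ∀ z, e (h.incl hF₁ z) = (z, 1) := fun z => e.apply_symm_apply _
  refine IsLieGroupExtension.of_section (s := fun g => e.symm (1, g)) ?_ ?_ ?_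
    (h.smooth_incl hF₁ hL) ⟨fun x => (e x).1, (hL.smoothNear h.one_snd).fst, ?_⟩
    (h.smooth_proj hL) (hL.mk_smoothNear (smoothNear_const _ _ _ _) (smoothNear_id _ _) rfl) ?_
  · intro z z' hz
    have := hincl z
    rw [hz, hincl] at this
    exact (congrArg Prod.fst this).symm
  · ext x
    constructor
    · rintro ⟨z, rfl⟩
      exact congrArg Prod.snd (hincl z)
    · intro hx
      exact ⟨(e x).1, e.injective ((hincl _).trans (Prod.ext rfl hx.symm))⟩
  · intro g
    exact ⟨e.symm (1, g), congrArg Prod.snd (e.apply_symm_apply _)⟩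
  · refine Eventually.of_forall fun p z hz => ?_
    subst hz
    exact congrArg Prod.fst (hincl z)
  · exact Eventually.of_forall fun g => congrArg Prod.snd (e.apply_symm_apply _)

end Twisted

end CosetBundle

/-! ### Nonabelian cochains with values in a crossed module -/

section CrossedModuleCochains

variable {H P Γ : Type u} [Group H] [Group P] [Group Γ] {α : H →* P} {S : P →* MulAut H}

/-- By the Peiffer identity, conjugation by `c` is the action of α(c) = 1. -/
theorem mul_comm_of_peiffer (pf : ∀ h h' : H, S (α h) h' = h * h' * h⁻¹) {c : H} (hc : α c = 1)
    (h : H) : c * h = h * c := by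
  have := pf c h
  rw [hc, map_one, MulAut.one_apply] at this
  rw [eq_mul_inv_iff_mul_eq] at this
  exact this.symm

/-- The division-free form, convenient for rewriting: `dTwo` is the left factor by which
associativity of the factor system fails. -/
theorem dTwo_mul_mul {A : Type u} [Group A] (T : Γ → MulAut A) (ω : Γ → Γ → A) (x y z : Γ) :
    dTwo T ω x y z * (ω x y * ω (x * y) z) = T x (ω y z) * ω x (y * z) := by
  simp [dTwo, mul_assoc]

theorem dTwo_eq_of_mul_mul {A : Type u} [Group A] {T : Γ → MulAut A} {ω : Γ → Γ → A} {x y z : Γ}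
    {c : A} (h : c * (ω x y * ω (x * y) z) = T x (ω y z) * ω x (y * z)) :
    dTwo T ω x y z = c :=
  mul_right_cancel ((dTwo_mul_mul T ω x y z).trans h.symm)

section

variable (eqv : ∀ (g : P) (h : H), α (S g h) = g * α h * g⁻¹)
  (pf : ∀ h h' : H, S (α h) h' = h * h' * h⁻¹) {σ : Γ → P} {ω : Γ → Γ → H}
  (hω : ∀ x y, α (ω x y) = deltaMap σ x y)

include eqv hω in
-- Under `α` the action becomes conjugation and `ω` becomes δ_σ, so the claim is associativity of
-- σ(x)σ(y)σ(z) in `P`.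
theorem map_dTwo_eq_one (x y z : Γ) : α (dTwo (fun x => S (σ x)) ω x y z) = 1 := by
  simp only [dTwo, map_mul, map_inv, eqv, hω, deltaMap]
  simp only [mul_assoc x y z]
  group

include pf hω in
-- Since σ(x)σ(y) = δ_σ(x,y)σ(xy), the Peiffer identity shows that `S ∘ σ` is multiplicative up to
-- conjugation by ω(x,y).
theorem action_action (x y : Γ) (h : H) :
    S (σ x) (S (σ y) h) = ω x y * S (σ (x * y)) h * (ω x y)⁻¹ := by
  rw [← pf, hω, ← MulAut.mul_apply, ← MulAut.mul_apply, ← map_mul, ← map_mul, deltaMap,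
    inv_mul_cancel_right]

include eqv pf hω in
theorem dTwo_comm (x y z : Γ) (h : H) :
    dTwo (fun x => S (σ x)) ω x y z * h = h * dTwo (fun x => S (σ x)) ω x y z :=
  mul_comm_of_peiffer pf (map_dTwo_eq_one eqv hω x y z) h

include eqv pf hω in
/-- The differential of a nonabelian `2`-cochain over `δ_σ` is a `3`-cocycle. -/
theorem dTwo_cocycle {c : Γ → Γ → Γ → H} (hc : c = dTwo (fun x => S (σ x)) ω) (x y z w : Γ) :
    S (σ x) (c y z w) * (c x (y * z) w * c x y z) = c x y (z * w) * c (x * y) z w := by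
  have hcomm : ∀ x y z h, c x y z * h = h * c x y z := by
    subst hc; exact dTwo_comm eqv pf hω
  have hspec : ∀ x y z, S (σ x) (ω y z) * ω x (y * z) = c x y z * (ω x y * ω (x * y) z) := by
    subst hc; exact fun x y z => (dTwo_mul_mul (fun x => S (σ x)) ω x y z).symm
  -- The same word is reduced in two ways to a central factor times ω(x,y)ω(xy,z)ω(xyz,w). Here the
  -- bracket inside S(σ(x)) is resolved before the outer product.
  have way1 : S (σ x) (S (σ y) (ω z w) * ω y (z * w)) * ω x (y * (z * w)) =
      S (σ x) (c y z w) * (c x (y * z) w * c x y z) *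
        (ω x y * ω (x * y) z * ω (x * y * z) w) := by
    have h1 := hspec x (y * z) w
    rw [mul_assoc y z w] at h1
    calc _ = S (σ x) (c y z w) * (S (σ x) (ω y z) *
          (S (σ x) (ω (y * z) w) * ω x (y * (z * w)))) := by
          rw [hspec]; simp only [map_mul, mul_assoc]
      _ = S (σ x) (c y z w) * (c x (y * z) w * (S (σ x) (ω y z) * ω x (y * z)) *
          ω (x * (y * z)) w) := by
          rw [h1, ← mul_assoc (S (σ x) (ω y z)), ← hcomm]; simp only [mul_assoc]
      _ = _ := by rw [hspec]; simp only [mul_assoc]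
  -- Here S(σ(x)) is distributed first and S(σ(x))S(σ(y)) is rewritten by `action_action`.
  have way2 : S (σ x) (S (σ y) (ω z w) * ω y (z * w)) * ω x (y * (z * w)) =
      c x y (z * w) * c (x * y) z w * (ω x y * ω (x * y) z * ω (x * y * z) w) := by
    calc _ = ω x y * S (σ (x * y)) (ω z w) * (ω x y)⁻¹ *
          (S (σ x) (ω y (z * w)) * ω x (y * (z * w))) := by
          rw [map_mul, action_action pf hω]; simp only [mul_assoc]
      _ = c x y (z * w) * (ω x y * (S (σ (x * y)) (ω z w) * ω (x * y) (z * w))) := by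
          rw [hspec, ← mul_assoc _ (c x y (z * w)), ← hcomm]
          simp only [mul_assoc, inv_mul_cancel_left]
      _ = _ := by
          rw [hspec, ← mul_assoc (ω x y), ← hcomm]; simp only [mul_assoc]
  exact mul_right_cancel (way1.symm.trans way2)

/-- The change of a nonabelian `2`-cochain if the section `σ` is replaced by `α(h) σ`. -/
def twistCochain (S : P →* MulAut H) (σ : Γ → P) (ω : Γ → Γ → H) (h : Γ → H) (x y : Γ) : H :=
  h x * S (σ x) (h y) * ω x y * (h (x * y))⁻¹

include eqv hω in
theorem map_twistCochain (h : Γ → H) (x y : Γ) :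
    α (twistCochain S σ ω h x y) = deltaMap (fun x => α (h x) * σ x) x y := by
  simp only [twistCochain, map_mul, map_inv, eqv, hω, deltaMap]
  group

include eqv pf hω in
-- By the Peiffer identity the new action is the old one followed by conjugation by h(x), so the
-- factors `h` telescope. The old differential is central and can be moved out of the remaining
-- word.
theorem dTwo_twistCochain (h : Γ → H) (x y z : Γ) :
    dTwo (fun x => S (α (h x) * σ x)) (twistCochain S σ ω h) x y z =
      dTwo (fun x => S (σ x)) ω x y z := by
  have hcomm := dTwo_comm eqv pf hω
  have hspec := dTwo_mul_mul (fun x => S (σ x)) ω x y z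
  have hact := action_action pf hω
  set c := dTwo (fun x => S (σ x)) ω with hc
  apply dTwo_eq_of_mul_mul
  rw [map_mul, MulAut.mul_apply, pf]
  have h1 : S (σ x) (twistCochain S σ ω h y z) = S (σ x) (h y) *
      (ω x y * S (σ (x * y)) (h z) * (ω x y)⁻¹) * S (σ x) (ω y z) *
        (S (σ x) (h (y * z)))⁻¹ := by
    simp only [twistCochain, map_mul, map_inv, hact]
  rw [h1]
  simp only [twistCochain]
  calc _ = h x * S (σ x) (h y) * (ω x y * (S (σ (x * y)) (h z))) * (c x y z * ω (x * y) z) *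
        (h (x * y * z))⁻¹ := by
        rw [hcomm, hcomm]
        simp only [mul_assoc, inv_mul_cancel_left]
        rw [hcomm]
    _ = h x * S (σ x) (h y) * (ω x y * (S (σ (x * y)) (h z))) * (ω x y)⁻¹ *
        (c x y z * (ω x y * ω (x * y) z)) * (h (x * y * z))⁻¹ := by
        rw [hcomm x y z (ω (x * y) z), hcomm x y z (ω x y * _)]
        simp only [mul_assoc, inv_mul_cancel_left]
    _ = _ := by
        rw [hspec]
        simp only [mul_assoc, inv_mul_cancel_left]

end

/-- The change of a nonabelian `2`-cochain by a central factor. -/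
theorem dTwo_mul_central {A : Type u} [Group A] (T : Γ → MulAut A) (β ω : Γ → Γ → A)
    (hβ : ∀ x y a, β x y * a = a * β x y) (x y z : Γ) :
    dTwo T (fun x y => β x y * ω x y) x y z = dTwo T β x y z * dTwo T ω x y z := by
  have hinv : ∀ x y a, (β x y)⁻¹ * a = a * (β x y)⁻¹ := fun x y a => by
    rw [inv_mul_eq_iff_eq_mul, ← mul_assoc, hβ, mul_inv_cancel_right]
  have left : ∀ {b : A}, (∀ a, b * a = a * b) → ∀ w a, w * (b * a) = b * (w * a) := by
    intro b hb w a
    rw [← mul_assoc, ← hb, mul_assoc]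
  have c2 := hβ x (y * z)
  have c3 := hinv (x * y) z
  have c4 := hinv x y
  simp only [dTwo, map_mul, mul_inv_rev, mul_assoc]
  rw [← c4 (ω x y)⁻¹, left c3 (ω (x * y) z)⁻¹, left c4 (ω (x * y) z)⁻¹,
    left c3 (ω x (y * z)), left c4 (ω x (y * z)), left c2 (T x (ω y z)), left c3 (T x (ω y z)),
    left c4 (T x (ω y z))]

end CrossedModuleCochains

/-! ### Smoothness properties of nonabelian cochains -/

section SmoothCochains

open SmoothMfd

variable {𝕜 : Type*} [RCLike 𝕜] {M Γ H P Z : Type u} [Group Γ] [Group H] [Group P] [CommGroup Z]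
  {LΓ : LieGroupStr 𝕜 Γ} {LH : LieGroupStr 𝕜 H} {LP : LieGroupStr 𝕜 P} {LZ : LieGroupStr 𝕜 Z}
  {A : SmoothMfd 𝕜 M}

theorem smoothNear_action {S : P →* MulAut H}
    (hS : (LP.prod LH.toSmoothMfd).Smooth LH.toSmoothMfd (fun x : P × H => S x.1 x.2))
    {f : M → P} {g : M → H} {x : M} (hf : A.SmoothNear LP.toSmoothMfd f x)
    (hg : A.SmoothNear LH.toSmoothMfd g x) :
    A.SmoothNear LH.toSmoothMfd (fun y => S (f y) (g y)) x :=
  (hS.smoothNear _).comp₂ (m := fun a b => S a b) hf hg rfl rfl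

theorem mul_mul_inv_of_central {H : Type*} [Group H] {b₂ : H} (hb : ∀ h, b₂ * h = h * b₂)
    (b₁ w₁ w₂ : H) : b₁ * w₁ * (b₂ * w₂)⁻¹ = b₁ * b₂⁻¹ * (w₁ * w₂⁻¹) := by
  have : w₁ * (w₂⁻¹ * b₂⁻¹) = b₂⁻¹ * (w₁ * w₂⁻¹) := by
    rw [eq_inv_mul_iff_mul_eq, hb]
    simp [mul_assoc]
  rw [mul_inv_rev, mul_assoc, this, mul_assoc b₁]

/-- For general g the factor h(gx) need not be smooth near x = 1. It occurs in both values of the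
cochain because (gxg⁻¹)g = gx, and it cancels in the quotient. -/
theorem isC2ss_twistCochain {S : P →* MulAut H}
    (hS : (LP.prod LH.toSmoothMfd).Smooth LH.toSmoothMfd (fun x : P × H => S x.1 x.2))
    {σ : Γ → P} (hσ : IsC1s LΓ.toSmoothMfd LP.toSmoothMfd σ) {ω : Γ → Γ → H}
    (hω : IsC2ss LΓ.toSmoothMfd LH.toSmoothMfd ω) {h : Γ → H}
    (hh : IsC1s LΓ.toSmoothMfd LH.toSmoothMfd h) :
    IsC2ss LΓ.toSmoothMfd LH.toSmoothMfd (twistCochain S σ ω h) := by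
  refine ⟨⟨fun g => ?_, fun g => ?_, ?_⟩, fun g => ?_⟩
  · simp [twistCochain, hσ.1, hh.1, hω.1.1]
  · simp [twistCochain, hh.1, hω.1.2.1]
  · set B := LΓ.toSmoothMfd
    have h1 := smoothNear_fst B B ((1 : Γ), (1 : Γ))
    have h2 := smoothNear_snd B B ((1 : Γ), (1 : Γ))
    exact LH.smoothNear_mul (LH.smoothNear_mul (LH.smoothNear_mul (hh.2.comp_of_eq h1 rfl)
      (smoothNear_action hS (hσ.2.comp_of_eq h1 rfl) (hh.2.comp_of_eq h2 rfl))) hω.1.2.2)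
      (LH.smoothNear_inv (hh.2.comp_of_eq (LΓ.smoothNear_mul h1 h2) (mul_one _)))
  · have hc := LΓ.smoothNear_conj g 1
    have hid := smoothNear_id LΓ.toSmoothMfd 1
    have e1 := smoothNear_action hS (smoothNear_const LΓ.toSmoothMfd LP.toSmoothMfd (σ g) 1) hh.2
    have e2 := smoothNear_action hS (hσ.2.comp_of_eq hc (by simp))
      (smoothNear_const LΓ.toSmoothMfd LH.toSmoothMfd (h g) 1)
    refine (LH.smoothNear_mul (LH.smoothNear_mul (LH.smoothNear_mul (LH.smoothNear_mul
      (smoothNear_const _ _ (h g) _) e1) (hω.2 g)) (LH.smoothNear_inv e2))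
      (LH.smoothNear_inv (hh.2.comp_of_eq hc (by simp)))).congr (Eventually.of_forall fun x => ?_)
    simp [twistCochain, mul_assoc]

/-- β is recovered as ω'ω⁻¹; centrality turns its C²_ss expression into the quotient of those of ω'
and ω, and the retraction brings smoothness back to Z. -/
theorem isC2ss_of_map_mul {ι : Z →* H} (hr : HasLocalRetraction LZ LH ι)
    (inj : Function.Injective ι) (hι : ∀ z h, ι z * h = h * ι z) {β : Γ → Γ → Z}
    {ω ω' : Γ → Γ → H} (hω : IsC2ss LΓ.toSmoothMfd LH.toSmoothMfd ω)
    (hω' : IsC2ss LΓ.toSmoothMfd LH.toSmoothMfd ω') (hβ : ∀ x y, ω' x y = ι (β x y) * ω x y) :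
    IsC2ss LΓ.toSmoothMfd LZ.toSmoothMfd β := by
  have hβ' : ∀ x y, ι (β x y) = ω' x y * (ω x y)⁻¹ := fun x y => by
    rw [hβ, mul_inv_cancel_right]
  refine ⟨⟨fun g => ?_, fun g => ?_, hr.smoothNear ?_⟩, fun g => hr.smoothNear ?_⟩
  · apply inj
    rw [hβ', hω'.1.1, hω.1.1, mul_inv_cancel, map_one]
  · apply inj
    rw [hβ', hω'.1.2.1, hω.1.2.1, mul_inv_cancel, map_one]
  · simp only [hβ']
    exact LH.smoothNear_mul hω'.1.2.2 (LH.smoothNear_inv hω.1.2.2)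
  · refine (LH.smoothNear_mul (hω'.2 g) (LH.smoothNear_inv (hω.2 g))).congr
      (Eventually.of_forall fun x => ?_)
    rw [hβ, hβ, mul_mul_inv_of_central (hι _), mul_inv_cancel_right, map_mul, map_inv]

theorem isC2ss_map_mul {ι : Z →* H} (hs : LZ.Smooth LH.toSmoothMfd ι)
    (hι : ∀ z h, ι z * h = h * ι z) {β : Γ → Γ → Z}
    {ω : Γ → Γ → H} (hω : IsC2ss LΓ.toSmoothMfd LH.toSmoothMfd ω)
    (hβ : IsC2ss LΓ.toSmoothMfd LZ.toSmoothMfd β) :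
    IsC2ss LΓ.toSmoothMfd LH.toSmoothMfd (fun x y => ι (β x y) * ω x y) := by
  refine ⟨⟨fun g => ?_, fun g => ?_, ?_⟩, fun g => ?_⟩
  · simp [hβ.1.1, hω.1.1]
  · simp [hβ.1.2.1, hω.1.2.1]
  · exact LH.smoothNear_mul ((hs.smoothNear _).comp hβ.1.2.2) hω.1.2.2
  · refine (LH.smoothNear_mul ((hs.smoothNear _).comp (hβ.2 g)) (hω.2 g)).congr
      (Eventually.of_forall fun x => ?_)
    rw [mul_mul_inv_of_central (hι _), map_mul, map_inv]

theorem dTwo_map {T : Γ → MulAut H} {R : Γ → MulAut Z} {ι : Z →* H}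
    (h : ∀ x z, T x (ι z) = ι (R x z)) (β : Γ → Γ → Z) (x y z : Γ) :
    dTwo T (fun x y => ι (β x y)) x y z = ι (dTwo R β x y z) := by
  simp [dTwo, h]

theorem isC2ss_inv {β : Γ → Γ → Z} (hβ : IsC2ss LΓ.toSmoothMfd LZ.toSmoothMfd β) :
    IsC2ss LΓ.toSmoothMfd LZ.toSmoothMfd (fun x y => (β x y)⁻¹) := by
  refine ⟨⟨fun g => ?_, fun g => ?_, LZ.smoothNear_inv hβ.1.2.2⟩, fun g => ?_⟩
  · simp [hβ.1.1]
  · simp [hβ.1.2.1]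
  · exact (LZ.smoothNear_inv (hβ.2 g)).congr (Eventually.of_forall fun x => by simp [mul_comm])

theorem isC2ss_mul {β γ : Γ → Γ → Z} (hβ : IsC2ss LΓ.toSmoothMfd LZ.toSmoothMfd β)
    (hγ : IsC2ss LΓ.toSmoothMfd LZ.toSmoothMfd γ) :
    IsC2ss LΓ.toSmoothMfd LZ.toSmoothMfd (fun x y => β x y * γ x y) :=
  isC2ss_map_mul (ι := MonoidHom.id Z) (smooth_iff.2 (smoothNear_id _)) mul_comm hγ hβ

theorem dTwo_inv (ρ : Γ → MulAut Z) (β : Γ → Γ → Z) (x y z : Γ) :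
    dTwo ρ (fun x y => (β x y)⁻¹) x y z = (dTwo ρ β x y z)⁻¹ := by
  simp only [dTwo, map_inv, mul_inv]

theorem dTwo_mul (ρ : Γ → MulAut Z) (β γ : Γ → Γ → Z) (x y z : Γ) :
    dTwo ρ (fun x y => β x y * γ x y) x y z = dTwo ρ β x y z * dTwo ρ γ x y z :=
  dTwo_mul_central ρ β γ (fun _ _ _ => mul_comm _ _) x y z

theorem dTwo_one (ρ : Γ → MulAut Z) (x y z : Γ) : dTwo ρ (fun _ _ => 1) x y z = 1 := by
  simp [dTwo]

/-- The relation defining the quotient is already an equivalence, because coboundaries of C²_ss form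
a group, so it equals the relation it generates. -/
theorem H3ss.mk_eq_mk_iff {ρ : Γ →* MulAut Z} {c c' : Z3s LΓ.toSmoothMfd LZ.toSmoothMfd ρ} :
    H3ss.mk c = H3ss.mk c' ↔ ∃ β : Γ → Γ → Z, IsC2ss LΓ.toSmoothMfd LZ.toSmoothMfd β ∧
      ∀ x y z, c'.fn x y z = c.fn x y z * dTwo ρ β x y z := by
  have equiv : Equivalence (fun c c' : Z3s LΓ.toSmoothMfd LZ.toSmoothMfd ρ =>
      ∃ β : Γ → Γ → Z, IsC2ss LΓ.toSmoothMfd LZ.toSmoothMfd β ∧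
        ∀ x y z, c'.fn x y z = c.fn x y z * dTwo ρ β x y z) := by
    refine ⟨fun c => ?_, ?_, ?_⟩
    · refine ⟨fun _ _ => 1, ⟨⟨fun _ => rfl, fun _ => rfl, smoothNear_const _ _ _ _⟩,
        fun _ => smoothNear_const _ _ _ _⟩, fun x y z => ?_⟩
      rw [dTwo_one, mul_one]
    · rintro c c' ⟨β, hβ, h⟩
      refine ⟨_, isC2ss_inv hβ, fun x y z => ?_⟩
      rw [dTwo_inv, h, mul_inv_cancel_right]
    · rintro c c' c'' ⟨β, hβ, h⟩ ⟨γ, hγ, h'⟩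
      refine ⟨_, isC2ss_mul hβ hγ, fun x y z => ?_⟩
      rw [dTwo_mul, h', h, mul_assoc]
  exact Quot.eq.trans equiv.eqvGen_iff

end SmoothCochains

/-! ### The obstruction class -/

namespace CentralExt

open SmoothMfd

section

variable {𝕜 : Type*} [RCLike 𝕜] {Γ Z : Type u} [Group Γ] [CommGroup Z]

/-- The bijection of `Z ×_f Γ` with `Z × Γ`. -/
def equivProd {MΓ : SmoothMfd 𝕜 Γ} {MZ : SmoothMfd 𝕜 Z} (f : Z2ss MΓ MZ 1) :
    CentralExt f ≃ Z × Γ where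
  toFun x := (x.fst, x.snd)
  invFun p := ⟨p.1, p.2⟩
  left_inv _ := rfl
  right_inv _ := rfl

theorem isTwisted {MΓ : SmoothMfd 𝕜 Γ} {MZ : SmoothMfd 𝕜 Z} (f : Z2ss MΓ MZ 1) :
    IsTwisted 1 f.fn (equivProd f) := fun _ _ => rfl

theorem incl_comm {MΓ : SmoothMfd 𝕜 Γ} {MZ : SmoothMfd 𝕜 Z} (f : Z2ss MΓ MZ 1) (z : Z)
    (x : CentralExt f) : incl f z * x = x * incl f z := by
  refine CentralExt.ext ?_ ?_
  · simp [mul_fst, incl, f.c2ss.1.1, f.c2ss.1.2.1, mul_comm]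
  · simp [mul_snd, incl]

theorem incl_injective {MΓ : SmoothMfd 𝕜 Γ} {MZ : SmoothMfd 𝕜 Z} (f : Z2ss MΓ MZ 1) :
    Function.Injective (incl f) := fun _ _ h => congrArg fst h

theorem eq_incl {MΓ : SmoothMfd 𝕜 Γ} {MZ : SmoothMfd 𝕜 Z} {f : Z2ss MΓ MZ 1}
    {x : CentralExt f} (hx : x.snd = 1) : x = incl f x.fst := CentralExt.ext rfl hx

variable {LΓ : LieGroupStr 𝕜 Γ} {LZ : LieGroupStr 𝕜 Z} (f : Z2ss LΓ.toSmoothMfd LZ.toSmoothMfd 1)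

theorem exists_isStandard : ∃ L : LieGroupStr 𝕜 (CentralExt f), IsStandard L :=
  (isTwisted f).exists_isStandardAlong (smooth_iff.2 fun p => smoothNear_snd _ _ p) f.c2ss

variable {f} {L : LieGroupStr 𝕜 (CentralExt f)} (hL : IsStandard L)

include hL

theorem IsStandard.isStandardAlong :
    IsStandardAlong LΓ.toSmoothMfd LZ.toSmoothMfd (equivProd f) L := hL

theorem IsStandard.isLieGroupExtension : IsLieGroupExtension LZ L LΓ (incl f) (proj f) :=
  (isTwisted f).isLieGroupExtension f.c2ss.1.1 hL.isStandardAlong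

theorem IsStandard.hasLocalRetraction : HasLocalRetraction LZ L (incl f) :=
  hL.isLieGroupExtension.2.2.hasLocalRetraction

theorem IsStandard.smooth_incl : LZ.Smooth L.toSmoothMfd (incl f) :=
  hL.isLieGroupExtension.2.2.smooth_incl

end

end CentralExt

section Obstruction

open SmoothMfd CentralExt

variable {𝕜 : Type*} [RCLike 𝕜] {G Z : Type u} [Group G] [CommGroup Z]
  {N : Subgroup G} {LG : LieGroupStr 𝕜 G} {LZ : LieGroupStr 𝕜 Z}
  {LN : LieGroupStr 𝕜 N} {MQ : SmoothMfd 𝕜 (G ⧸ N)}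
  {ρ : G →* MulAut Z} {f : Z2ss LN.toSmoothMfd LZ.toSmoothMfd 1}

theorem alphaHom_eq_one {x : CentralExt f} (hx : alphaHom f x = 1) : x = incl f x.fst :=
  eq_incl (Subtype.ext hx)

theorem exists_incl_mul {x y : CentralExt f} (h : alphaHom f x = alphaHom f y) :
    ∃ z, x = incl f z * y := by
  refine ⟨_, mul_inv_eq_iff_eq_mul.1 (alphaHom_eq_one ?_)⟩
  rw [map_mul, map_inv, h, mul_inv_cancel]

variable [N.Normal] {θ : G → N → Z}
  {hθ : IsZ1ss LG LZ LN ρ f θ} {hc : IsCompatible ρ f θ} {L : LieGroupStr 𝕜 (CentralExt f)}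

theorem extAction_incl (g : G) (z : Z) :
    extAction hθ hc g (incl f z) = incl f (ρ g z) := by
  rw [extAction_apply]
  refine CentralExt.ext ?_ ?_
  · simp [incl, (hθ.c1s g).1]
  · simp [incl]

theorem IsFactorData.alphaHom_eq {σ : G ⧸ N → G} {ω : G ⧸ N → G ⧸ N → CentralExt f}
    (h : IsFactorData LG MQ L σ ω) (x y : G ⧸ N) : alphaHom f (ω x y) = deltaMap σ x y :=
  h.lift_eq x y

theorem quotAction_of_section (hρN : N ≤ ρ.ker) {σ : G ⧸ N → G}
    (hσ : ∀ x, (σ x : G ⧸ N) = x) (x : G ⧸ N) : quotAction ρ hρN x = ρ (σ x) := by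
  conv_lhs => rw [← hσ x]
  rfl

variable (hN : IsSplitLieSubgroup LG N LN MQ) (hL : IsStandard L)
  (hα : IsSmoothCrossedModule L LG (alphaHom f) (extAction hθ hc))

omit [N.Normal] in
include hN hL in
/-- A map of `N`-valued elements of `G` that is smooth near the identity lifts to `Z ×_f N`. -/
theorem isC1s_lift {Γ : Type u} [Group Γ] {MΓ : SmoothMfd 𝕜 Γ} {n : Γ → N}
    (hn : MΓ.SmoothNear LG.toSmoothMfd (fun x => (n x : G)) 1) (h1 : n 1 = 1) :
    IsC1s MΓ L.toSmoothMfd (fun x => (⟨1, n x⟩ : CentralExt f)) :=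
  ⟨CentralExt.ext rfl h1, hL.isStandardAlong.mk_smoothNear (smoothNear_const _ _ _ _)
    ((IsCosetBundle.hasLocalRetraction hN).smoothNear (k := n) hn) h1⟩

include hN hL in
theorem IsFactorData.exists_cocycle {σ : G ⧸ N → G} {ω : G ⧸ N → G ⧸ N → CentralExt f}
    (h : IsFactorData LG MQ L σ ω) :
    ∃ c : Z3s MQ LZ.toSmoothMfd (quotAction ρ hα.le_ker),
      ∀ x y z, dTwo (fun x => extAction hθ hc (σ x)) ω x y z = incl f (c.fn x y z) := by
  set S := extAction hθ hc with hS
  set d := dTwo (fun x => S (σ x)) ω with hd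
  have hinc : ∀ x y z, d x y z = incl f (d x y z).fst := fun x y z =>
    alphaHom_eq_one (map_dTwo_eq_one hα.equivariant h.alphaHom_eq x y z)
  have hω := h.c2ss
  have hσ := h.section_c1s
  refine ⟨⟨fun x y z => (d x y z).fst, ⟨?_, ?_, ?_, ?_⟩, ?_⟩, hinc⟩
  · intro x y
    simp [hd, dTwo, hσ.1, hω.1.1, one_fst]
  · intro x y
    simp [hd, dTwo, hω.1.1, hω.1.2.1, one_fst]
  · intro x y
    simp [hd, dTwo, hω.1.2.1, one_fst]
  -- Smoothness into Z is checked after inclusion in N̂, where `d` is a product of locally smooth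
  -- factors.
  · refine hL.hasLocalRetraction.smoothNear ?_
    simp only [← hinc]
    let LQ := hN.quotient
    have h1 := smoothNear_fst MQ (MQ.prod MQ) ((1 : G ⧸ N), (1 : G ⧸ N), (1 : G ⧸ N))
    have h23 := smoothNear_snd MQ (MQ.prod MQ) ((1 : G ⧸ N), (1 : G ⧸ N), (1 : G ⧸ N))
    have h2 := h23.fst
    have h3 := h23.snd
    have hm12 := LQ.smoothNear_mul h1 h2
    have hm23 := LQ.smoothNear_mul h2 h3
    exact L.smoothNear_mul (L.smoothNear_mul (L.smoothNear_mul
      (smoothNear_action hα.smooth_action (hσ.2.comp_of_eq h1 rfl)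
        (hω.1.2.2.comp₂ (m := ω) h2 h3 rfl rfl))
      (hω.1.2.2.comp₂ (m := ω) h1 hm23 rfl (mul_one _)))
      (L.smoothNear_inv (hω.1.2.2.comp₂ (m := ω) hm12 h3 (mul_one _) rfl)))
      (L.smoothNear_inv (hω.1.2.2.comp₂ (m := ω) h1 h2 rfl rfl))
  · intro x y z w
    have key := dTwo_cocycle hα.equivariant hα.peiffer h.alphaHom_eq hd x y z w
    rw [hinc y z w, hinc x (y * z) w, hinc x y z, hinc x y (z * w), hinc (x * y) z w, hS,
      extAction_incl, ← map_mul, ← map_mul, ← map_mul] at key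
    have key' := incl_injective f key
    rw [← quotAction_of_section hα.le_ker h.section_eq] at key'
    simp only [dThree]
    -- The negative terms are moved to the end so that the positive ones match `key'`.
    rw [mul_right_comm _ (d (x * y) z w).fst⁻¹, mul_right_comm _ (d (x * y) z w).fst⁻¹,
      mul_right_comm _ (d (x * y) z w).fst⁻¹, mul_right_comm _ (d x y (z * w)).fst⁻¹,
      mul_assoc _ (d x (y * z) w).fst, key']
    simp

include hN hL in
theorem IsFactorData.hasClass_of_isFactorData {σ σ' : G ⧸ N → G}
    {ω ω' : G ⧸ N → G ⧸ N → CentralExt f}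
    (h : IsFactorData LG MQ L σ ω) (h' : IsFactorData LG MQ L σ' ω')
    {Q : H3ss MQ LZ.toSmoothMfd (quotAction ρ hα.le_ker)}
    (hQ : HasClass (dTwo (fun x => extAction hθ hc (σ x)) ω) Q) :
    HasClass (dTwo (fun x => extAction hθ hc (σ' x)) ω') Q := by
  obtain ⟨c, hcω, rfl⟩ := hQ
  obtain ⟨c', hcω'⟩ := h'.exists_cocycle hN hL hα
  refine ⟨c', hcω', ((H3ss.mk_eq_mk_iff (LΓ := hN.quotient)).2 ?_).symm⟩
  have hmem : ∀ x, σ' x * (σ x)⁻¹ ∈ N := fun x => by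
    rw [← QuotientGroup.eq_one_iff, QuotientGroup.mk_mul, QuotientGroup.mk_inv, h.section_eq,
      h'.section_eq, mul_inv_cancel]
  -- The two sections differ by σ'σ⁻¹, which is N-valued; its lift to N̂ with Z-component 1 twists
  -- `ω` to a cochain over σ'.
  have hh := isC1s_lift hN hL (Γ := G ⧸ N) (n := fun x => ⟨σ' x * (σ x)⁻¹, hmem x⟩)
    (LG.smoothNear_mul h'.section_c1s.2 (LG.smoothNear_inv h.section_c1s.2))
    (Subtype.ext (by simp [h.section_c1s.1, h'.section_c1s.1]))
  set η : G ⧸ N → CentralExt f := fun x => ⟨1, ⟨σ' x * (σ x)⁻¹, hmem x⟩⟩ with hη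
  have hησ : (fun x => alphaHom f (η x) * σ x) = σ' :=
    funext fun x => inv_mul_cancel_right _ _
  set S := extAction hθ hc with hS
  have hα'' := map_twistCochain hα.equivariant h.alphaHom_eq η
  have hd'' := dTwo_twistCochain hα.equivariant hα.peiffer h.alphaHom_eq η
  have hω'' := isC2ss_twistCochain (LΓ := hN.quotient) hα.smooth_action h.section_c1s h.c2ss hh
  rw [hησ] at hα''
  have hd''' : ∀ x y z, dTwo (fun x => S (σ' x)) (twistCochain S σ ω η) x y z =
      incl f (c.fn x y z) := fun x y z => by
    rw [← hcω, ← hd'', ← hησ]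
  -- `ω'` and the twisted cochain both lie over δ_σ', so they differ by Z, and dβ is the difference
  -- of the cocycles.
  choose β hβ using fun x y => exists_incl_mul ((h'.alphaHom_eq x y).trans (hα'' x y).symm)
  refine ⟨β, isC2ss_of_map_mul hL.hasLocalRetraction (incl_injective f) (incl_comm f) hω''
    h'.c2ss hβ, fun x y z => incl_injective f ?_⟩
  have hω' : ω' = fun x y => incl f (β x y) * twistCochain S σ ω η x y :=
    funext fun x => funext fun y => hβ x y
  rw [← hcω', hω', dTwo_mul_central _ (fun x y => incl f (β x y)) _ (fun x y => incl_comm f _),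
    hd''', dTwo_map (R := quotAction ρ hα.le_ker), ← map_mul, mul_comm]
  intro x z
  rw [quotAction_of_section hα.le_ker h'.section_eq]
  exact extAction_incl _ _

end Obstruction

/-! ### Extensions of `G` that extend a given extension of `N` -/

section Extensions

open SmoothMfd

variable {𝕜 : Type*} [RCLike 𝕜] {M Γ H P B Z : Type u} [Group Γ] [Group H] [Group P] [Group B]
  [CommGroup Z] {LΓ : LieGroupStr 𝕜 Γ} {LH : LieGroupStr 𝕜 H} {LP : LieGroupStr 𝕜 P}
  {LB : LieGroupStr 𝕜 B} {LZ : LieGroupStr 𝕜 Z} {A : SmoothMfd 𝕜 M}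

theorem isC2ss_of_map {ι : H →* P} (hr : HasLocalRetraction LH LP ι)
    (inj : Function.Injective ι) {ω : Γ → Γ → H}
    (hω : IsC2ss LΓ.toSmoothMfd LP.toSmoothMfd (fun x y => ι (ω x y))) :
    IsC2ss LΓ.toSmoothMfd LH.toSmoothMfd ω := by
  refine ⟨⟨fun g => inj ?_, fun g => inj ?_, hr.smoothNear hω.1.2.2⟩, fun g => hr.smoothNear ?_⟩
  · rw [map_one]; exact hω.1.1 g
  · rw [map_one]; exact hω.1.2.1 g
  · simpa using hω.2 g

/-- As for twisted cochains, the uncontrolled factor h(gx) cancels; what remains is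
h(g)h(x)h(g)⁻¹h(gxg⁻¹)⁻¹. -/
theorem isC2ss_deltaMap {h : Γ → H} (hh : IsC1s LΓ.toSmoothMfd LH.toSmoothMfd h) :
    IsC2ss LΓ.toSmoothMfd LH.toSmoothMfd (deltaMap h) := by
  refine ⟨⟨fun g => ?_, fun g => ?_, ?_⟩, fun g => ?_⟩
  · simp [deltaMap, hh.1]
  · simp [deltaMap, hh.1]
  · set C := LΓ.toSmoothMfd
    have h1 := smoothNear_fst C C ((1 : Γ), (1 : Γ))
    have h2 := smoothNear_snd C C ((1 : Γ), (1 : Γ))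
    exact LH.smoothNear_mul (LH.smoothNear_mul (hh.2.comp_of_eq h1 rfl) (hh.2.comp_of_eq h2 rfl))
      (LH.smoothNear_inv (hh.2.comp_of_eq (LΓ.smoothNear_mul h1 h2) (mul_one _)))
  · have hc := LΓ.smoothNear_conj g 1
    refine (LH.smoothNear_mul ((LH.smoothNear_conj (h g) _).comp hh.2)
      (LH.smoothNear_inv (hh.2.comp_of_eq hc (by simp)))).congr (Eventually.of_forall fun x => ?_)
    simp [deltaMap, mul_assoc]

/-- A local section, divided by its value at 1, is used wherever it is a section; elsewhere any
preimage will do, since smoothness is demanded only near 1. -/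
theorem IsLieGroupExtension.exists_normalized_section {ι : H →* P} {q : P →* B}
    (h : IsLieGroupExtension LH LP LB ι q) :
    ∃ s : B → P, (∀ y, q (s y) = y) ∧ IsC1s LB.toSmoothMfd LP.toSmoothMfd s := by
  classical
  obtain ⟨s, hs, hqs⟩ := h.2.2.exists_section 1
  have hq1 : q (s 1) = 1 := self_of_eventually (p := fun y => q (s y) = y) hqs
  choose t ht using h.2.1
  have hev : ∀ᶠ y in LB.nhd 1, q (s y * (s 1)⁻¹) = y := by
    filter_upwards [hqs] with y hy
    rw [map_mul, map_inv, hq1, hy, inv_one, mul_one]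
  refine ⟨fun y => if q (s y * (s 1)⁻¹) = y then s y * (s 1)⁻¹ else t y, fun y => ?_, ?_, ?_⟩
  · by_cases hy : q (s y * (s 1)⁻¹) = y
    · simp only [if_pos hy]; exact hy
    · simp only [if_neg hy]; exact ht y
  · simp
  · refine (LP.smoothNear_mul hs (smoothNear_const _ LP.toSmoothMfd (s 1)⁻¹ _)).congr ?_
    filter_upwards [hev] with y hy
    rw [if_pos hy]

/-- The Lie group structure for which the isomorphism `φ` is a diffeomorphism. -/
def LieGroupStr.transport (L : LieGroupStr 𝕜 P) (φ : H ≃* P) : LieGroupStr 𝕜 H where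
  toSmoothMfd := L.toSmoothMfd.transport φ.toEquiv
  smooth_mul := by
    rw [smooth_iff]
    intro p
    refine SmoothNear.transport ?_
    have h := fun x => transport_smoothNear L.toSmoothMfd φ.toEquiv x
    refine (L.smoothNear_mul ((h p.1).comp (smoothNear_fst _ _ p))
      ((h p.2).comp (smoothNear_snd _ _ p))).congr (Eventually.of_forall fun x => ?_)
    exact map_mul φ _ _
  smooth_inv := by
    rw [smooth_iff]
    intro x
    refine SmoothNear.transport ?_
    refine (L.smoothNear_inv (transport_smoothNear L.toSmoothMfd φ.toEquiv x)).congr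
      (Eventually.of_forall fun x => ?_)
    exact map_inv φ _

theorem LieGroupStr.transport_smooth (L : LieGroupStr 𝕜 P) (φ : H ≃* P) :
    (L.transport φ).Smooth L.toSmoothMfd φ :=
  smooth_iff.2 fun x => transport_smoothNear L.toSmoothMfd φ.toEquiv x

theorem LieGroupStr.transport_symm_smooth (L : LieGroupStr 𝕜 P) (φ : H ≃* P) :
    L.Smooth (L.transport φ).toSmoothMfd φ.symm :=
  smooth_iff.2 fun x => transport_symm_smoothNear L.toSmoothMfd φ.toEquiv x

theorem IsLieGroupExtension.transport {ι : Γ →* P} {q : P →* B}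
    (h : IsLieGroupExtension LΓ LP LB ι q) (φ : H ≃* P) :
    IsLieGroupExtension LΓ (LP.transport φ) LB (φ.symm.toMonoidHom.comp ι)
      (q.comp φ.toMonoidHom) := by
  have hφ := LP.transport_smooth φ
  have hφ' := LP.transport_symm_smooth φ
  obtain ⟨s, hs, hqs⟩ := h.2.2.exists_section 1
  obtain ⟨r, hr, hev⟩ := h.2.2.hasLocalRetraction
  refine IsLieGroupExtension.of_section (s := fun y => φ.symm (s y))
    (φ.symm.injective.comp h.2.2.injective) ?_ (h.2.1.comp φ.surjective) ?_
    ⟨fun p => r (φ p), ?_, ?_⟩ ?_ ((hφ'.smoothNear _).comp hs) ?_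
  · ext x
    have := congrArg (fun K : Subgroup P => φ x ∈ K) h.1
    simp only [MonoidHom.mem_range, MonoidHom.mem_ker, eq_iff_iff] at this
    rw [MonoidHom.mem_range, MonoidHom.mem_ker]
    refine Iff.trans (exists_congr fun z => ?_) this
    exact φ.symm_apply_eq
  · exact smooth_iff.2 fun z => (hφ'.smoothNear _).comp (h.2.2.smooth_incl.smoothNear z)
  · exact hr.comp_of_eq (hφ.smoothNear 1) (map_one φ)
  · have ht := (hφ.smoothNear 1).tendsto
    rw [map_one] at ht
    filter_upwards [ht.eventually hev] with p hp z hz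
    exact hp z (φ.symm_apply_eq.1 hz)
  · exact smooth_iff.2 fun z => (h.2.2.smooth_proj.smoothNear _).comp (hφ.smoothNear z)
  · filter_upwards [hqs] with y hy
    exact (congrArg q (φ.apply_symm_apply _)).trans hy

/-- Smoothness of the inverse of a morphism of extensions which is the identity on the quotient
group and on the kernel. -/
theorem exists_smooth_inverse {ι : Z →* H} {q : H →* B} {ι' : Z →* P} {q' : P →* B}
    (h : IsLieGroupExtension LZ LH LB ι q) (h' : IsLieGroupExtension LZ LP LB ι' q')
    {φ : H →* P} (hφ : LH.Smooth LP.toSmoothMfd φ) (hι : ∀ z, φ (ι z) = ι' z)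
    (hq : ∀ x, q' (φ x) = q x) :
    ∃ r : P → H, (∀ p, φ (r p) = p) ∧ LP.SmoothNear LH.toSmoothMfd r 1 := by
  obtain ⟨s, hs, hs1, hss⟩ := h.exists_normalized_section
  -- Every `p` is ι'(k(p))·φ(s(q'(p))), so ι(k(p))·s(q'(p)) is a preimage of `p` depending smoothly
  -- on `p` near 1.
  have hex : ∀ p, ∃ z, ι' z = p * (φ (s (q' p)))⁻¹ := fun p => by
    have : p * (φ (s (q' p)))⁻¹ ∈ q'.ker := by
      rw [MonoidHom.mem_ker, map_mul, map_inv, hq, hs, mul_inv_cancel]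
    rwa [← h'.1] at this
  choose k hk using hex
  have hsq := hss.comp_of_eq (h'.2.2.smooth_proj.smoothNear 1) (map_one q')
  refine ⟨fun p => ι (k p) * s (q' p), fun p => ?_, LH.smoothNear_mul
    ((h.2.2.smooth_incl.smoothNear _).comp (h'.2.2.hasLocalRetraction.smoothNear ?_)) hsq⟩
  · rw [map_mul, hι, hk, inv_mul_cancel_right]
  · simp only [hk]
    exact LP.smoothNear_mul (smoothNear_id _ _)
      (LP.smoothNear_inv ((hφ.smoothNear _).comp hsq))

theorem injective_of_extension {ι : Z →* H} {q : H →* B} {ι' : Z →* P} {q' : P →* B}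
    (exact : ι.range = q.ker) (inj : Function.Injective ι')
    {φ : H →* P} (hι : ∀ z, φ (ι z) = ι' z) (hq : ∀ x, q' (φ x) = q x) :
    Function.Injective φ := by
  rw [injective_iff_map_eq_one]
  intro x hx
  have hx' : x ∈ ι.range := by
    rw [exact, MonoidHom.mem_ker, ← hq, hx, map_one]
  obtain ⟨z, rfl⟩ := hx'
  rw [hι, ← map_one ι'] at hx
  rw [inj hx, map_one]

end Extensions

/-! ### The extension defined by a cocycle on `G` -/

/-- The set underlying the extension `A ×_F Γ` defined by `F ∈ Z^2_ss(Γ, A)`. -/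
@[ext]
structure ModuleExt {𝕜 : Type*} [RCLike 𝕜] {Γ A : Type u} [Group Γ] [CommGroup A]
    {MΓ : SmoothMfd 𝕜 Γ} {MA : SmoothMfd 𝕜 A} {ρ : Γ →* MulAut A} (F : Z2ss MΓ MA ρ) where
  fst : A
  snd : Γ

namespace ModuleExt

variable {𝕜 : Type*} [RCLike 𝕜] {Γ A : Type u} [Group Γ] [CommGroup A]
  {MΓ : SmoothMfd 𝕜 Γ} {MA : SmoothMfd 𝕜 A} {ρ : Γ →* MulAut A}

theorem cocycle_eq (F : Z2ss MΓ MA ρ) (a b c : Γ) :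
    ρ a (F.fn b c) * F.fn a (b * c) = F.fn a b * F.fn (a * b) c := by
  have h := F.cocycle a b c
  rw [dTwo, mul_inv_eq_one, mul_inv_eq_iff_eq_mul] at h
  exact h

instance (F : Z2ss MΓ MA ρ) : Group (ModuleExt F) where
  mul x y := ⟨x.fst * ρ x.snd y.fst * F.fn x.snd y.snd, x.snd * y.snd⟩
  one := ⟨1, 1⟩
  inv x := ⟨(ρ x.snd⁻¹ x.fst * F.fn x.snd⁻¹ x.snd)⁻¹, x.snd⁻¹⟩
  mul_assoc x y z := by
    refine ModuleExt.ext ?_ (mul_assoc _ _ _)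
    change x.fst * ρ x.snd y.fst * F.fn x.snd y.snd * ρ (x.snd * y.snd) z.fst *
        F.fn (x.snd * y.snd) z.snd =
      x.fst * ρ x.snd (y.fst * ρ y.snd z.fst * F.fn y.snd z.snd) * F.fn x.snd (y.snd * z.snd)
    have h := cocycle_eq F x.snd y.snd z.snd
    calc _ = x.fst * ρ x.snd y.fst * ρ (x.snd * y.snd) z.fst *
          (F.fn x.snd y.snd * F.fn (x.snd * y.snd) z.snd) := by
          rw [mul_right_comm _ (F.fn x.snd y.snd), mul_assoc]
      _ = _ := by rw [← h]; simp only [map_mul, MulAut.mul_apply, mul_assoc]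
  one_mul x := by
    refine ModuleExt.ext ?_ (one_mul _)
    change 1 * ρ 1 x.fst * F.fn 1 x.snd = x.fst
    rw [F.c2ss.1.1]; simp
  mul_one x := by
    refine ModuleExt.ext ?_ (mul_one _)
    change x.fst * ρ x.snd 1 * F.fn x.snd 1 = x.fst
    rw [F.c2ss.1.2.1]; simp
  inv_mul_cancel x := by
    refine ModuleExt.ext ?_ (inv_mul_cancel _)
    change (ρ x.snd⁻¹ x.fst * F.fn x.snd⁻¹ x.snd)⁻¹ * ρ x.snd⁻¹ x.fst *
      F.fn x.snd⁻¹ x.snd = 1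
    rw [mul_assoc, inv_mul_cancel]

/-- The bijection of `A ×_F Γ` with `A × Γ`. -/
def equivProd (F : Z2ss MΓ MA ρ) : ModuleExt F ≃ A × Γ where
  toFun x := (x.fst, x.snd)
  invFun p := ⟨p.1, p.2⟩
  left_inv _ := rfl
  right_inv _ := rfl

theorem isTwisted (F : Z2ss MΓ MA ρ) : IsTwisted ρ F.fn (equivProd F) := fun _ _ => rfl

end ModuleExt

/-! ### From trivial obstruction to cocycle, from cocycle to extension, and from extension to
trivial obstruction -/

section Equivalence

open SmoothMfd CentralExt

variable {𝕜 : Type*} [RCLike 𝕜] {G Z : Type u} [Group G] [CommGroup Z]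
  {N : Subgroup G} {LG : LieGroupStr 𝕜 G} {LZ : LieGroupStr 𝕜 Z}
  {LN : LieGroupStr 𝕜 N} {MQ : SmoothMfd 𝕜 (G ⧸ N)}
  {ρ : G →* MulAut Z} {f : Z2ss LN.toSmoothMfd LZ.toSmoothMfd 1}
  [N.Normal] {θ : G → N → Z}
  {hθ : IsZ1ss LG LZ LN ρ f θ} {hc : IsCompatible ρ f θ} {L : LieGroupStr 𝕜 (CentralExt f)}
  (hN : IsSplitLieSubgroup LG N LN MQ) (hL : IsStandard L)
  (hα : IsSmoothCrossedModule L LG (alphaHom f) (extAction hθ hc))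

include hN hL

include hα in
/-- If the obstruction cocycle is trivial, then `f` and `θ` extend to `G`. -/
theorem IsFactorData.exists_extends {σ : G ⧸ N → G} {ω : G ⧸ N → G ⧸ N → CentralExt f}
    (h : IsFactorData LG MQ L σ ω)
    (hd : ∀ x y z, dTwo (fun x => extAction hθ hc (σ x)) ω x y z = 1) :
    ∃ F : Z2ss LG.toSmoothMfd LZ.toSmoothMfd ρ, Extends F f θ := by
  set S := extAction hθ hc with hS
  have hπ : LG.Smooth MQ (fun g => (g : G ⧸ N)) := hN.smooth_proj
  have hσ : IsC1s LG.toSmoothMfd LG.toSmoothMfd (fun g => σ g) :=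
    ⟨h.section_c1s.1, h.section_c1s.2.comp_of_eq (hπ.smoothNear 1) rfl⟩
  have hω : IsC2ss LG.toSmoothMfd L.toSmoothMfd (fun g g' : G => ω g g') := by
    refine ⟨⟨fun g => h.c2ss.1.1 g, fun g => h.c2ss.1.2.1 g, ?_⟩, fun g => ?_⟩
    · exact h.c2ss.1.2.2.comp₂ (m := ω)
        ((hπ.smoothNear _).comp (smoothNear_fst LG.toSmoothMfd LG.toSmoothMfd (1, 1)))
        ((hπ.smoothNear _).comp (smoothNear_snd LG.toSmoothMfd LG.toSmoothMfd (1, 1))) rfl rfl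
    · exact (h.c2ss.2 g).comp_of_eq (hπ.smoothNear 1) rfl
  have hmem : ∀ g : G, g * (σ g)⁻¹ ∈ N := fun g => by
    rw [← QuotientGroup.eq_one_iff, QuotientGroup.mk_mul, QuotientGroup.mk_inv, h.section_eq,
      mul_inv_cancel]
  have hη := isC1s_lift hN hL (n := fun g : G => ⟨g * (σ g)⁻¹, hmem g⟩)
    (LG.smoothNear_mul (smoothNear_id _ _) (LG.smoothNear_inv hσ.2))
    (Subtype.ext (by simpa using hσ.1))
  -- After pulling back to G, twisting by this η turns the section into the identity map, whose δ is
  -- 1; the twisted cochain is therefore Z-valued.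
  set η : G → CentralExt f := fun g => ⟨1, ⟨g * (σ g)⁻¹, hmem g⟩⟩ with hη_def
  have hησ : (fun g => alphaHom f (η g) * σ g) = fun g => g :=
    funext fun g => inv_mul_cancel_right _ _
  have hαω : ∀ g g' : G, alphaHom f (ω g g') = deltaMap (fun g : G => σ g) g g' :=
    fun g g' => h.alphaHom_eq g g'
  set Ω := twistCochain S (fun g : G => σ g) (fun g g' => ω g g') η with hΩ
  have hαΩ : ∀ g g', alphaHom f (Ω g g') = 1 := fun g g' => by
    rw [hΩ, map_twistCochain hα.equivariant hαω η, hησ]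
    simp [deltaMap]
  have hdΩ := dTwo_twistCochain hα.equivariant hα.peiffer hαω η
  rw [← hΩ] at hdΩ
  have hΩs := isC2ss_twistCochain hα.smooth_action hσ hω hη
  have hΩi : ∀ g g', Ω g g' = incl f (Ω g g').fst := fun g g' => alphaHom_eq_one (hαΩ g g')
  have hFs : IsC2ss LG.toSmoothMfd LZ.toSmoothMfd (fun g g' => (Ω g g').fst) := by
    refine isC2ss_of_map hL.hasLocalRetraction (incl_injective f) ?_
    simp only [← hΩi]
    exact hΩs
  -- On N the pulled-back σ and ω are trivial by normalization, so there the twisted cochain reduces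
  -- to η(n)η(n')η(nn')⁻¹, which is f.
  have hση : ∀ n : G, n ∈ N → σ n = 1 := fun n hn => by
    rw [(QuotientGroup.eq_one_iff n).2 hn, h.section_c1s.1]
  have hηn : ∀ n : N, η n = ⟨1, n⟩ := fun n =>
    CentralExt.ext rfl (Subtype.ext (by simp [hη_def, hση n n.2]))
  have hω1 : ∀ n ∈ N, ∀ g : G, ω n g = 1 := fun n hn g => by
    rw [(QuotientGroup.eq_one_iff n).2 hn, h.c2ss.1.1]
  have hω1' : ∀ n ∈ N, ∀ g : G, ω g n = 1 := fun n hn g => by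
    rw [(QuotientGroup.eq_one_iff n).2 hn, h.c2ss.1.2.1]
  refine ⟨⟨_, hFs, fun x y z => incl_injective f ?_⟩, fun n n' => incl_injective f ?_,
    fun g n => incl_injective f ?_⟩
  · rw [← dTwo_map (T := fun g => S g) (fun g z => extAction_incl g z), map_one]
    simp only [← hΩi]
    rw [show (fun x : G => S (alphaHom f (η x) * σ x)) = fun g => S g from
      funext fun g => congrArg (fun a => S a) (congrFun hησ g)] at hdΩ
    exact (hdΩ x y z).trans (hd x y z)
  · have hmul := hηn (n * n')
    rw [Subgroup.coe_mul] at hmul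
    rw [← hΩi]
    simp only [hΩ, twistCochain]
    rw [hηn, hηn, hmul, hω1 n n.2, hση n n.2, map_one, MulAut.one_apply, mul_one,
      mul_inv_eq_iff_eq_mul]
    refine CentralExt.ext ?_ ?_
    · simp [CentralExt.mul_fst, incl, f.c2ss.1.1]
    · simp [CentralExt.mul_snd, incl]
  · have hconj : g⁻¹ * n * g ∈ N := by
      simpa using (inferInstance : N.Normal).conj_mem n n.2 g⁻¹
    have hηc := hηn ⟨g⁻¹ * n * g, hconj⟩
    have hSg : S g (η (g⁻¹ * n * g)) = incl f (θ g n) * η n := by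
      have hn : MulAut.conjNormal g ⟨g⁻¹ * n * g, hconj⟩ = n := Subtype.ext (by
        simp [mul_assoc])
      rw [hηc, hηn, hS, extAction_apply, hn]
      refine CentralExt.ext ?_ ?_
      · simp [CentralExt.mul_fst, incl, f.c2ss.1.1]
      · simp [CentralExt.mul_snd, incl]
    -- Since α(η(g))σ(g) = g, conjugating by η(g) replaces the action of σ(g) by that of g, which
    -- produces the factor θ(g)(n).
    have hpf := hα.peiffer (η g) (S (σ g) (η (g⁻¹ * n * g)))
    rw [← MulAut.mul_apply, ← map_mul, congrFun hησ g, hSg] at hpf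
    rw [map_mul, map_inv, ← hΩi, ← hΩi]
    simp only [hΩ, twistCochain]
    rw [hω1 n n.2, hω1' _ hconj, hση n n.2, map_one, MulAut.one_apply]
    have e1 : g * (g⁻¹ * n * g) = n * g := by simp [mul_assoc]
    rw [e1, mul_one, mul_one, mul_inv_rev, inv_inv, mul_inv_rev]
    rw [← mul_assoc, ← mul_assoc, inv_mul_cancel_right, ← hpf, mul_inv_cancel_right]

/-- An equivariant extension defines factor data with trivial obstruction cocycle. -/
theorem HasEquivariantExtension.exists_factorData
    (hE : HasEquivariantExtension LG L (extAction hθ hc)) {σ : G ⧸ N → G}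
    (hσ : ∀ x, (σ x : G ⧸ N) = x) (hσs : IsC1s MQ LG.toSmoothMfd σ) :
    ∃ ω, IsFactorData LG MQ L σ ω ∧
      ∀ x y z, dTwo (fun x => extAction hθ hc (σ x)) ω x y z = 1 := by
  obtain ⟨Ghat, _, LGhat, ι, q, hext, LP, MP, hP, ιP, φ, hι, hPext, hφ, hφι, hφq, hequiv⟩ := hE
  obtain ⟨r₂, hr₂φ, hr₂⟩ := exists_smooth_inverse hL.isLieGroupExtension hPext hφ hφι hφq
  have hφinj : Function.Injective φ :=
    injective_of_extension hL.isLieGroupExtension.1 hPext.2.2.injective hφι hφq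
  obtain ⟨r₁, hr₁, hev⟩ := IsCosetBundle.hasLocalRetraction hP
  set j : CentralExt f →* Ghat := (N.comap q).subtype.comp φ with hj
  have hjinj : Function.Injective j := Subtype.val_injective.comp hφinj
  have hr₁1 : r₁ 1 = 1 := self_of_eventually (p := fun p => ∀ h, (N.comap q).subtype h = p →
    r₁ p = h) hev 1 (map_one _)
  -- Compose a retraction onto q⁻¹(N) with the local inverse of φ; `hr₁1` ensures that they meet at
  -- 1.
  have hjr : HasLocalRetraction L LGhat j := by
    refine ⟨fun p => r₂ (r₁ p), hr₂.comp_of_eq hr₁ hr₁1, ?_⟩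
    filter_upwards [hev] with p hp x hx
    apply hφinj
    rw [hr₂φ, hp (φ x) hx]
  obtain ⟨s, hs, hss⟩ := hext.exists_normalized_section
  -- The lift s ∘ σ of σ to Ĝ. Equivariance makes the action of σ(x) on N̂ conjugation by s(σ(x)),
  -- so for ω = δ of this lift the differential is trivial by associativity in Ĝ.
  have hŝ : IsC1s MQ LGhat.toSmoothMfd (fun x => s (σ x)) :=
    ⟨by simp only [hσs.1, hss.1], hss.2.comp_of_eq hσs.2 hσs.1⟩
  have hqD : ∀ x y, q (deltaMap (fun x => s (σ x)) x y) = deltaMap σ x y := fun x y => by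
    simp only [deltaMap, map_mul, map_inv, hs]
  have hex : ∀ x y, ∃ w, j w = deltaMap (fun x => s (σ x)) x y := fun x y => by
    have hmem : deltaMap (fun x => s (σ x)) x y ∈ N.comap q := by
      rw [Subgroup.mem_comap, hqD, ← QuotientGroup.eq_one_iff]
      simp only [deltaMap, QuotientGroup.mk_mul, QuotientGroup.mk_inv, hσ]
      exact mul_inv_cancel _
    exact ⟨r₂ ⟨_, hmem⟩, congrArg Subtype.val (hr₂φ _)⟩
  choose ω hω using hex
  have hjq : ∀ x, q (j x) = (CentralExt.proj f x : G) := fun x => congrArg Subtype.val (hφq x)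
  refine ⟨ω, ⟨hσ, hσs, isC2ss_of_map (LΓ := hN.quotient) hjr hjinj ?_, fun x y => ?_⟩,
    fun x y z => dTwo_eq_of_mul_mul (hjinj ?_)⟩
  · simp only [hω]
    exact isC2ss_deltaMap (LΓ := hN.quotient) hŝ
  · rw [← hjq, hω, hqD]
  · have hact : j (extAction hθ hc (σ x) (ω y z)) = s (σ x) * j (ω y z) * (s (σ x))⁻¹ := by
      have := hequiv (s (σ x)) (ω y z)
      rwa [hs] at this
    simp only [map_mul, hact, hω, map_one, deltaMap, mul_assoc x y z]
    group

include hα in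
/-- A cocycle on `G` that extends `f` and `θ` defines an equivariant extension. -/
theorem Extends.hasEquivariantExtension
    (hρ : (LG.prod LZ.toSmoothMfd).Smooth LZ.toSmoothMfd (fun p : G × Z => ρ p.1 p.2))
    {F : Z2ss LG.toSmoothMfd LZ.toSmoothMfd ρ} (hF : Extends F f θ) :
    HasEquivariantExtension LG L (extAction hθ hc) := by
  have htw := ModuleExt.isTwisted F
  obtain ⟨LE, hLE⟩ := htw.exists_isStandardAlong hρ F.c2ss
  have hext := htw.isLieGroupExtension F.c2ss.1.1 hLE
  set q : ModuleExt F →* G := htw.proj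
  have hρN : ∀ (n : N) z, ρ n z = z := fun n z => by
    have := hα.le_ker n.2
    rw [MonoidHom.mem_ker] at this
    rw [this, MulAut.one_apply]
  let φ : CentralExt f ≃* N.comap q :=
    { toFun := fun x => ⟨⟨x.fst, x.snd⟩, x.snd.2⟩
      invFun := fun p => ⟨p.1.fst, ⟨p.1.snd, p.2⟩⟩
      left_inv := fun _ => rfl
      right_inv := fun _ => rfl
      -- Multiplicativity uses that N acts trivially on Z and that `F` restricts to `f`.
      map_mul' := fun x y => Subtype.ext (ModuleExt.ext (by
        change x.fst * y.fst * f.fn x.snd y.snd = x.fst * ρ x.snd y.fst * F.fn x.snd y.snd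
        rw [hρN, hF.1]) rfl) }
  -- The subgroup q⁻¹(N) takes its structure from N̂ and the coset space from G/N; what remains is
  -- to check that they fit the Lie group Ĝ.
  let LP := L.transport φ.symm
  let ψ : ModuleExt F ⧸ N.comap q ≃ G ⧸ N :=
    Equiv.ofBijective (QuotientGroup.map (N.comap q) N q le_rfl) (by
      constructor
      · rw [injective_iff_map_eq_one]
        intro x
        induction x using QuotientGroup.induction_on with | H x => ?_
        intro hx
        exact (QuotientGroup.eq_one_iff x).2 ((QuotientGroup.eq_one_iff (q x)).1 hx)
      · intro y
        induction y using QuotientGroup.induction_on with | H y => ?_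
        obtain ⟨x, rfl⟩ := hext.2.1 y
        exact ⟨(x : ModuleExt F ⧸ N.comap q), rfl⟩)
  have hLP : L.Smooth LP.toSmoothMfd φ := L.transport_symm_smooth φ.symm
  have hLP' : LP.Smooth L.toSmoothMfd φ.symm := L.transport_smooth φ.symm
  have hj : L.Smooth LE.toSmoothMfd ((N.comap q).subtype.comp φ.toMonoidHom) := by
    refine LieGroupStr.smooth_of_smoothNear_one L LE _ ?_
    have he : L.SmoothNear (LZ.prod LN.toSmoothMfd) (CentralExt.equivProd f) 1 :=
      hL.isStandardAlong.smoothNear rfl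
    exact hLE.mk_smoothNear he.fst ((hN.smooth_incl.smoothNear _).comp he.snd) rfl
  obtain ⟨r, hr, hev⟩ := IsCosetBundle.hasLocalRetraction hN
  have hr1 : r 1 = 1 := self_of_eventually (p := fun p => ∀ h, N.subtype h = p → r p = h) hev 1
    (map_one _)
  have heE : LE.SmoothNear (LZ.prod LG.toSmoothMfd) (ModuleExt.equivProd F) 1 :=
    hLE.smoothNear rfl
  have hsplit : IsSplitLieSubgroup LE (N.comap q) LP (MQ.transport ψ) := by
    refine IsCosetBundle.of_section Subtype.val_injective ?_ ?_ ?_ ?_ ?_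
    · exact smooth_iff.2 fun x => (hj.smoothNear _).comp (hLP'.smoothNear x)
    -- A retraction of G onto N, applied to the second coordinate, retracts Ĝ onto q⁻¹(N) near 1.
    · refine ⟨fun p => φ ⟨p.fst, r p.snd⟩, (hLP.smoothNear _).comp
        (hL.isStandardAlong.mk_smoothNear heE.fst (hr.comp_of_eq heE.snd rfl) hr1), ?_⟩
      filter_upwards [heE.snd.tendsto.eventually hev] with p hp x hx
      subst hx
      refine Subtype.ext (ModuleExt.ext rfl ?_)
      exact congrArg Subtype.val (hp ⟨x.1.snd, x.2⟩ rfl)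
    · refine smooth_iff.2 fun x => SmoothNear.transport ?_
      exact (hN.smooth_proj.smoothNear _).comp (hext.2.2.smooth_proj.smoothNear x)
    · intro p p'
      rw [QuotientGroup.eq]
      constructor
      · intro h
        exact ⟨⟨_, h⟩, (mul_inv_cancel_left p p').symm⟩
      · rintro ⟨h, rfl⟩
        rw [inv_mul_cancel_left]
        exact h.2
    · intro b
      obtain ⟨s, hs, hπs⟩ := IsCosetBundle.exists_section hN (ψ b)
      obtain ⟨t, ht, hqt⟩ := hext.2.2.exists_section (s (ψ b))
      have hψ := transport_smoothNear MQ ψ b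
      have hsψ := hs.comp hψ
      -- A local section over G/N is lifted from G to Ĝ by a local section of `q`.
      refine ⟨fun y => t (s (ψ y)), ht.comp (f := fun y => s (ψ y)) hsψ, ?_⟩
      filter_upwards [hψ.tendsto.eventually hπs, hsψ.tendsto.eventually hqt] with y h1 h2
      apply ψ.injective
      change ((q (t (s (ψ y))) : G) : G ⧸ N) = ψ y
      exact (congrArg (fun g : G => (g : G ⧸ N)) h2).trans h1
  refine ⟨ModuleExt F, inferInstance, LE, htw.incl F.c2ss.1.1, q, hext, LP, MQ.transport ψ, hsplit,
    φ.toMonoidHom.comp (CentralExt.incl f), φ.toMonoidHom, fun z => rfl, ?_, hLP, fun z => rfl,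
    fun x => rfl, fun a x => ?_⟩
  · exact hL.isLieGroupExtension.transport φ.symm
  -- Cleared of inverses, equivariance is the identity expressing θ through `F`, since the first
  -- component of `a` cancels.
  · rw [eq_mul_inv_iff_mul_eq]
    have hθF := hF.2 (q a) (MulAut.conjNormal (q a) x.snd)
    have e1 : (q a)⁻¹ * ((MulAut.conjNormal (q a) x.snd : N) : G) * q a = x.snd := by
      simp [mul_assoc]
    rw [e1] at hθF
    refine ModuleExt.ext ?_ ?_
    · change ρ (q a) x.fst * θ (q a) (MulAut.conjNormal (q a) x.snd) *
          ρ (MulAut.conjNormal (q a) x.snd : N) a.fst *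
          F.fn (MulAut.conjNormal (q a) x.snd : N) (q a) =
        a.fst * ρ (q a) x.fst * F.fn (q a) x.snd
      rw [hρN, ← hθF, mul_right_comm, ← mul_assoc, inv_mul_cancel_right, mul_right_comm,
        mul_comm (ρ _ _)]
    · change ((MulAut.conjNormal (q a) x.snd : N) : G) * q a = q a * x.snd
      simp

end Equivalence

/-! ### The main theorem -/

theorem mainTheorem5 {𝕜 : Type*} [RCLike 𝕜] {G Z : Type u} [Group G] [CommGroup Z]
    (LG : LieGroupStr 𝕜 G) (LZ : LieGroupStr 𝕜 Z)
    (ρ : G →* MulAut Z)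
    (hρ : (LG.prod LZ.toSmoothMfd).Smooth LZ.toSmoothMfd (fun p : G × Z => ρ p.1 p.2))
    (N : Subgroup G) [N.Normal] (LN : LieGroupStr 𝕜 N) (MQ : SmoothMfd 𝕜 (G ⧸ N))
    (hN : IsSplitLieSubgroup LG N LN MQ)
    (f : Z2ss LN.toSmoothMfd LZ.toSmoothMfd 1) :
    (∃ L : LieGroupStr 𝕜 (CentralExt f), CentralExt.IsStandard L) ∧
    ∀ (L : LieGroupStr 𝕜 (CentralExt f)) (_ : CentralExt.IsStandard L)
      (θ : G → N → Z) (hθ : IsZ1ss LG LZ LN ρ f θ) (hc : IsCompatible ρ f θ)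
      (hα : IsSmoothCrossedModule L LG (alphaHom f) (extAction hθ hc))
      (σ : G ⧸ N → G) (ω : G ⧸ N → G ⧸ N → CentralExt f) (_ : IsFactorData LG MQ L σ ω),
      ∃ Q : H3ss MQ LZ.toSmoothMfd (quotAction ρ hα.le_ker),
        HasClass (dTwo (fun x => extAction hθ hc (σ x)) ω) Q ∧
        (∀ (σ' : G ⧸ N → G) (ω' : G ⧸ N → G ⧸ N → CentralExt f), IsFactorData LG MQ L σ' ω' →
          HasClass (dTwo (fun x => extAction hθ hc (σ' x)) ω') Q) ∧
        List.TFAE [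
          Q = H3ss.trivial MQ LZ.toSmoothMfd (quotAction ρ hα.le_ker),
          HasEquivariantExtension LG L (extAction hθ hc),
          ∃ F : Z2ss LG.toSmoothMfd LZ.toSmoothMfd ρ, Extends F f θ] := by
  refine ⟨CentralExt.exists_isStandard f, fun L hL θ hθ hc hα σ ω h => ?_⟩
  obtain ⟨c, hcω⟩ := h.exists_cocycle hN hL hα
  have hQ : HasClass (dTwo (fun x => extAction hθ hc (σ x)) ω) (H3ss.mk c) := ⟨c, hcω, rfl⟩
  have hind := fun σ' ω' (h' : IsFactorData LG MQ L σ' ω') =>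
    h.hasClass_of_isFactorData hN hL hα h' hQ
  refine ⟨H3ss.mk c, hQ, hind, ?_⟩
  tfae_have 1 → 3 := by
    intro htriv
    -- Here c·dβ = 1, so the central correction βω is again factor data for σ and has trivial
    -- differential.
    obtain ⟨β, hβ, hcβ⟩ := (H3ss.mk_eq_mk_iff (LΓ := hN.quotient)).1 htriv
    have hβω : ∀ x y, (CentralExt.proj f (CentralExt.incl f (β x y) * ω x y) : G) =
        deltaMap σ x y := fun x y => by
      rw [map_mul, ← h.lift_eq]
      exact congrArg Subtype.val (one_mul _)
    have h' : IsFactorData LG MQ L σ (fun x y => CentralExt.incl f (β x y) * ω x y) :=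
      ⟨h.section_eq, h.section_c1s, isC2ss_map_mul (LΓ := hN.quotient) hL.smooth_incl
        (CentralExt.incl_comm f) h.c2ss hβ, hβω⟩
    refine h'.exists_extends hN hL hα fun x y z => ?_
    rw [dTwo_mul_central _ (fun x y => CentralExt.incl f (β x y)) _
      (fun x y => CentralExt.incl_comm f _), hcω, dTwo_map (R := quotAction ρ hα.le_ker),
      ← map_mul, mul_comm, ← hcβ x y z]
    · exact map_one _
    · intro x z
      rw [quotAction_of_section hα.le_ker h.section_eq]
      exact extAction_incl _ _
  tfae_have 3 → 2 := fun ⟨F, hF⟩ => hF.hasEquivariantExtension hN hL hα hρ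
  tfae_have 2 → 1 := by
    intro hE
    -- The extension supplies another ω' over the same σ with trivial differential; independence of
    -- the class transfers this to `Q`.
    obtain ⟨ω', h', hd⟩ := hE.exists_factorData hN hL h.section_eq h.section_c1s
    obtain ⟨c', hc', hQ'⟩ := hind σ ω' h'
    rw [← hQ']
    have hc1 : ∀ x y z, c'.fn x y z = 1 := fun x y z => CentralExt.incl_injective f (by
      rw [← hc', hd, map_one])
    refine (H3ss.mk_eq_mk_iff (LΓ := hN.quotient)).2 ⟨fun _ _ => 1, ⟨⟨fun _ => rfl, fun _ => rfl,
      SmoothMfd.smoothNear_const _ _ _ _⟩, fun _ => SmoothMfd.smoothNear_const _ _ _ _⟩,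
      fun x y z => ?_⟩
    rw [dTwo_one, hc1, mul_one]
    rfl
  tfae_finish
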